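/- **Setting.** Consider the semi-discrete equation $t_{1x}=f(x,t,t_1,t_x)$ for $t=t(n,x)$, $n\in\mathbb Z$, where $t_k=t(n+k,x)$. Let $f$ be real analytic on an open set $\Omega\subset\mathbb R^4$, injective in $t_x$ on $\Omega$ (so that $t_{-1x}=g(x,t_{-1},t,t_x)$ is determined), with $f_{t_x}\neq0$ and $f_{t_xt_x}\ne 0$ on $\Omega$. Fix a trajectory $(x_0,\tau_n,\xi_n)_{n\in\mathbb Z}$, that is, $(x_0,\tau_n,\tau_{n+1},\xi_n)\in\Omega$ and $\xi_{n+1}=f(x_0,\tau_n,\tau_{n+1},\xi_n)$ for all $n$, and assume that all points $(x_0,\tau_n,\tau_{n+1},\tau_{n+2},\xi_n)$ lie in one connected component of the set of $(x,t,t_1,t_2,t_x)$ with $(x,t,t_1,t_x)\in\Omega$ and $(x,t_1,t_2,f(x,t,t_1,t_x))\in\Omega$. Let $P_n$ be the point $x=x_0$, $t_x=\xi_n$, $t_k=\tau_{n+k}$ $(k\in\mathbb Z)$. Functions are germs of real analytic functions of finitely many of the variables $x,t_x,t_k$ $(k\in\mathbb Z)$. The shift $D$ replaces $t_k$ by $t_{k+1}$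 and $t_x$ by $f$; it sends germs at $P_{n+1}$ to germs at $P_n$. Let $X=\partial_{t_x}$ and $K=\partial_x+t_x\partial_t+f\partial_{t_1}+g\partial_{t_{-1}}+\cdots$ (the coefficient of $\partial_{t_k}$ is $t_{kx}$ expressed through $x,t_x,t_j$). The characteristic ring $L_x$ (near $P_0$) is generated by $X$ and $K$ under sums, multiplication by functions, and commutators. Put $C_1=[X,K]$, $C_{n}=[X,C_{n-1}]$, $Z_1=[K,C_1]$. "Basis of $L_x$" means basis over the fractions of functions: linearly independent elements of $L_x$ such that each element of $L_x$ has a multiple, by a function that is not identically zero, in their linear span. Put $$p=\frac{f_x+t_xf_t+ff_{t_1}}{f_{t_x}},\quad v=f_t+f_{t_x}f_{t_1},\quad w=f_{xt_x}+t_xf_{t_xt}+ff_{t_xt_1},\quad h=f_{t_xt_xt_x}f_{t_x}-3f_{t_xt_x}^2 .$$ **Systems.** For $i=2,3$ consider, for unknown functions $u,\bar u$, the system $$E_{11}u+E_{12}Du=F_1,\qquad E_{22}Du+E_{23}\bar u+E_{24}D\bar u=F_2,\qquad E_{32}Du+E_{34}D\bar u=F_3$$ which corresponds to $[C_1,C_2]=\bar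 uC_2+uC_3$ for $i=2$ and to $C_4=\bar uC_2+uC_3$ for $i=3$. For $i=2$: $$E_{11}=1,\ E_{12}=-1,\ F_1=\frac v{f_{t_x}},\ E_{22}=\frac{3f_{t_xt_x}}{f_{t_x}^2},\ E_{23}=\frac1{f_{t_x}},\ E_{24}=-1,\ E_{32}=\frac h{f_{t_x}^2},\ E_{34}=f_{t_xt_x},$$ $$F_2=\frac{2(f_{tt_x}+f_{t_x}f_{t_1t_x})}{f_{t_x}^2}-\frac{3f_{t_xt_x}v-f_{t_xt_x}f_t}{f_{t_x}^3},$$ $$F_3=\frac{f_{tt_xt_x}+f_{t_x}f_{t_1t_xt_x}-3f_{t_xt_x}f_{t_1t_x}}{f_{t_x}}-\frac{2f_{t_xt_x}f_{tt_x}}{f_{t_x}^2}-\frac{f_{t_xt_x}^2f_t+vh}{f_{t_x}^3}.$$ For $i=3$: $$E_{11}=\frac1{f_{t_x}},\ E_{12}=-1,\ F_1=\frac{6f_{t_xt_x}}{f_{t_x}^2},\ E_{22}=\frac{3f_{t_xt_x}}{f_{t_x}^2},\ E_{23}=\frac1{f_{t_x}^2},\ E_{24}=-1,\ E_{32}=\frac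 h{f_{t_x}^2},\ E_{34}=f_{t_xt_x},$$ $$F_2=\frac{4h-3f_{t_xt_x}^2}{f_{t_x}^4},\qquad F_3=\frac{f_{t_xt_xt_xt_x}f_{t_x}-5f_{t_xt_x}f_{t_xt_xt_x}}{f_{t_x}^3}-\frac{5f_{t_xt_x}h}{f_{t_x}^4}.$$ In both cases put $$\Delta=-E_{11}E_{22}E_{34}(D^{-1}E_{34})+E_{11}E_{24}E_{32}(D^{-1}E_{34})-E_{12}E_{23}E_{34}(D^{-1}E_{32}),$$ $$H=\frac{\left(F_1E_{24}E_{32}-F_1E_{22}E_{34}+F_2E_{12}E_{34}-F_3E_{12}E_{24}\right)(D^{-1}E_{34})-(D^{-1}F_3)E_{12}E_{23}E_{34}}{\Delta}.$$ **Theorem.** (a) $X,K,C_1,C_2,C_3$ is a basis of $L_x$ while $X,K,C_1,C_2,Z_1$ is not, if and only if the following three conditions hold near $P_n$ for every $n\in\mathbb Z$: 1. $\displaystyle D\left(\frac{w-v}{f_{t_xt_x}}\right)=f_{t_x}\left(\frac{w-v}{f_{t_xt_x}}-p\right)$; 2. $\Delta\not\equiv0$ for $i=2$ and for $i=3$; 3.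 $\displaystyle DH=\frac{F_1}{E_{12}}-\frac{E_{11}}{E_{12}}H$ wherever $\Delta\neq0$ and $D\Delta\ne0$, for $i=2$ and for $i=3$. (b) If condition 1 holds near every $P_n$, then $Z_1=\lambda C_2$ near $P_0$ with $\lambda=(w-v)/f_{t_xt_x}$. -/

import Mathlib

open Filter Topology

namespace SemiDiscrete

noncomputable section

/-- The independent dynamical variables of `t_{1x} = f (x, t, t_1, t_x)`: the continuous variable `x`,
the derivative `t_x`, and the shifts `t_k`, `k ∈ ℤ`. -/
inductive Coord : Type
  | x : Coord
  | tx : Coord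
  | t : ℤ → Coord

/-- Values of all dynamical variables, with the product topology. -/
abbrev Jet : Type := Coord → ℝ

/-- `F` is, near `P`, an analytic function of finitely many dynamical variables. -/
def FinAnalyticAt (F : Jet → ℝ) (P : Jet) : Prop :=
  ∃ (s : Finset Coord) (G : (s → ℝ) → ℝ),
    AnalyticAt ℝ G (fun c => P c) ∧ ∀ᶠ Q in 𝓝 P, F Q = G (fun c => Q c)

open Classical in
/-- The partial derivative of `F` with respect to the dynamical variable `c`. -/
def pd (c : Coord) (F : Jet → ℝ) : Jet → ℝ := fun Q =>
  deriv (fun s : ℝ => F (Function.update Q c s)) (Q c)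

/-- The formal vector field `∑ V_c ∂/∂c`, given by its coefficients. -/
abbrev VField : Type := Coord → Jet → ℝ

/-- The commutator `[V, W]`. For coefficients depending on finitely many variables
the sum has finitely many nonzero terms. -/
def bracket (V W : VField) : VField := fun c Q =>
  ∑ᶠ d : Coord, (V d Q * pd d (W c) Q - W d Q * pd d (V c) Q)

section Chain

variable (f : ℝ × ℝ × ℝ × ℝ → ℝ) (Ω : Set (ℝ × ℝ × ℝ × ℝ))

open Classical in
/-- Solves `f (x, t, t₁, y) = z` for `y` with `(x, t, t₁, y) ∈ Ω`; here the argument is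
`(x, t, t₁, z)`. Thus `t_{-1x} = g (x, t_{-1}, t, t_x)`. -/
def solveBack (q : ℝ × ℝ × ℝ × ℝ) : ℝ :=
  if h : ∃ y : ℝ, (q.1, q.2.1, q.2.2.1, y) ∈ Ω ∧ f (q.1, q.2.1, q.2.2.1, y) = q.2.2.2 then
    h.choose
  else 0

/-- `t_{k x}` for `k ≥ 0`, as a function of the dynamical variables. -/
def siteSlopeUp : ℕ → Jet → ℝ
  | 0 => fun Q => Q .tx
  | k + 1 => fun Q => f (Q .x, Q (.t k), Q (.t (k + 1)), siteSlopeUp k Q)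

/-- `t_{-k x}` for `k ≥ 0`, as a function of the dynamical variables. -/
def siteSlopeDown : ℕ → Jet → ℝ
  | 0 => fun Q => Q .tx
  | k + 1 => fun Q => solveBack f Ω (Q .x, Q (.t (-(k + 1))), Q (.t (-k)), siteSlopeDown k Q)

/-- `t_{k x}` for `k ∈ ℤ`, as a function of the dynamical variables. -/
def siteSlope (k : ℤ) (Q : Jet) : ℝ :=
  if 0 ≤ k then siteSlopeUp f k.toNat Q else siteSlopeDown f Ω (-k).toNat Q

/-- The substitution behind `D`: `t_k ↦ t_{k+1}`, `t_x ↦ f`. -/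
def shift (Q : Jet) : Jet
  | .x => Q .x
  | .tx => f (Q .x, Q (.t 0), Q (.t 1), Q .tx)
  | .t k => Q (.t (k + 1))

/-- The substitution behind `D⁻¹`: `t_k ↦ t_{k-1}`, `t_x ↦ g`. -/
def shiftInv (Q : Jet) : Jet
  | .x => Q .x
  | .tx => solveBack f Ω (Q .x, Q (.t (-1)), Q (.t 0), Q .tx)
  | .t k => Q (.t (k - 1))

/-- The shift operator on functions. -/
def D (F : Jet → ℝ) : Jet → ℝ := fun Q => F (shift f Q)

/-- The inverse shift operator on functions. -/
def Dinv (F : Jet → ℝ) : Jet → ℝ := fun Q => F (shiftInv f Ω Q)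

/-! The generators of the characteristic ring and their first commutators. -/

/-- `X = ∂/∂t_x`. -/
def fieldX : VField
  | .x => fun _ => 0
  | .tx => fun _ => 1
  | .t _ => fun _ => 0

/-- `K = ∂/∂x + t_x ∂/∂t + f ∂/∂t_1 + g ∂/∂t_{-1} + ⋯`. -/
def fieldK : VField
  | .x => fun _ => 1
  | .tx => fun _ => 0
  | .t k => siteSlope f Ω k

def fieldC1 : VField := bracket fieldX (fieldK f Ω)
def fieldC2 : VField := bracket fieldX (fieldC1 f Ω)
def fieldC3 : VField := bracket fieldX (fieldC2 f Ω)
def fieldZ1 : VField := bracket (fieldK f Ω) (fieldC1 f Ω)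

/-- The characteristic `x`-ring near `P`: generated by `X` and `K` under sums, multiplication by
locally analytic functions of finitely many dynamical variables, and commutators. -/
inductive CharRing (P : Jet) : VField → Prop
  | genX : CharRing P fieldX
  | genK : CharRing P (fieldK f Ω)
  | add {V W : VField} : CharRing P V → CharRing P W → CharRing P (V + W)
  | smul {F : Jet → ℝ} {V : VField} : FinAnalyticAt F P → CharRing P V →
      CharRing P (fun c Q => F Q * V c Q)
  | comm {V W : VField} : CharRing P V → CharRing P W → CharRing P (bracket V W)

/-- The five fields `B i` form a basis of the characteristic ring near `P` over the fractions of
germs of analytic functions of finitely many variables: they belong to the ring, they are linearly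
independent, and each element of the ring has a multiple, by a germ that is not zero, that is a
linear combination of them. -/
def IsCharRingBasis (P : Jet) (B : Fin 5 → VField) : Prop :=
  (∀ i, CharRing f Ω P (B i)) ∧
  (∀ a : Fin 5 → Jet → ℝ, (∀ i, FinAnalyticAt (a i) P) →
    (∀ c, ∀ᶠ Q in 𝓝 P, ∑ i, a i Q * B i c Q = 0) → ∀ i, ∀ᶠ Q in 𝓝 P, a i Q = 0) ∧
  (∀ V, CharRing f Ω P V → ∃ (q : Jet → ℝ) (a : Fin 5 → Jet → ℝ),
    FinAnalyticAt q P ∧ (∀ i, FinAnalyticAt (a i) P) ∧ (¬ ∀ᶠ Q in 𝓝 P, q Q = 0) ∧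
    ∀ c, ∀ᶠ Q in 𝓝 P, q Q * V c Q = ∑ i, a i Q * B i c Q)

/-! Derivatives of `f` as functions of the dynamical variables. -/

/-- `f (x, t, t_1, t_x)` as a function of the dynamical variables. -/
def fJ : Jet → ℝ := fun Q => f (Q .x, Q (.t 0), Q (.t 1), Q .tx)

def f_x : Jet → ℝ := pd .x (fJ f)
def f_t : Jet → ℝ := pd (.t 0) (fJ f)
def f_t1 : Jet → ℝ := pd (.t 1) (fJ f)
def f_tx : Jet → ℝ := pd .tx (fJ f)
def f_xtx : Jet → ℝ := pd .x (f_tx f)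
def f_ttx : Jet → ℝ := pd (.t 0) (f_tx f)
def f_t1tx : Jet → ℝ := pd (.t 1) (f_tx f)
def f_txtx : Jet → ℝ := pd .tx (f_tx f)
def f_ttxtx : Jet → ℝ := pd (.t 0) (f_txtx f)
def f_t1txtx : Jet → ℝ := pd (.t 1) (f_txtx f)
def f_txtxtx : Jet → ℝ := pd .tx (f_txtx f)
def f_txtxtxtx : Jet → ℝ := pd .tx (f_txtxtx f)

def pFun : Jet → ℝ := fun Q => (f_x f Q + Q .tx * f_t f Q + fJ f Q * f_t1 f Q) / f_tx f Q
def vFun : Jet → ℝ := fun Q => f_t f Q + f_tx f Q * f_t1 f Q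
def wFun : Jet → ℝ := fun Q => f_xtx f Q + Q .tx * f_ttx f Q + fJ f Q * f_t1tx f Q
def hFun : Jet → ℝ := fun Q => f_txtxtx f Q * f_tx f Q - 3 * f_txtx f Q ^ 2

/-- The condition `D ((w - v) / f_{t_x t_x}) = f_{t_x} ((w - v) / f_{t_x t_x} - p)`,
as an identity near `P`. -/
def ZCondition (P : Jet) : Prop :=
  ∀ᶠ Q in 𝓝 P, D f (fun R => (wFun f R - vFun f R) / f_txtx f R) Q =
    f_tx f Q * ((wFun f Q - vFun f Q) / f_txtx f Q - pFun f Q)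

end Chain

/-- Coefficients of the difference system
`E11 u + E12 Du = F1`, `E22 Du + E23 v + E24 Dv = F2`, `E32 Du + E34 Dv = F3`. -/
structure DiffSystem where
  (E11 E12 E22 E23 E24 E32 E34 F1 F2 F3 : Jet → ℝ)

namespace DiffSystem

variable (f : ℝ × ℝ × ℝ × ℝ → ℝ) (Ω : Set (ℝ × ℝ × ℝ × ℝ)) (S : DiffSystem)

/-- The determinant of the system completed by
`(D⁻¹ E32) u + (D⁻¹ E34) v = D⁻¹ F3`, for the unknowns `u, Du, v, Dv`. -/
def delta : Jet → ℝ := fun Q =>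
  -(S.E11 Q * S.E22 Q * S.E34 Q * Dinv f Ω S.E34 Q)
    + S.E11 Q * S.E24 Q * S.E32 Q * Dinv f Ω S.E34 Q
    - S.E12 Q * S.E23 Q * S.E34 Q * Dinv f Ω S.E32 Q

/-- The value of `u` obtained from the completed system. -/
def H : Jet → ℝ := fun Q =>
  ((S.F1 Q * S.E24 Q * S.E32 Q - S.F1 Q * S.E22 Q * S.E34 Q + S.F2 Q * S.E12 Q * S.E34 Q
      - S.F3 Q * S.E12 Q * S.E24 Q) * Dinv f Ω S.E34 Q
    - Dinv f Ω S.F3 Q * S.E12 Q * S.E23 Q * S.E34 Q) / delta f Ω S Q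

/-- Nondegeneracy near `P`: the determinant is not identically zero. -/
def Nondegenerate (P : Jet) : Prop := ¬ ∀ᶠ Q in 𝓝 P, delta f Ω S Q = 0

/-- Compatibility near `P`: `D H = F1 / E12 - (E11 / E12) H`, wherever `H` and `D H` are defined. -/
def Compatible (P : Jet) : Prop :=
  ∀ᶠ Q in 𝓝 P, delta f Ω S Q ≠ 0 → D f (delta f Ω S) Q ≠ 0 →
    D f (H f Ω S) Q = S.F1 Q / S.E12 Q - S.E11 Q / S.E12 Q * H f Ω S Q

end DiffSystem

section Systems

variable (f : ℝ × ℝ × ℝ × ℝ → ℝ)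

/-- The system for `[C_1, C_2] = v C_2 + u C_3`. -/
def system2 : DiffSystem where
  E11 := fun _ => 1
  E12 := fun _ => -1
  F1 := fun Q => vFun f Q / f_tx f Q
  E22 := fun Q => 3 * f_txtx f Q / f_tx f Q ^ 2
  E23 := fun Q => 1 / f_tx f Q
  E24 := fun _ => -1
  F2 := fun Q => 2 * (f_ttx f Q + f_tx f Q * f_t1tx f Q) / f_tx f Q ^ 2
    - (3 * f_txtx f Q * vFun f Q - f_txtx f Q * f_t f Q) / f_tx f Q ^ 3
  E32 := fun Q => hFun f Q / f_tx f Q ^ 2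
  E34 := f_txtx f
  F3 := fun Q => (f_ttxtx f Q + f_tx f Q * f_t1txtx f Q - 3 * f_txtx f Q * f_t1tx f Q) / f_tx f Q
    - 2 * f_txtx f Q * f_ttx f Q / f_tx f Q ^ 2
    - (f_txtx f Q ^ 2 * f_t f Q + vFun f Q * hFun f Q) / f_tx f Q ^ 3

/-- The system for `C_4 = v C_2 + u C_3`. -/
def system3 : DiffSystem where
  E11 := fun Q => 1 / f_tx f Q
  E12 := fun _ => -1
  F1 := fun Q => 6 * f_txtx f Q / f_tx f Q ^ 2
  E22 := fun Q => 3 * f_txtx f Q / f_tx f Q ^ 2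
  E23 := fun Q => 1 / f_tx f Q ^ 2
  E24 := fun _ => -1
  F2 := fun Q => (4 * hFun f Q - 3 * f_txtx f Q ^ 2) / f_tx f Q ^ 4
  E32 := fun Q => hFun f Q / f_tx f Q ^ 2
  E34 := f_txtx f
  F3 := fun Q => (f_txtxtxtx f Q * f_tx f Q - 5 * f_txtx f Q * f_txtxtx f Q) / f_tx f Q ^ 3
    - 5 * f_txtx f Q * hFun f Q / f_tx f Q ^ 4

end Systems

/-- The data `t(n, x₀) = τ n`, `t_x(n, x₀) = ξ n` lie in the domain and satisfy the equation. -/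
def IsTrajectory (f : ℝ × ℝ × ℝ × ℝ → ℝ) (Ω : Set (ℝ × ℝ × ℝ × ℝ)) (x₀ : ℝ) (τ ξ : ℤ → ℝ) :
    Prop :=
  ∀ n : ℤ, (x₀, τ n, τ (n + 1), ξ n) ∈ Ω ∧ ξ (n + 1) = f (x₀, τ n, τ (n + 1), ξ n)

/-- The values of the dynamical variables along a trajectory, seen from site `n`. -/
def trajJet (x₀ : ℝ) (τ ξ : ℤ → ℝ) (n : ℤ) : Jet
  | .x => x₀
  | .tx => ξ n
  | .t k => τ (n + k)

/-- The points `(x, t, t_1, t_2, t_x)` at which both `f` and its shift are defined. -/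
def twoStepDomain (f : ℝ × ℝ × ℝ × ℝ → ℝ) (Ω : Set (ℝ × ℝ × ℝ × ℝ)) :
    Set (ℝ × ℝ × ℝ × ℝ × ℝ) :=
  {z | (z.1, z.2.1, z.2.2.1, z.2.2.2.2) ∈ Ω ∧
    (z.1, z.2.2.1, z.2.2.2.1, f (z.1, z.2.1, z.2.2.1, z.2.2.2.2)) ∈ Ω}

end

end SemiDiscrete

open SemiDiscrete

/-! Everything rests on how the shift conjugates vector fields. Conjugation by D turns X into X /
f_{t_x} and K into K - p X. Hence each iterated commutator at site n+1 becomes a nonzero multiple of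
the same commutator at site n plus a combination of simpler ones (`related_C1` to `related_Z1`).
Call a field vertical if it annihilates x, t_x and t; C_2, C_3, C_4, [C_1,C_2] and Z_1 are vertical.
Two rigidity facts carry the proof. A vertical field conjugate to a combination of C_1 and X is
zero, because C_1 t_1 = X f = f_{t_x} is invertible (`related_eq_zero`). A family of vertical
fields, each conjugate to a multiple of its predecessor modulo X, is zero: the t_k-component at site
n+1 vanishes exactly when the t_{k+1}-component at site n does, and the t_0-components all vanish
(`eq_zero_of_related`).

So a linear relation between vertical fields is equivalent to difference equations for its
coefficients. For Z_1 = λ C_2, with λ forced by evaluation on t_1, the equation is condition 1. For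
M = ū C_2 + u C_3, with M = [C_1,C_2] or M = C_4, it is the system of three equations. Adjoining D⁻¹
of the third equation gives four linear equations for u, Du, ū, Dū with determinant Δ; they yield u
= H, and the first equation for H is condition 3 (`System.spanned_of_compat`,
`System.compat_of_spanned`). For both systems Δ is, up to a nonzero factor and a shift by one site,
the obstruction to C_3 = μ C_2. By the identity theorem on the connected component this obstruction
vanishes at one site only if it vanishes at all, so condition 2 amounts to the independence of C_2
and C_3.

If the family with C_3 is a basis and the family with Z_1 is not, then Z_1 has no C_3-part, since
otherwise it could be exchanged for C_3; so Z_1 = λ C_2. Conversely, by the Jacobi identity, the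
span of X, K, C_1, C_2, C_3 over fractions is closed under brackets once it contains Z_1, [C_1,C_2]
and C_4 (`isBasis_famC`).

The algebra is done in an abstract `ShiftChain`. The analysis shows that germs along the trajectory
form such a chain of integral domains (`jetChain`): D is invertible by the inverse function theorem
and injectivity in t_x, and products of nonzero germs are nonzero by analyticity. -/

namespace SemiDiscrete

/-- A chain of rings of functions linked by a shift `D`, with derivations `X`, `K` and coordinates
`x`, `tx`, `t k`, as they arise from the equation `t_{1x} = f(x, t, t_1, t_x)`. Here `qi` and `q2i`
are the inverses of `f_{t_x}` and `f_{t_x t_x}`, and `fields` are the derivations which are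
determined by their values on the coordinates. -/
structure ShiftChain (A : ℤ → Type*) [∀ n, CommRing (A n)] where
  D : ∀ n, A (n + 1) ≃+* A n
  X : ∀ n, Derivation ℤ (A n) (A n)
  K : ∀ n, Derivation ℤ (A n) (A n)
  x : ∀ n, A n
  tx : ∀ n, A n
  t : ∀ n, ℤ → A n
  qi : ∀ n, A n
  q2i : ∀ n, A n
  fields : ∀ n, Submodule (A n) (Derivation ℤ (A n) (A n))
  X_mem : ∀ n, X n ∈ fields n
  K_mem : ∀ n, K n ∈ fields n
  lie_mem : ∀ n, ∀ V ∈ fields n, ∀ W ∈ fields n, ⁅V, W⁆ ∈ fields n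
  eq_zero : ∀ n, ∀ V ∈ fields n, V (x n) = 0 → V (tx n) = 0 → (∀ k, V (t n k) = 0) → V = 0
  D_x : ∀ n, D n (x (n + 1)) = x n
  D_t : ∀ n k, D n (t (n + 1) k) = t n (k + 1)
  X_x : ∀ n, X n (x n) = 0
  X_tx : ∀ n, X n (tx n) = 1
  X_t : ∀ n k, X n (t n k) = 0
  K_x : ∀ n, K n (x n) = 1
  K_tx : ∀ n, K n (tx n) = 0
  K_t0 : ∀ n, K n (t n 0) = tx n
  K_t1 : ∀ n, K n (t n 1) = D n (tx (n + 1))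
  q_mul_qi : ∀ n, X n (D n (tx (n + 1))) * qi n = 1
  q2_mul_q2i : ∀ n, X n (X n (D n (tx (n + 1)))) * q2i n = 1
  X_D : ∀ n F, qi n * X n (D n F) = D n (X (n + 1) F)
  K_D : ∀ n F, K n (D n F) - qi n * K n (D n (tx (n + 1))) * X n (D n F) = D n (K (n + 1) F)

/-! ### Conjugation of the iterated commutators by the shift. -/

namespace ShiftChain

variable {A : ℤ → Type*} [∀ n, CommRing (A n)] (S : ShiftChain A) (n : ℤ)

def f : A n := S.D n (S.tx (n + 1))
def q : A n := S.X n (S.f n)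
def q2 : A n := S.X n (S.q n)
def q3 : A n := S.X n (S.q2 n)
def C1 : Derivation ℤ (A n) (A n) := ⁅S.X n, S.K n⁆
def C2 : Derivation ℤ (A n) (A n) := ⁅S.X n, S.C1 n⁆
def C3 : Derivation ℤ (A n) (A n) := ⁅S.X n, S.C2 n⁆
def C4 : Derivation ℤ (A n) (A n) := ⁅S.X n, S.C3 n⁆
def Z1 : Derivation ℤ (A n) (A n) := ⁅S.K n, S.C1 n⁆
-- This is the function for which K - p X annihilates f; it is the X-correction in the conjugate of
-- K.
def p : A n := S.qi n * S.K n (S.f n)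
def v : A n := S.C1 n (S.f n)
-- Equal to h / f_{t_x}²; up to the factor -qi³ it is the C_1-coefficient in the conjugate of C_3.
def e : A n := S.q3 n * S.qi n - 3 * S.q2 n ^ 2 * S.qi n ^ 2

/-- `Y'` at the site `n + 1` is conjugate to `Y` at the site `n` by the shift. -/
def Related {n : ℤ} (Y' : Derivation ℤ (A (n + 1)) (A (n + 1))) (Y : Derivation ℤ (A n) (A n)) :
    Prop :=
  ∀ F, Y (S.D n F) = S.D n (Y' F)

lemma q_qi : S.q n * S.qi n = 1 := S.q_mul_qi n
lemma q2_q2i : S.q2 n * S.q2i n = 1 := S.q2_mul_q2i n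

lemma derivation_inv {R : Type*} [CommRing R] (V : Derivation ℤ R R) {a b : R} (h : a * b = 1) :
    V b = -b ^ 2 * V a := by
  have h1 : V (a * b) = 0 := by rw [h]; exact V.map_one_eq_zero
  rw [V.leibniz, smul_eq_mul, smul_eq_mul] at h1
  linear_combination b * h1 - V b * h

lemma X_q2 : S.X n (S.q2 n) = S.q3 n := rfl

lemma C1_apply (F : A n) : S.C1 n F = S.X n (S.K n F) - S.K n (S.X n F) := rfl
lemma C2_apply (F : A n) : S.C2 n F = S.X n (S.C1 n F) - S.C1 n (S.X n F) := rfl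
lemma C3_apply (F : A n) : S.C3 n F = S.X n (S.C2 n F) - S.C2 n (S.X n F) := rfl
lemma C4_apply (F : A n) : S.C4 n F = S.X n (S.C3 n F) - S.C3 n (S.X n F) := rfl
lemma Z1_apply (F : A n) : S.Z1 n F = S.K n (S.C1 n F) - S.C1 n (S.K n F) := rfl

lemma C1_mem : S.C1 n ∈ S.fields n := S.lie_mem n _ (S.X_mem n) _ (S.K_mem n)
lemma C2_mem : S.C2 n ∈ S.fields n := S.lie_mem n _ (S.X_mem n) _ (S.C1_mem n)
lemma Z1_mem : S.Z1 n ∈ S.fields n := S.lie_mem n _ (S.K_mem n) _ (S.C1_mem n)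

/-- The derivations which annihilate `x`, `t_x` and `t`. -/
def vertical : Submodule (A n) (Derivation ℤ (A n) (A n)) where
  carrier := {V | V ∈ S.fields n ∧ V (S.x n) = 0 ∧ V (S.tx n) = 0 ∧ V (S.t n 0) = 0}
  add_mem' := by
    rintro V W ⟨h1, h2, h3, h4⟩ ⟨k1, k2, k3, k4⟩
    exact ⟨add_mem h1 k1, by simp [h2, k2], by simp [h3, k3], by simp [h4, k4]⟩
  zero_mem' := ⟨zero_mem _, by simp⟩
  smul_mem' := by
    rintro c V ⟨h1, h2, h3, h4⟩
    exact ⟨Submodule.smul_mem _ c h1, by simp [h2], by simp [h3], by simp [h4]⟩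

lemma C1_x : S.C1 n (S.x n) = 0 := by simp [C1_apply, S.X_x, S.K_x]
lemma C1_tx : S.C1 n (S.tx n) = 0 := by simp [C1_apply, S.X_tx, S.K_tx]
lemma C1_t0 : S.C1 n (S.t n 0) = 1 := by simp [C1_apply, S.X_t, S.K_t0, S.X_tx]
lemma C1_t1 : S.C1 n (S.t n 1) = S.q n := by simp [C1_apply, S.X_t, S.K_t1]; rfl
lemma C2_t1 : S.C2 n (S.t n 1) = S.q2 n := by simp [C2_apply, S.X_t, S.C1_t1]; rfl
lemma C3_t1 : S.C3 n (S.t n 1) = S.q3 n := by simp [C3_apply, S.X_t, S.C2_t1]; rfl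

lemma C2_vertical : S.C2 n ∈ S.vertical n :=
  ⟨S.C2_mem n, by simp [C2_apply, C1_x, X_x], by simp [C2_apply, C1_tx, X_tx],
    by simp [C2_apply, C1_t0, X_t]⟩

lemma lie_X_vertical {V : Derivation ℤ (A n) (A n)} (hV : V ∈ S.vertical n) :
    ⁅S.X n, V⁆ ∈ S.vertical n :=
  ⟨S.lie_mem n _ (S.X_mem n) _ hV.1, by simp [Derivation.commutator_apply, hV.2.1, X_x],
    by simp [Derivation.commutator_apply, hV.2.2.1, X_tx],
    by simp [Derivation.commutator_apply, hV.2.2.2, X_t]⟩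

lemma C3_vertical : S.C3 n ∈ S.vertical n := S.lie_X_vertical n (S.C2_vertical n)
lemma C4_vertical : S.C4 n ∈ S.vertical n := S.lie_X_vertical n (S.C3_vertical n)

lemma Z1_vertical : S.Z1 n ∈ S.vertical n :=
  ⟨S.Z1_mem n, by simp [Z1_apply, C1_x, K_x], by simp [Z1_apply, C1_tx, K_tx],
    by simp [Z1_apply, C1_t0, K_t0, C1_tx]⟩

lemma lie_C1_C2_vertical : ⁅S.C1 n, S.C2 n⁆ ∈ S.vertical n := by
  obtain ⟨h1, h2, h3, h4⟩ := S.C2_vertical n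
  exact ⟨S.lie_mem n _ (S.C1_mem n) _ h1, by simp [Derivation.commutator_apply, h2, C1_x],
    by simp [Derivation.commutator_apply, h3, C1_tx],
    by simp [Derivation.commutator_apply, h4, C1_t0]⟩

section Related

variable {S n}

lemma Related.add {Y' Z' : Derivation ℤ (A (n + 1)) (A (n + 1))} {Y Z : Derivation ℤ (A n) (A n)}
    (h : S.Related Y' Y) (k : S.Related Z' Z) : S.Related (Y' + Z') (Y + Z) := fun F => by
  simp [h F, k F]

lemma Related.sub {Y' Z' : Derivation ℤ (A (n + 1)) (A (n + 1))} {Y Z : Derivation ℤ (A n) (A n)}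
    (h : S.Related Y' Y) (k : S.Related Z' Z) : S.Related (Y' - Z') (Y - Z) := fun F => by
  simp [h F, k F]

lemma Related.smul {Y' : Derivation ℤ (A (n + 1)) (A (n + 1))} {Y : Derivation ℤ (A n) (A n)}
    (h : S.Related Y' Y) (a : A (n + 1)) : S.Related (a • Y') (S.D n a • Y) := fun F => by
  simp [h F]

lemma Related.lie {Y' Z' : Derivation ℤ (A (n + 1)) (A (n + 1))} {Y Z : Derivation ℤ (A n) (A n)}
    (h : S.Related Y' Y) (k : S.Related Z' Z) : S.Related ⁅Y', Z'⁆ ⁅Y, Z⁆ := fun F => by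
  simp only [Derivation.commutator_apply, k F, h F, h _, k _, map_sub]

lemma Related.of_eq {Y' : Derivation ℤ (A (n + 1)) (A (n + 1))} {Y Z : Derivation ℤ (A n) (A n)}
    (h : S.Related Y' Y) (e : Y = Z) : S.Related Y' Z := e ▸ h

lemma Related.eq_zero {Y' : Derivation ℤ (A (n + 1)) (A (n + 1))} (h : S.Related Y' 0) :
    Y' = 0 := by
  ext F
  have := h F
  rw [Derivation.zero_apply, eq_comm, map_eq_zero_iff _ (S.D n).injective] at this
  exact this

lemma Related.eq_zero_right {Y : Derivation ℤ (A n) (A n)} (h : S.Related (n := n) 0 Y) :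
    Y = 0 := by
  ext F
  obtain ⟨G, rfl⟩ := (S.D n).surjective F
  simp [h G]

end Related

lemma related_X : S.Related (S.X (n + 1)) (S.qi n • S.X n) := fun F => by simp [S.X_D n F]

lemma related_K : S.Related (S.K (n + 1)) (S.K n - S.p n • S.X n) := fun F => by
  rw [← S.K_D n F]; simp [p, f]

lemma X_qi : S.X n (S.qi n) = -S.qi n ^ 2 * S.q2 n := derivation_inv _ (S.q_qi n)

/-- Conjugation respects brackets, so the law for C_1 is the bracket of the laws for X and K,
expanded with the Leibniz rule. The laws for the higher commutators arise in the same way. -/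
lemma related_C1 : S.Related (S.C1 (n + 1)) (S.qi n • S.C1 n - (S.v n * S.qi n ^ 2) • S.X n) := by
  refine ((S.related_X n).lie (S.related_K n)).of_eq ?_
  ext F
  have h1 := derivation_inv (S.K n) (S.q_qi n)
  have h2 : S.v n = S.X n (S.K n (S.f n)) - S.K n (S.q n) := rfl
  simp only [Derivation.commutator_apply, Derivation.smul_apply, Derivation.sub_apply, p,
    smul_eq_mul, Derivation.leibniz, map_sub, X_qi, C1_apply, h1, h2]
  ring

lemma related_C2 : S.Related (S.C2 (n + 1)) (S.qi n ^ 2 • S.C2 n - (S.q2 n * S.qi n ^ 3) • S.C1 n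
    + (S.v n * S.q2 n * S.qi n ^ 4 - S.qi n ^ 3 * S.C2 n (S.f n)) • S.X n) := by
  refine ((S.related_X n).lie (S.related_C1 n)).of_eq ?_
  ext F
  have h1 := derivation_inv (S.C1 n) (S.q_qi n)
  have h2 : S.C2 n (S.f n) = S.X n (S.v n) - S.C1 n (S.q n) := rfl
  simp only [Derivation.commutator_apply, Derivation.smul_apply, Derivation.sub_apply, pow_two,
    smul_eq_mul, Derivation.leibniz, map_sub, X_qi, C2_apply, h1, h2, Derivation.add_apply]
  ring

/-- The X-coefficient is left unspecified here and in the later laws: in the applications to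
vertical fields, evaluation on t_x accounts for it, so its value plays no role. -/
lemma related_C3 : ∃ c : A n, S.Related (S.C3 (n + 1)) (S.qi n ^ 3 • S.C3 n
    - (3 * S.q2 n * S.qi n ^ 4) • S.C2 n - (S.e n * S.qi n ^ 3) • S.C1 n + c • S.X n) := by
  refine ⟨S.qi n * S.X n (S.v n * S.q2 n * S.qi n ^ 4 - S.qi n ^ 3 * S.C2 n (S.f n))
    - S.qi n ^ 2 * S.C2 n (S.qi n) + S.q2 n * S.qi n ^ 3 * S.C1 n (S.qi n)
    - (S.v n * S.q2 n * S.qi n ^ 4 - S.qi n ^ 3 * S.C2 n (S.f n)) * S.X n (S.qi n),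
    ((S.related_X n).lie (S.related_C2 n)).of_eq ?_⟩
  ext F
  generalize S.v n * S.q2 n * S.qi n ^ 4 - S.qi n ^ 3 * S.C2 n (S.f n) = n2
  have h1 := derivation_inv (S.C1 n) (S.q_qi n)
  have h2 := derivation_inv (S.C2 n) (S.q_qi n)
  simp only [Derivation.commutator_apply, Derivation.smul_apply, Derivation.sub_apply, pow_succ,
    pow_zero, one_mul,
    smul_eq_mul, Derivation.leibniz, map_sub, map_add, X_qi, C3_apply, e, h1, h2,
    Derivation.add_apply, X_q2]
  simp only [C2_apply S n F]
  ring

lemma related_C4 : ∃ c : A n, S.Related (S.C4 (n + 1)) ((S.qi n ^ 3 * S.qi n) • S.C4 n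
    - (S.qi n ^ 3 * (6 * S.q2 n * S.qi n ^ 2)) • S.C3 n
    - (S.qi n ^ 2 * (4 * S.e n * S.qi n ^ 2 - 3 * S.q2 n ^ 2 * S.qi n ^ 4)) • S.C2 n
    - (S.qi n ^ 3 * (S.X n (S.e n) * S.qi n - 3 * S.e n * S.q2 n * S.qi n ^ 2)) • S.C1 n
    + c • S.X n) := by
  obtain ⟨c, hc⟩ := S.related_C3 n
  refine ⟨S.qi n * S.X n c
    - S.qi n ^ 3 * S.C3 n (S.qi n) + 3 * S.q2 n * S.qi n ^ 4 * S.C2 n (S.qi n)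
    + S.e n * S.qi n ^ 3 * S.C1 n (S.qi n) - c * S.X n (S.qi n),
    ((S.related_X n).lie hc).of_eq ?_⟩
  ext F
  have h3 : S.X n 3 = 0 := by exact_mod_cast (S.X n).map_natCast 3
  simp only [Derivation.commutator_apply, Derivation.smul_apply, Derivation.sub_apply, pow_succ,
    pow_zero, one_mul, smul_eq_mul, Derivation.leibniz, map_sub, map_add, X_qi, C4_apply, e,
    Derivation.add_apply, X_q2, h3]
  simp only [C3_apply S n F, C2_apply S n F]
  ring

/-- The right-hand sides of the system for `[C_1, C_2]`. -/
def F1 : A n := S.v n * S.qi n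
def F2 : A n := 2 * S.C1 n (S.q n) * S.qi n ^ 2 - S.C2 n (S.f n) * S.qi n ^ 2
  - 2 * S.v n * S.q2 n * S.qi n ^ 3
def F3 : A n := -S.C2 n (S.q n) * S.qi n + S.C1 n (S.q2 n) * S.qi n
  - 2 * S.q2 n * S.C1 n (S.q n) * S.qi n ^ 2
  - S.q2 n * (S.v n * S.q2 n * S.qi n ^ 3 - S.qi n ^ 2 * S.C2 n (S.f n)) - S.v n * S.e n * S.qi n

lemma related_lie_C1_C2 : ∃ c : A n, S.Related ⁅S.C1 (n + 1), S.C2 (n + 1)⁆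
    (S.qi n ^ 3 • ⁅S.C1 n, S.C2 n⁆
    - (S.qi n ^ 3 * S.F1 n) • S.C3 n - (S.qi n ^ 2 * S.F2 n) • S.C2 n
    - (S.qi n ^ 3 * S.F3 n) • S.C1 n + c • S.X n) := by
  have h1 := derivation_inv (S.C1 n) (S.q_qi n)
  have h2 := derivation_inv (S.C2 n) (S.q_qi n)
  refine ⟨S.qi n * S.C1 n (S.v n * S.q2 n * S.qi n ^ 4 - S.qi n ^ 3 * S.C2 n (S.f n))
    + S.qi n ^ 2 * S.C2 n (S.v n * S.qi n ^ 2)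
    - S.q2 n * S.qi n ^ 3 * S.C1 n (S.v n * S.qi n ^ 2)
    - S.v n * S.qi n ^ 2 * S.X n (S.v n * S.q2 n * S.qi n ^ 4 - S.qi n ^ 3 * S.C2 n (S.f n))
    + (S.v n * S.q2 n * S.qi n ^ 4 - S.qi n ^ 3 * S.C2 n (S.f n)) * S.X n (S.v n * S.qi n ^ 2),
    ((S.related_C1 n).lie (S.related_C2 n)).of_eq ?_⟩
  ext F
  simp only [Derivation.commutator_apply, Derivation.smul_apply, Derivation.sub_apply, pow_succ,
    pow_zero, one_mul, smul_eq_mul, Derivation.leibniz, map_sub, map_add, X_qi, h1, h2,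
    Derivation.add_apply, X_q2, F1, F2, F3, e]
  simp only [C3_apply S n F, C2_apply S n F]
  ring

/-- Only the coefficients of Z_1 and C_2 matter; the multiples of C_1 and X are disposed of by
verticality. -/
lemma related_Z1 : ∃ a b : A n, S.Related (S.Z1 (n + 1)) (S.qi n • S.Z1 n
    - (S.p n * S.qi n) • S.C2 n + a • S.C1 n + b • S.X n) := by
  refine ⟨S.K n (S.qi n) - S.p n * S.X n (S.qi n) + S.v n * S.qi n ^ 2,
    -S.K n (S.v n * S.qi n ^ 2) + S.p n * S.X n (S.v n * S.qi n ^ 2) + S.qi n * S.C1 n (S.p n)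
      - S.v n * S.qi n ^ 2 * S.X n (S.p n),
    ((S.related_K n).lie (S.related_C1 n)).of_eq ?_⟩
  ext F
  generalize S.v n * S.qi n ^ 2 = w
  simp only [Derivation.commutator_apply, Derivation.smul_apply, Derivation.sub_apply,
    smul_eq_mul, Derivation.leibniz, map_sub, Z1_apply, C2_apply, Derivation.add_apply]
  simp only [C1_apply S n F]
  ring

end ShiftChain
end SemiDiscrete

/-! ### Relations Z_1 = λ C_2 and C_3 = μ C_2 along the chain. -/

namespace SemiDiscrete
namespace ShiftChain

variable {A : ℤ → Type*} [∀ n, CommRing (A n)]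

section Coefficients

variable (S : ShiftChain A) (n : ℤ)

lemma D_ne_zero {a : A (n + 1)} (h : a ≠ 0) : S.D n a ≠ 0 :=
  (map_ne_zero_iff _ (S.D n).injective).2 h

/-- The coefficient `λ` of the relation `Z_1 = λ C_2`. -/
def lam : A n := S.q2i n * S.Z1 n (S.t n 1)

lemma q2_lam : S.q2 n * S.lam n = S.Z1 n (S.t n 1) := by
  rw [lam]; linear_combination S.Z1 n (S.t n 1) * S.q2_q2i n

variable {S n} in
lemma lam_eq {a : A n} (h : S.Z1 n = a • S.C2 n) : S.lam n = a := by
  rw [lam, h, Derivation.smul_apply, C2_t1, smul_eq_mul]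
  linear_combination a * S.q2_q2i n

/-- The coefficient `μ` of the relation `C_3 = μ C_2`. -/
def mu : A n := S.q2i n * S.q3 n

lemma q2_mu : S.q2 n * S.mu n = S.q3 n := by
  rw [mu]; linear_combination S.q3 n * S.q2_q2i n

variable {S n} in
lemma mu_eq {a : A n} (h : S.C3 n = a • S.C2 n) : S.mu n = a := by
  rw [mu, ← C3_t1, h, Derivation.smul_apply, C2_t1, smul_eq_mul]
  linear_combination a * S.q2_q2i n

end Coefficients

variable [∀ n, IsDomain (A n)] (S : ShiftChain A) (n : ℤ)

lemma qi_ne_zero : S.qi n ≠ 0 := right_ne_zero_of_mul_eq_one (S.q_qi n)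
lemma q_ne_zero : S.q n ≠ 0 := left_ne_zero_of_mul_eq_one (S.q_qi n)
lemma q2_ne_zero : S.q2 n ≠ 0 := left_ne_zero_of_mul_eq_one (S.q2_q2i n)
variable {S n} in
lemma vertical_smul_cancel {c : A n} (hc : c ≠ 0) {V : Derivation ℤ (A n) (A n)}
    (h : c • V = 0) : V = 0 := by
  ext F
  have := congrArg (fun W : Derivation ℤ (A n) (A n) => W F) h
  simpa [hc] using this

variable {S n} in
/-- A derivation conjugate to a vertical one has no `C_1`-part and no `X`-part besides its vertical
part, as soon as the latter annihilates `t_1`. -/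
lemma coeff_C1_eq_zero {Y' : Derivation ℤ (A (n + 1)) (A (n + 1))} {V : Derivation ℤ (A n) (A n)}
    {c d : A n} (hY' : Y' ∈ S.vertical (n + 1)) (hV : V (S.t n 1) = 0)
    (h : S.Related Y' (V + c • S.C1 n + d • S.X n)) : c = 0 := by
  have := h (S.t (n + 1) 0)
  rw [hY'.2.2.2, map_zero, S.D_t, zero_add] at this
  simpa [hV, C1_t1, X_t, S.q_ne_zero n] using this

variable {S n} in
-- Evaluate on t_0 at site n+1, which the shift sends to t_1: this gives c f_{t_x} = 0. Then
-- evaluate on t_x, which the shift sends to f: this gives d f_{t_x} = 0.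
lemma related_eq_zero {Y' : Derivation ℤ (A (n + 1)) (A (n + 1))} {c d : A n}
    (hY' : Y' ∈ S.vertical (n + 1)) (h : S.Related Y' (c • S.C1 n + d • S.X n)) : Y' = 0 := by
  have hc : c = 0 := coeff_C1_eq_zero (V := 0) (d := d) hY' (by simp) (h.of_eq (by simp))
  have hd : d = 0 := by
    have := h (S.tx (n + 1))
    rw [hY'.2.2.1, map_zero] at this
    have h2 : (S.X n) (S.D n (S.tx (n + 1))) = S.q n := rfl
    simpa [hc, h2, S.q_ne_zero n] using this
  subst hc hd
  exact Related.eq_zero (h.of_eq (by simp))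

variable {S} in
/-- A sequence of vertical derivations, each of which is conjugate to a multiple of the preceding
one up to `X`, vanishes. -/
lemma eq_zero_of_related {Y W : ∀ n, Derivation ℤ (A n) (A n)} {a b d : ∀ n, A n}
    (hY : ∀ n, Y n ∈ S.vertical n) (hW : ∀ n, S.Related (Y (n + 1)) (W n)) (ha : ∀ n, a n ≠ 0)
    (hb : ∀ n, b n ≠ 0) (h : ∀ n, b n • W n = a n • Y n + d n • S.X n) : ∀ n, Y n = 0 := by
  -- The shift sends t_k at site n+1 to t_{k+1} at site n, and X annihilates every t_k, so the
  -- X-term disappears.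
  have key : ∀ n k, b n * S.D n (Y (n + 1) (S.t (n + 1) k)) = a n * Y n (S.t n (k + 1)) :=
    fun n k => by
      have := congrArg (fun V : Derivation ℤ (A n) (A n) => V (S.t n (k + 1))) (h n)
      simp only [Derivation.smul_apply, Derivation.add_apply, smul_eq_mul, X_t, mul_zero,
        add_zero] at this
      rw [← S.D_t, hW n] at this
      rw [this, S.D_t]
  have step : ∀ n k, Y (n + 1) (S.t (n + 1) k) = 0 ↔ Y n (S.t n (k + 1)) = 0 := fun n k => by
    have := key n k
    constructor
    · intro h0
      rw [h0, map_zero, mul_zero] at this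
      exact (mul_eq_zero.1 this.symm).resolve_left (ha n)
    · intro h0
      rw [h0, mul_zero] at this
      exact (map_eq_zero_iff _ (S.D n).injective).1 ((mul_eq_zero.1 this).resolve_left (hb n))
  -- Induction on k in both directions, for all sites at once: a step in k moves the site by one. It
  -- starts at k = 0, where verticality applies at every site.
  have all : ∀ k n, Y n (S.t n k) = 0 := fun k => by
    induction k using Int.induction_on with
    | zero => exact fun n => (hY n).2.2.2
    | succ i ih => exact fun n => (step n i).1 (ih (n + 1))
    | pred i ih =>
      intro n
      obtain ⟨n, rfl⟩ : ∃ m, n = m + 1 := ⟨n - 1, by ring⟩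
      exact (step n _).2 (by rw [sub_add_cancel]; exact ih n)
  exact fun n => S.eq_zero n _ (hY n).1 (hY n).2.1 (hY n).2.2.1 (fun k => all k n)

variable {S} in
/-- The same with a multiple of `C_1` allowed, for derivations which annihilate `t_1`. -/
lemma eq_zero_of_related_mod_C1 {Y W : ∀ n, Derivation ℤ (A n) (A n)} {a c d : ∀ n, A n}
    (hY : ∀ n, Y n ∈ S.vertical n) (hYt : ∀ n, Y n (S.t n 1) = 0)
    (hW : ∀ n, S.Related (Y (n + 1)) (W n)) (ha : ∀ n, a n ≠ 0)
    (h : ∀ n, W n = a n • Y n + c n • S.C1 n + d n • S.X n) : ∀ n, Y n = 0 := by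
  have hc : ∀ n, c n = 0 := fun n =>
    coeff_C1_eq_zero (V := a n • Y n) (d := d n) (hY (n + 1)) (by simp [hYt]) ((hW n).of_eq (h n))
  exact eq_zero_of_related hY hW ha (b := fun _ => 1) (d := d) (fun _ => one_ne_zero)
    (fun n => by rw [one_smul, h, hc, zero_smul, add_zero])

lemma int_induction_iff {P : ℤ → Prop} (h : ∀ n, P n ↔ P (n + 1)) (h0 : P 0) (n : ℤ) : P n := by
  induction n using Int.induction_on with
  | zero => exact h0
  | succ i ih => exact (h _).1 ih
  | pred i ih => exact (h _).2 (by rwa [sub_add_cancel])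

def ZDep : Prop := S.Z1 n = S.lam n • S.C2 n

def ZCond : Prop := S.D n (S.lam (n + 1)) = S.q n * (S.lam n - S.p n)

variable {S n} in
-- Choose ν so that subtracting ν C_2 removes the C_2-part of the conjugate of Z_1. What remains is
-- a combination of C_1 and X, hence zero by rigidity. So Z_1 = ν C_2 at site n+1, ν is the next λ,
-- and its defining formula is condition 1.
lemma ZDep.succ (h : S.ZDep n) : S.ZDep (n + 1) ∧ S.ZCond n := by
  obtain ⟨a, b, hab⟩ := S.related_Z1 n
  set ν := (S.D n).symm (S.q n * (S.lam n - S.p n)) with hν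
  have hD : S.D n ν = S.q n * (S.lam n - S.p n) := by simp [hν]
  have h0 : S.Z1 (n + 1) - ν • S.C2 (n + 1) = 0 := by
    refine related_eq_zero (sub_mem (S.Z1_vertical _)
      (Submodule.smul_mem _ _ (S.C2_vertical _))) ((hab.sub ((S.related_C2 n).smul ν)).of_eq
        (Z := (a + S.q n * (S.lam n - S.p n) * (S.q2 n * S.qi n ^ 3)) • S.C1 n + (b - S.q n *
        (S.lam n - S.p n) * (S.v n * S.q2 n * S.qi n ^ 4 - S.qi n ^ 3 * S.C2 n (S.f n))) • S.X n) ?_)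
    rw [hD, show S.Z1 n = S.lam n • S.C2 n from h]
    match_scalars
    · linear_combination -(S.lam n - S.p n) * S.qi n * S.q_qi n
    · ring
    · ring
  have h1 := lam_eq (sub_eq_zero.1 h0)
  refine ⟨?_, by rw [ZCond, h1, hD]⟩
  rw [ZDep, h1]; exact sub_eq_zero.1 h0

variable {S n} in
-- Evaluation on t_1 forces a = c λ, because C_2 t_1 = f_{t_x t_x} is nonzero; the factor c cancels
-- in a domain.
lemma ZDep.of_smul {c a : A n} (hc : c ≠ 0) (h : c • S.Z1 n = a • S.C2 n) : S.ZDep n := by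
  have h1 := congrArg (fun W : Derivation ℤ (A n) (A n) => W (S.t n 1)) h
  simp only [Derivation.smul_apply, C2_t1, smul_eq_mul, ← q2_lam] at h1
  have h2 : a = c * S.lam n := mul_right_cancel₀ (S.q2_ne_zero n) (by linear_combination -h1)
  refine sub_eq_zero.1 (vertical_smul_cancel hc ?_)
  rw [smul_sub, h, h2, smul_smul, sub_self]

variable {S n} in
lemma ZDep.of_succ (h : S.ZDep (n + 1)) : S.ZDep n := by
  obtain ⟨a, b, hab⟩ := S.related_Z1 n
  -- The zero field at site n+1 has zero conjugate, which gives a relation between Z_1, C_2, C_1 and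
  -- X at site n. Evaluation on t_0 and t_x then removes C_1 and X.
  have h1 := Related.eq_zero_right (((hab.sub ((S.related_C2 n).smul (S.lam (n + 1)))).of_eq rfl :
    S.Related (S.Z1 (n + 1) - S.lam (n + 1) • S.C2 (n + 1)) _) |> (sub_eq_zero.2 h ▸ ·))
  set c := S.D n (S.lam (n + 1))
  have h2 := congrArg (fun W : Derivation ℤ (A n) (A n) => W (S.t n 0)) h1
  simp [C1_t0, X_t, (S.Z1_vertical n).2.2.2, (S.C2_vertical n).2.2.2] at h2
  have h3 := congrArg (fun W : Derivation ℤ (A n) (A n) => W (S.tx n)) h1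
  simp [C1_tx, X_tx, (S.Z1_vertical n).2.2.1, (S.C2_vertical n).2.2.1] at h3
  refine ZDep.of_smul (S.qi_ne_zero n) (a := S.p n * S.qi n + c * S.qi n ^ 2) ?_
  rw [← sub_eq_zero, ← h1]
  match_scalars
  · ring
  · ring
  · linear_combination -h2
  · linear_combination -h3

lemma zdep_iff : S.ZDep n ↔ S.ZDep (n + 1) := ⟨fun h => h.succ.1, ZDep.of_succ⟩

variable {S} in
lemma ZDep.zcond (h : S.ZDep 0) (n : ℤ) : S.ZCond n :=
  (int_induction_iff S.zdep_iff h n).succ.2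

variable {S} in
-- The field Z_1 - λ C_2 is vertical and annihilates t_1 by the choice of λ. Condition 1 says
-- exactly that its conjugate has no further C_2-part, so the whole family vanishes.
lemma zdep_of_zcond (h : ∀ n, S.ZCond n) : ∀ n, S.ZDep n := by
  choose a b hab using S.related_Z1
  have h2 := eq_zero_of_related_mod_C1 (S := S) (Y := fun n => S.Z1 n - S.lam n • S.C2 n)
    (a := S.qi)
    (c := fun n => a n + S.q n * (S.lam n - S.p n) * (S.q2 n * S.qi n ^ 3))
    (d := fun n => b n - S.q n *
        (S.lam n - S.p n) * (S.v n * S.q2 n * S.qi n ^ 4 - S.qi n ^ 3 * S.C2 n (S.f n)))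
    (fun n => sub_mem (S.Z1_vertical _) (Submodule.smul_mem _ _ (S.C2_vertical _)))
    (fun n => by simp [C2_t1, ← q2_lam, mul_comm])
    (fun n => (hab n).sub ((S.related_C2 n).smul (S.lam (n + 1)))) S.qi_ne_zero
    (fun n => by
      rw [show S.D n (S.lam (n + 1)) = _ from h n]
      match_scalars
      · ring
      · linear_combination -(S.lam n - S.p n) * S.qi n * S.q_qi n
      · ring
      · ring)
  exact fun n => sub_eq_zero.1 (h2 n)

def Dep : Prop := S.C3 n = S.mu n • S.C2 n

/-- Cleared of denominators this reads D μ = e / f_{t_x t_x}, the difference equation for the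
coefficient μ. -/
def DepCond : Prop := S.D n (S.q3 (n + 1)) * S.q2 n = S.e n * S.D n (S.q2 (n + 1))

variable {S n}

lemma Dep.of_smul {c a : A n} (hc : c ≠ 0) (h : c • S.C3 n = a • S.C2 n) : S.Dep n := by
  have h1 := congrArg (fun W : Derivation ℤ (A n) (A n) => W (S.t n 1)) h
  simp only [Derivation.smul_apply, C2_t1, C3_t1, smul_eq_mul, ← q2_mu] at h1
  have h2 : a = c * S.mu n := mul_right_cancel₀ (S.q2_ne_zero n) (by linear_combination -h1)
  refine sub_eq_zero.1 (vertical_smul_cancel hc ?_)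
  rw [smul_sub, h, h2, smul_smul, sub_self]

/-- Coefficients of a relation between `C_3, C_2, C_1, X` vanish unless `C_3` is a multiple
of `C_2`. -/
lemma coeffs_eq_zero (hn : ¬ S.Dep n) {a b c d : A n}
    (h : a • S.C3 n + b • S.C2 n + c • S.C1 n + d • S.X n = 0) :
    a = 0 ∧ b = 0 ∧ c = 0 ∧ d = 0 := by
  have hc := congrArg (fun W : Derivation ℤ (A n) (A n) => W (S.t n 0)) h
  simp [C1_t0, X_t, (S.C3_vertical n).2.2.2, (S.C2_vertical n).2.2.2] at hc
  have hd := congrArg (fun W : Derivation ℤ (A n) (A n) => W (S.tx n)) h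
  simp [C1_tx, X_tx, (S.C3_vertical n).2.2.1, (S.C2_vertical n).2.2.1] at hd
  subst hc hd
  rw [zero_smul, zero_smul, add_zero, add_zero] at h
  have ha : a = 0 := by
    by_contra ha
    refine hn (Dep.of_smul ha (a := -b) ?_)
    rw [neg_smul]; exact eq_neg_of_add_eq_zero_left h
  have hb := congrArg (fun W : Derivation ℤ (A n) (A n) => W (S.t n 1)) h
  simp [ha, C2_t1, S.q2_ne_zero n] at hb
  exact ⟨ha, hb, rfl, rfl⟩

/-- Same mechanism as for Z_1: ν cancels the C_2-part of the conjugate of C_3, and the remaining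
combination of C_1 and X must vanish. -/
lemma Dep.succ (h : S.Dep n) : S.Dep (n + 1) ∧ S.DepCond n := by
  obtain ⟨b, hab⟩ := S.related_C3 n
  set ν := (S.D n).symm (S.mu n * S.qi n - 3 * S.q2 n * S.qi n ^ 2) with hν
  have hD : S.D n ν = S.mu n * S.qi n - 3 * S.q2 n * S.qi n ^ 2 := by simp [hν]
  have h0 : S.C3 (n + 1) - ν • S.C2 (n + 1) = 0 := by
    refine related_eq_zero (sub_mem (S.C3_vertical _)
      (Submodule.smul_mem _ _ (S.C2_vertical _))) ((hab.sub ((S.related_C2 n).smul ν)).of_eq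
        (Z := (-(S.e n * S.qi n ^ 3) + S.D n ν * (S.q2 n * S.qi n ^ 3)) • S.C1 n + (b - S.D n ν *
        (S.v n * S.q2 n * S.qi n ^ 4 - S.qi n ^ 3 * S.C2 n (S.f n))) • S.X n) ?_)
    rw [hD, show S.C3 n = S.mu n • S.C2 n from h]
    match_scalars <;> ring
  have h1 := mu_eq (sub_eq_zero.1 h0)
  refine ⟨?_, ?_⟩
  · rw [Dep, h1]; exact sub_eq_zero.1 h0
  · rw [DepCond, ← q2_mu, h1, map_mul, hD, e]
    linear_combination S.D n (S.q2 (n + 1)) * S.qi n * S.q2_mu n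

lemma Dep.of_succ (h : S.Dep (n + 1)) : S.Dep n := by
  obtain ⟨b, hab⟩ := S.related_C3 n
  have h1 := Related.eq_zero_right (((hab.sub ((S.related_C2 n).smul (S.mu (n + 1)))).of_eq rfl :
    S.Related (S.C3 (n + 1) - S.mu (n + 1) • S.C2 (n + 1)) _) |> (sub_eq_zero.2 h ▸ ·))
  by_contra hn
  have h2 := (coeffs_eq_zero hn (a := S.qi n ^ 3)
    (b := -(3 * S.q2 n * S.qi n ^ 4) - S.D n (S.mu (n + 1)) * S.qi n ^ 2)
    (c := -(S.e n * S.qi n ^ 3) + S.D n (S.mu (n + 1)) * (S.q2 n * S.qi n ^ 3))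
    (d := b - S.D n (S.mu (n + 1)) *
        (S.v n * S.q2 n * S.qi n ^ 4 - S.qi n ^ 3 * S.C2 n (S.f n))) (by
      rw [← h1]; match_scalars <;> ring)).1
  exact pow_ne_zero 3 (S.qi_ne_zero n) h2

lemma dep_iff (n : ℤ) : S.Dep n ↔ S.Dep (n + 1) := ⟨fun h => h.succ.1, Dep.of_succ⟩


lemma Dep.zero (h : S.Dep n) : S.Dep 0 := by
  have : ∀ m, S.Dep (m + n) := int_induction_iff (P := fun m => S.Dep (m + n))
    (fun m => by rw [dep_iff, add_right_comm]) (by simpa using h)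
  simpa using this (-n)

/-- The condition says that D μ equals μ qi - 3 q2 qi², the value for which the conjugate of C_3 - μ
C_2 is qi³ times that field modulo C_1 and X. -/
lemma dep_of_depCond (h : ∀ n, S.DepCond n) : ∀ n, S.Dep n := by
  choose b hab using S.related_C3
  have hmu : ∀ n, S.D n (S.mu (n + 1)) = S.mu n * S.qi n - 3 * S.q2 n * S.qi n ^ 2 := fun n => by
    refine mul_left_cancel₀ (mul_ne_zero (S.D_ne_zero n (S.q2_ne_zero (n + 1)))
      (S.q2_ne_zero n)) ?_
    have h1 := h n
    rw [DepCond, ← q2_mu, map_mul, e] at h1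
    linear_combination h1 - S.qi n * S.D n (S.q2 (n + 1)) * S.q2_mu n
  have h2 := eq_zero_of_related_mod_C1 (S := S) (Y := fun n => S.C3 n - S.mu n • S.C2 n)
    (a := fun n => S.qi n ^ 3)
    (c := fun n => -(S.e n * S.qi n ^ 3) + S.D n (S.mu (n + 1)) * (S.q2 n * S.qi n ^ 3))
    (d := fun n => b n - S.D n (S.mu (n + 1)) *
        (S.v n * S.q2 n * S.qi n ^ 4 - S.qi n ^ 3 * S.C2 n (S.f n)))
    (fun n => sub_mem (S.C3_vertical _) (Submodule.smul_mem _ _ (S.C2_vertical _)))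
    (fun n => by simp [C2_t1, C3_t1, ← q2_mu, mul_comm])
    (fun n => (hab n).sub ((S.related_C2 n).smul (S.mu (n + 1))))
    (fun n => pow_ne_zero 3 (S.qi_ne_zero n))
    (fun n => by rw [hmu]; match_scalars <;> ring)
  exact fun n => sub_eq_zero.1 (h2 n)

end ShiftChain
end SemiDiscrete

/-! ### The difference systems for M = ū C_2 + u C_3. -/

namespace SemiDiscrete
namespace ShiftChain

variable {A : ℤ → Type*} [∀ n, CommRing (A n)]

/-- Vertical derivations `M` whose conjugate by the shift is a combination of `M`, `C_3`, `C_2`,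
`C_1`, `X`. Then `M = ū C_2 + u C_3` is equivalent to the difference system
`β u - D u = F1`, `3 q2 / q² D u + β / q ū - D ū = F2`, `e D u + q2 D ū = F3`. Solving it,
one gets `u = num / del`. -/
structure System (S : ShiftChain A) where
  M : ∀ n, Derivation ℤ (A n) (A n)
  (β F1 F2 F3 c : ∀ n, A n)
  M_vertical : ∀ n, M n ∈ S.vertical n
  β_ne_zero : ∀ n, β n ≠ 0
  related_M : ∀ n, S.Related (M (n + 1)) ((S.qi n ^ 3 * β n) • M n - (S.qi n ^ 3 * F1 n) • S.C3 n
    - (S.qi n ^ 2 * F2 n) • S.C2 n - (S.qi n ^ 3 * F3 n) • S.C1 n + c n • S.X n)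
  (num del : ∀ n, A n)
  D_del : ∀ n, S.D n (del (n + 1)) = S.D n (S.qi (n + 1) * β (n + 1)) *
    (S.e n * S.D n (S.q2 (n + 1)) - S.D n (S.q3 (n + 1)) * S.q2 n)
  D_num : ∀ n, S.D n (num (n + 1)) = F3 n * S.D n (S.qi (n + 1) * β (n + 1) * S.q2 (n + 1)) -
    S.D n (F1 (n + 1) * S.q3 (n + 1) * S.qi (n + 1) + F2 (n + 1) * S.q2 (n + 1) + F3 (n + 1))
      * S.q2 n

namespace System

section Conditions

variable {S : ShiftChain A} (T : S.System) (n : ℤ)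

/-- The compatibility condition `D u = β u - F1` for `u = num / del`. -/
def Compat : Prop :=
  S.D n (T.num (n + 1)) * T.del n = (T.β n * T.num n - T.F1 n * T.del n) * S.D n (T.del (n + 1))

def Spanned : Prop := ∃ d a b : A n, d ≠ 0 ∧ d • T.M n = a • S.C2 n + b • S.C3 n

end Conditions

variable [∀ n, IsDomain (A n)] {S : ShiftChain A} (T : S.System) (n : ℤ)

/-- The other factor of D Δ is a nonzero germ, so the determinant tests the dependence of C_2 and
C_3. The index is n+1 because Δ contains D⁻¹ of data from the preceding site. -/
lemma del_eq_zero_iff : T.del (n + 1) = 0 ↔ S.DepCond n := by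
  rw [← map_eq_zero_iff _ (S.D n).injective, T.D_del, mul_eq_zero, or_iff_right
    (S.D_ne_zero n (mul_ne_zero (S.qi_ne_zero _) (T.β_ne_zero _))), sub_eq_zero, eq_comm, DepCond]

lemma spanned_of_compat (hdel : ∀ n, T.del n ≠ 0) (h : ∀ n, T.Compat n) (n : ℤ) :
    T.Spanned n := by
  choose c3 hc3 using S.related_C3
  -- The solution over the common denominator d is u = b / d = num / del and ū = a / d. The formula
  -- for a comes from eliminating Du and Dū from the three equations, using e + 3 q2² qi² = q3 qi.
  set a : ∀ n, A n := fun n =>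
    (T.F1 n * S.q3 n * S.qi n + T.F2 n * S.q2 n + T.F3 n) * T.del n
      - S.q3 n * S.qi n * T.β n * T.num n with ha
  set b : ∀ n, A n := fun n => S.qi n * T.β n * S.q2 n * T.num n with hb
  set d : ∀ n, A n := fun n => S.qi n * T.β n * S.q2 n * T.del n with hd
  set s : ∀ n, A n := fun n => S.D n (S.qi (n + 1) * T.β (n + 1) * S.q2 (n + 1)) with hs
  have hd0 : ∀ n, d n ≠ 0 := fun n => mul_ne_zero (mul_ne_zero (mul_ne_zero (S.qi_ne_zero n)
    (T.β_ne_zero n)) (S.q2_ne_zero n)) (hdel n)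
  have hs0 : ∀ n, s n ≠ 0 := fun n => S.D_ne_zero n (mul_ne_zero (mul_ne_zero (S.qi_ne_zero _)
    (T.β_ne_zero _)) (S.q2_ne_zero _))
  -- This is the third equation, cleared of denominators. It holds identically, because its D⁻¹ was
  -- one of the four equations defining num and del.
  have hDa : ∀ n, S.D n (a (n + 1)) * S.q2 n =
      s n * (T.F3 n * S.D n (T.del (n + 1)) - S.e n * S.D n (T.num (n + 1))) := fun n => by
    have h1 := T.D_num n
    have h2 := T.D_del n
    simp only [map_mul, map_sub, map_add, ha, hs] at h1 h2 ⊢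
    linear_combination S.D n (T.del (n + 1)) * h1 - S.D n (T.num (n + 1)) * h2
  have key := eq_zero_of_related (S := S)
    (Y := fun n => d n • T.M n - a n • S.C2 n - b n • S.C3 n)
    (W := fun n => S.D n (d (n + 1)) • ((S.qi n ^ 3 * T.β n) • T.M n
      - (S.qi n ^ 3 * T.F1 n) • S.C3 n - (S.qi n ^ 2 * T.F2 n) • S.C2 n
      - (S.qi n ^ 3 * T.F3 n) • S.C1 n + T.c n • S.X n)
      - S.D n (a (n + 1)) • (S.qi n ^ 2 • S.C2 n - (S.q2 n * S.qi n ^ 3) • S.C1 n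
    + (S.v n * S.q2 n * S.qi n ^ 4 - S.qi n ^ 3 * S.C2 n (S.f n)) • S.X n)
      - S.D n (b (n + 1)) • (S.qi n ^ 3 • S.C3 n
    - (3 * S.q2 n * S.qi n ^ 4) • S.C2 n - (S.e n * S.qi n ^ 3) • S.C1 n + c3 n • S.X n))
    (a := fun n => s n * S.D n (T.del (n + 1)) * S.qi n ^ 2)
    (b := fun n => S.q2 n * T.del n)
    (d := fun n => S.q2 n * T.del n * (S.D n (d (n + 1)) * T.c n - S.D n (a (n + 1)) *
      (S.v n * S.q2 n * S.qi n ^ 4 - S.qi n ^ 3 * S.C2 n (S.f n)) - S.D n (b (n + 1)) * c3 n))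
    ?_ ?_ ?_ ?_ ?_
  · refine ⟨d n, a n, b n, hd0 n, ?_⟩
    have := key n
    rw [sub_sub] at this
    exact sub_eq_zero.1 this
  · exact fun n => sub_mem (sub_mem (Submodule.smul_mem _ _ (T.M_vertical n))
      (Submodule.smul_mem _ _ (S.C2_vertical n))) (Submodule.smul_mem _ _ (S.C3_vertical n))
  · exact fun n => (((T.related_M n).smul (d (n + 1))).sub ((S.related_C2 n).smul _)).sub
      ((hc3 n).smul _)
  · exact fun n => mul_ne_zero (mul_ne_zero (hs0 n) (S.D_ne_zero n (hdel _)))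
      (pow_ne_zero 2 (S.qi_ne_zero n))
  · exact fun n => mul_ne_zero (S.q2_ne_zero n) (hdel n)
  · intro n
    have h1 : S.D n (d (n + 1)) = s n * S.D n (T.del (n + 1)) := by simp [hd, hs]
    have h2 : S.D n (b (n + 1)) = s n * S.D n (T.num (n + 1)) := by simp [hb, hs]
    have h3 := h n
    have h4 := hDa n
    rw [Compat] at h3
    have h5 : S.e n + 3 * S.q2 n ^ 2 * S.qi n ^ 2 = S.q3 n * S.qi n := by rw [e]; ring
    rw [h1, h2]
    match_scalars
    -- The coefficients of M, C_3, C_2, C_1 and X are compared in turn: C_3 uses the first equation,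
    -- which is compatibility; C_2 uses the first and third, C_1 the third alone.
    · simp only [hd]; ring
    · simp only [hb]
      linear_combination S.q2 n * s n * S.qi n ^ 3 * (-1) * h3
    · simp only [ha]
      linear_combination -T.del n * S.qi n ^ 2 * h4 +
        T.del n * s n * S.qi n ^ 2 * S.D n (T.num (n + 1)) * h5 + s n * S.qi n ^ 3 * S.q3 n * h3
    · linear_combination T.del n * S.qi n ^ 3 * S.q2 n * h4
    · ring

/-- The equations satisfied by the coefficients of `d M = a C_2 + b C_3` at adjacent sites. -/
lemma equations (hn : ¬ S.Dep n) {d a b : A n} {d' a' b' : A (n + 1)}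
    (h : d • T.M n = a • S.C2 n + b • S.C3 n)
    (h' : d' • T.M (n + 1) = a' • S.C2 (n + 1) + b' • S.C3 (n + 1)) :
    d * S.D n b' = S.D n d' * (T.β n * b - T.F1 n * d) ∧
    S.D n d' * S.qi n * T.β n * a - d * S.D n d' * T.F2 n - d * S.D n a' +
      3 * S.q2 n * S.qi n ^ 2 * d * S.D n b' = 0 ∧
    d * (S.D n a' * S.q2 n + S.D n b' * S.e n - S.D n d' * T.F3 n) = 0 := by
  obtain ⟨c3, hc3⟩ := S.related_C3 n
  have h1 := Related.eq_zero_right (sub_eq_zero.2 h' ▸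
    ((T.related_M n).smul d').sub (((S.related_C2 n).smul a').add (hc3.smul b')))
  rw [← sub_eq_zero, ← sub_sub] at h
  have h2 := coeffs_eq_zero hn
    (a := S.D n d' * (S.qi n ^ 3 * T.β n) * b - d * S.D n d' * (S.qi n ^ 3 * T.F1 n)
      - d * S.D n b' * S.qi n ^ 3)
    (b := S.D n d' * (S.qi n ^ 3 * T.β n) * a - d * S.D n d' * (S.qi n ^ 2 * T.F2 n)
      - d * S.D n a' * S.qi n ^ 2 + d * S.D n b' * (3 * S.q2 n * S.qi n ^ 4))
    (c := -d * S.D n d' * (S.qi n ^ 3 * T.F3 n) + d * S.D n a' * (S.q2 n * S.qi n ^ 3)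
      + d * S.D n b' * (S.e n * S.qi n ^ 3))
    (d := d * (S.D n d' * T.c n - S.D n a' *
      (S.v n * S.q2 n * S.qi n ^ 4 - S.qi n ^ 3 * S.C2 n (S.f n)) - S.D n b' * c3)) (by
      refine Eq.trans ?_ ((congrArg₂ (fun U V : Derivation ℤ (A n) (A n) =>
        d • U - (S.D n d' * (S.qi n ^ 3 * T.β n)) • V) h1 h).trans (by simp))
      match_scalars <;> ring)
  refine ⟨?_, ?_, ?_⟩
  · refine mul_left_cancel₀ (pow_ne_zero 3 (S.qi_ne_zero n)) ?_
    linear_combination -h2.1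
  · refine mul_left_cancel₀ (pow_ne_zero 2 (S.qi_ne_zero n)) ?_
    linear_combination h2.2.1
  · refine mul_left_cancel₀ (pow_ne_zero 3 (S.qi_ne_zero n)) ?_
    linear_combination h2.2.2.1

/-- Take d' = D⁻¹ d and choose b', a' to cancel the C_3- and C_2-parts of the conjugate. The rest is
a combination of C_1 and X, so it vanishes; independence of C_2 and C_3 is not needed. -/
lemma Spanned.succ {T : S.System} {n : ℤ} (h : T.Spanned n) : T.Spanned (n + 1) := by
  obtain ⟨c3, hc3⟩ := S.related_C3 n
  obtain ⟨d, a, b, hd, h⟩ := h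
  set n2 := S.v n * S.q2 n * S.qi n ^ 4 - S.qi n ^ 3 * S.C2 n (S.f n) with hn2
  set b' := (S.D n).symm (T.β n * b - d * T.F1 n) with hb'
  set a' := (S.D n).symm (S.qi n * T.β n * a - d * T.F2 n
    + 3 * S.q2 n * S.qi n ^ 2 * (T.β n * b - d * T.F1 n)) with ha'
  have hDb : S.D n b' = T.β n * b - d * T.F1 n := by simp [hb']
  have hDa : S.D n a' = S.qi n * T.β n * a - d * T.F2 n
    + 3 * S.q2 n * S.qi n ^ 2 * (T.β n * b - d * T.F1 n) := by simp [ha']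
  have hDd : S.D n ((S.D n).symm d) = d := by simp
  refine ⟨(S.D n).symm d, a', b', by simpa using hd, sub_eq_zero.1 ?_⟩
  refine related_eq_zero (sub_mem (Submodule.smul_mem _ _ (T.M_vertical _)) (add_mem
    (Submodule.smul_mem _ _ (S.C2_vertical _)) (Submodule.smul_mem _ _ (S.C3_vertical _))))
    ((((T.related_M n).smul _).sub (((S.related_C2 n).smul a').add (hc3.smul b'))).of_eq
    (Z := (-(d * (S.qi n ^ 3 * T.F3 n)) + S.D n a' * (S.q2 n * S.qi n ^ 3)
      + S.D n b' * (S.e n * S.qi n ^ 3)) • S.C1 n +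
      (d * T.c n - S.D n a' * n2 - S.D n b' * c3) • S.X n) ?_)
  rw [hDd, ← hn2]
  trans (S.qi n ^ 3 * T.β n) • (d • T.M n - (a • S.C2 n + b • S.C3 n)) +
    ((-(d * (S.qi n ^ 3 * T.F3 n)) + S.D n a' * (S.q2 n * S.qi n ^ 3)
      + S.D n b' * (S.e n * S.qi n ^ 3)) • S.C1 n +
      (d * T.c n - S.D n a' * n2 - S.D n b' * c3) • S.X n)
  · rw [hDb, hDa]
    match_scalars <;> ring
  · rw [h, sub_self, smul_zero, zero_add]

/-- Conjugating the relation gives one at site n, in which M has the nonzero coefficient D d' · qi³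
β; evaluation on t_0 and t_x removes C_1 and X. -/
lemma Spanned.of_succ {T : S.System} {n : ℤ} (h : T.Spanned (n + 1)) : T.Spanned n := by
  obtain ⟨c3, hc3⟩ := S.related_C3 n
  obtain ⟨d', a', b', hd', h'⟩ := h
  have h1 := Related.eq_zero_right (sub_eq_zero.2 h' ▸
    ((T.related_M n).smul d').sub (((S.related_C2 n).smul a').add (hc3.smul b')))
  set n2 := S.v n * S.q2 n * S.qi n ^ 4 - S.qi n ^ 3 * S.C2 n (S.f n) with hn2
  have hc := congrArg (fun W : Derivation ℤ (A n) (A n) => W (S.t n 0)) h1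
  simp [C1_t0, X_t, (S.C3_vertical n).2.2.2, (S.C2_vertical n).2.2.2,
    (T.M_vertical n).2.2.2] at hc
  have hx := congrArg (fun W : Derivation ℤ (A n) (A n) => W (S.tx n)) h1
  simp [C1_tx, X_tx, (S.C3_vertical n).2.2.1, (S.C2_vertical n).2.2.1,
    (T.M_vertical n).2.2.1] at hx
  refine ⟨S.D n d' * (S.qi n ^ 3 * T.β n), S.D n d' * (S.qi n ^ 2 * T.F2 n)
    + S.D n a' * S.qi n ^ 2 - S.D n b' * (3 * S.q2 n * S.qi n ^ 4),
    S.D n d' * (S.qi n ^ 3 * T.F1 n) + S.D n b' * S.qi n ^ 3,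
    mul_ne_zero (S.D_ne_zero n hd') (mul_ne_zero (pow_ne_zero 3 (S.qi_ne_zero n))
      (T.β_ne_zero n)), ?_⟩
  rw [← sub_eq_zero, ← h1]
  match_scalars
  · ring
  · ring
  · ring
  · linear_combination -hc
  · linear_combination -hx

lemma spanned_iff : T.Spanned n ↔ T.Spanned (n + 1) := ⟨Spanned.succ, Spanned.of_succ⟩

lemma compat_of_spanned (hn : ∀ n, ¬ S.Dep n) (h0 : T.Spanned 0) : ∀ n, T.Compat n := by
  choose d a b hd hM using int_induction_iff T.spanned_iff h0
  have hE n := T.equations n (hn n) (hM n) (hM (n + 1))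
  have hE3 : ∀ n, S.D n (a (n + 1)) * S.q2 n + S.D n (b (n + 1)) * S.e n
      = S.D n (d (n + 1)) * T.F3 n := fun n =>
    sub_eq_zero.1 ((mul_eq_zero.1 (hE n).2.2).resolve_left (hd n))
  -- Elimination of Du and Dū: the formula for ū in terms of u.
  have hE4 : ∀ n, S.qi n * T.β n * S.q2 n * a n = d n * (T.F1 n * S.q3 n * S.qi n
      + T.F2 n * S.q2 n + T.F3 n) - S.q3 n * S.qi n * T.β n * b n := fun n => by
    obtain ⟨h1, h2, -⟩ := hE n
    have h5 : S.e n + 3 * S.q2 n ^ 2 * S.qi n ^ 2 = S.q3 n * S.qi n := by rw [e]; ring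
    refine mul_left_cancel₀ (S.D_ne_zero n (hd (n + 1))) ?_
    linear_combination S.q2 n * h2 + d n * hE3 n - (S.e n + 3 * S.q2 n ^ 2 * S.qi n ^ 2) * h1
      - S.D n (d (n + 1)) * (T.β n * b n - T.F1 n * d n) * h5
  -- Here u = num / del is derived. After one shift, the formula for ū and the third equation at the
  -- previous site both involve the unknowns at n+1; eliminating the shifted ū leaves del · u = num.
  have hH : ∀ n, T.del n * b n = T.num n * d n := fun n => by
    obtain ⟨n, rfl⟩ : ∃ m, n = m + 1 := ⟨n - 1, by ring⟩
    apply (S.D n).injective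
    have h4 := congrArg (S.D n) (hE4 (n + 1))
    have h6 := T.D_del n
    have h7 := T.D_num n
    simp only [map_mul, map_add, map_sub] at h4 h6 h7 ⊢
    linear_combination S.D n (b (n + 1)) * h6 - S.D n (d (n + 1)) * h7 - S.q2 n * h4 +
      S.D n (S.qi (n + 1)) * S.D n (T.β (n + 1)) * S.D n (S.q2 (n + 1)) * hE3 n
  intro n
  refine mul_left_cancel₀ (mul_ne_zero (hd n) (S.D_ne_zero n (hd (n + 1)))) ?_
  have h8 := congrArg (S.D n) (hH (n + 1))
  simp only [map_mul] at h8
  linear_combination -T.del n * d n * h8 + T.del n * S.D n (T.del (n + 1)) * (hE n).1 +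
    S.D n (T.del (n + 1)) * S.D n (d (n + 1)) * T.β n * hH n

end System
end ShiftChain
end SemiDiscrete

/-! ### Saturated spans and bases of the ring generated by X and K. -/

namespace SemiDiscrete
namespace ShiftChain

lemma lie_smul_right {R : Type*} [CommRing R] (V W : Derivation ℤ R R) (a : R) :
    ⁅V, a • W⁆ = a • ⁅V, W⁆ + V a • W := by
  ext F
  simp only [Derivation.commutator_apply, Derivation.smul_apply, Derivation.add_apply,
    Derivation.leibniz, smul_eq_mul]
  ring

section Saturation

variable {R : Type*} [CommRing R] [IsDomain R] {ι : Type*} (B : ι → Derivation ℤ R R)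

/-- The derivations with a nonzero multiple in the span of the family `B`. -/
def saturation : Submodule R (Derivation ℤ R R) where
  carrier := {V | ∃ c : R, c ≠ 0 ∧ c • V ∈ Submodule.span R (Set.range B)}
  add_mem' := by
    rintro V W ⟨c, hc, hV⟩ ⟨d, hd, hW⟩
    refine ⟨c * d, mul_ne_zero hc hd, ?_⟩
    rw [smul_add, mul_comm c d, mul_smul, mul_comm d c, mul_smul]
    exact add_mem (Submodule.smul_mem _ _ hV) (Submodule.smul_mem _ _ hW)
  zero_mem' := ⟨1, one_ne_zero, by simp⟩
  smul_mem' := by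
    rintro a V ⟨c, hc, hV⟩
    exact ⟨c, hc, by rw [smul_comm]; exact Submodule.smul_mem _ _ hV⟩

variable {B}

lemma mem_saturation_of_smul {V : Derivation ℤ R R} {c : R} (hc : c ≠ 0)
    (h : c • V ∈ saturation B) : V ∈ saturation B := by
  obtain ⟨d, hd, h⟩ := h
  exact ⟨d * c, mul_ne_zero hd hc, by rwa [mul_smul]⟩

lemma span_le_saturation : Submodule.span R (Set.range B) ≤ saturation B := fun V hV =>
  ⟨1, one_ne_zero, by rwa [one_smul]⟩

lemma mem_saturation (i : ι) : B i ∈ saturation B :=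
  span_le_saturation (Submodule.subset_span ⟨i, rfl⟩)

/-- If brackets with `V` map the family `B` to its saturation, then they preserve the saturation. -/
lemma lie_mem_saturation {V : Derivation ℤ R R} (h : ∀ i, ⁅V, B i⁆ ∈ saturation B)
    {W : Derivation ℤ R R} (hW : W ∈ saturation B) : ⁅V, W⁆ ∈ saturation B := by
  have hspan : ∀ U ∈ Submodule.span R (Set.range B), ⁅V, U⁆ ∈ saturation B := fun U hU => by
    induction hU using Submodule.span_induction with
    | mem U hU => obtain ⟨i, rfl⟩ := hU; exact h i
    | zero => simp
    | add U U' _ _ h1 h2 => rw [lie_add]; exact add_mem h1 h2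
    | smul a U hU h1 =>
      rw [lie_smul_right]
      exact add_mem (Submodule.smul_mem _ _ h1) (Submodule.smul_mem _ _ (span_le_saturation hU))
  obtain ⟨c, hc, hcW⟩ := hW
  have h1 := hspan _ hcW
  rw [lie_smul_right] at h1
  -- Since ⁅V, c W⁆ = c ⁅V, W⁆ + (V c) W, and both the left side and (V c) W lie in the saturation,
  -- so does c ⁅V, W⁆; the factor c is then removed.
  refine mem_saturation_of_smul hc ?_
  have h2 : V c • W ∈ saturation B := Submodule.smul_mem _ _ ⟨c, hc, hcW⟩
  simpa using sub_mem h1 h2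

lemma lie_mem_saturation_both (h : ∀ i j, ⁅B i, B j⁆ ∈ saturation B) {V W : Derivation ℤ R R}
    (hV : V ∈ saturation B) (hW : W ∈ saturation B) : ⁅V, W⁆ ∈ saturation B := by
  refine lie_mem_saturation (fun j => ?_) hW
  rw [← lie_skew]
  exact neg_mem (lie_mem_saturation (fun i => h j i) hV)

end Saturation

variable {A : ℤ → Type*} [∀ n, CommRing (A n)] (S : ShiftChain A) (n : ℤ)

/-- The ring of derivations generated by `X` and `K`. -/
inductive Gen : Derivation ℤ (A n) (A n) → Prop
  | genX : Gen (S.X n)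
  | genK : Gen (S.K n)
  | add {V W : Derivation ℤ (A n) (A n)} : Gen V → Gen W → Gen (V + W)
  | smul (a : A n) {V : Derivation ℤ (A n) (A n)} : Gen V → Gen (a • V)
  | comm {V W : Derivation ℤ (A n) (A n)} : Gen V → Gen W → Gen ⁅V, W⁆

variable {S n} in
lemma Gen.induction {p : Derivation ℤ (A n) (A n) → Prop} (hX : p (S.X n)) (hK : p (S.K n))
    (add : ∀ V W, p V → p W → p (V + W)) (smul : ∀ (a : A n) V, p V → p (a • V))
    (comm : ∀ V W, p V → p W → p ⁅V, W⁆) {V : Derivation ℤ (A n) (A n)} (h : S.Gen n V) : p V := by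
  induction h with
  | genX => exact hX
  | genK => exact hK
  | add _ _ h h' => exact add _ _ h h'
  | smul a _ h => exact smul a _ h
  | comm _ _ h h' => exact comm _ _ h h'

/-- `B` is a basis over the fractions of the ring generated by `X` and `K`. -/
def IsBasis (B : Fin 5 → Derivation ℤ (A n) (A n)) : Prop :=
  (∀ a : Fin 5 → A n, ∑ i, a i • B i = 0 → ∀ i, a i = 0) ∧
  ∀ V, S.Gen n V → ∃ (c : A n) (a : Fin 5 → A n), c ≠ 0 ∧ c • V = ∑ i, a i • B i

def famC : Fin 5 → Derivation ℤ (A n) (A n) := ![S.X n, S.K n, S.C1 n, S.C2 n, S.C3 n]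

def famZ : Fin 5 → Derivation ℤ (A n) (A n) := ![S.X n, S.K n, S.C1 n, S.C2 n, S.Z1 n]

lemma gen_C1 : S.Gen n (S.C1 n) := .comm .genX .genK
lemma gen_C2 : S.Gen n (S.C2 n) := .comm .genX (S.gen_C1 n)
lemma gen_C3 : S.Gen n (S.C3 n) := .comm .genX (S.gen_C2 n)
lemma gen_C4 : S.Gen n (S.C4 n) := .comm .genX (S.gen_C3 n)
lemma gen_Z1 : S.Gen n (S.Z1 n) := .comm .genK (S.gen_C1 n)

variable {S n}

/-- Evaluation on x, t_x and t_0 isolates the coefficients of K, X and C_1 and annihilates the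
vertical part. -/
lemma coeffs_XKC1 {V : Derivation ℤ (A n) (A n)} (hV : V ∈ S.vertical n) {a b c : A n}
    (h : a • S.X n + b • S.K n + c • S.C1 n + V = 0) : a = 0 ∧ b = 0 ∧ c = 0 ∧ V = 0 := by
  have hb := congrArg (fun W : Derivation ℤ (A n) (A n) => W (S.x n)) h
  simp [X_x, K_x, C1_x, hV.2.1] at hb
  have ha := congrArg (fun W : Derivation ℤ (A n) (A n) => W (S.tx n)) h
  simp [X_tx, K_tx, C1_tx, hV.2.2.1] at ha
  subst ha hb
  have hc := congrArg (fun W : Derivation ℤ (A n) (A n) => W (S.t n 0)) h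
  simp [C1_t0, hV.2.2.2] at hc
  subst hc
  simpa using h

lemma vertical_relation {V W : Derivation ℤ (A n) (A n)} (hV : V ∈ S.vertical n)
    (hW : W ∈ S.vertical n) {c : A n} {a : Fin 5 → A n}
    (h : c • V = ∑ i, a i • ![S.X n, S.K n, S.C1 n, S.C2 n, W] i) :
    c • V = a 3 • S.C2 n + a 4 • W := by
  have h1 := (coeffs_XKC1 (V := a 3 • S.C2 n + a 4 • W - c • V) (a := a 0) (b := a 1) (c := a 2)
    (sub_mem (add_mem (Submodule.smul_mem _ _ (S.C2_vertical n)) (Submodule.smul_mem _ _ hW))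
      (Submodule.smul_mem _ _ hV)) (by
      rw [h, Fin.sum_univ_five]
      simp only [Matrix.cons_val]
      abel)).2.2.2
  exact (sub_eq_zero.1 h1).symm

lemma System.spanned_of_isBasis {T : S.System} (hb : S.IsBasis n (S.famC n))
    (hg : S.Gen n (T.M n)) : T.Spanned n := by
  obtain ⟨c, a, hc, h⟩ := hb.2 _ hg
  exact ⟨c, a 3, a 4, hc, vertical_relation (T.M_vertical n) (S.C3_vertical n) h⟩

variable [∀ n, IsDomain (A n)]

/-- The coefficients of X, K, C_1 vanish by evaluation on x, t_x, t_0. Once the coefficient of W is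
zero, C_2 t_1 ≠ 0 removes the coefficient of C_2. -/
lemma independent_iff {W : Derivation ℤ (A n) (A n)} (hW : W ∈ S.vertical n) :
    (∀ a : Fin 5 → A n, ∑ i, a i • ![S.X n, S.K n, S.C1 n, S.C2 n, W] i = 0 → ∀ i, a i = 0) ↔
      ∀ a b : A n, a • S.C2 n + b • W = 0 → b = 0 := by
  constructor
  · intro h a b hab
    exact h ![0, 0, 0, a, b] (by simpa [Fin.sum_univ_five] using hab) 4
  · intro h a ha
    rw [Fin.sum_univ_five] at ha
    simp only [Matrix.cons_val] at ha
    rw [add_assoc] at ha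
    obtain ⟨h0, h1, h2, h3⟩ := coeffs_XKC1 (add_mem
      (Submodule.smul_mem _ (a 3) (S.C2_vertical n)) (Submodule.smul_mem _ (a 4) hW)) ha
    have h4 := h _ _ h3
    have h5 := congrArg (fun U : Derivation ℤ (A n) (A n) => U (S.t n 1)) h3
    simp [h4, C2_t1, S.q2_ne_zero n] at h5
    intro i
    fin_cases i
    exacts [h0, h1, h2, h5, h4]

lemma famC_independent_iff : (∀ a : Fin 5 → A n, ∑ i, a i • S.famC n i = 0 → ∀ i, a i = 0) ↔
    ¬ S.Dep n := by
  rw [famC, independent_iff (S.C3_vertical n)]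
  constructor
  · intro h hd
    have := h (S.mu n) (-1) (by rw [show S.C3 n = S.mu n • S.C2 n from hd]; simp)
    simp at this
  · intro h a b hab
    exact (coeffs_eq_zero h (a := b) (b := a) (c := 0) (d := 0) (by rw [← hab]; module)).1

lemma not_isBasis_famZ (h : S.ZDep n) : ¬ S.IsBasis n (S.famZ n) := by
  rintro ⟨h1, -⟩
  rw [famZ, independent_iff (S.Z1_vertical n)] at h1
  have := h1 (S.lam n) (-1) (by rw [show S.Z1 n = S.lam n • S.C2 n from h]; simp)
  simp at this

/-- If the family with `C_3` is a basis and the family with `Z_1` is not, then `Z_1` is a multiple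
of `C_2`. -/
lemma zdep_of_isBasis (h : S.IsBasis n (S.famC n)) (h' : ¬ S.IsBasis n (S.famZ n)) :
    S.ZDep n := by
  obtain ⟨c, a, hc, hZ⟩ := h.2 _ (S.gen_Z1 n)
  have hZ' := vertical_relation (S.Z1_vertical n) (S.C3_vertical n) hZ
  by_cases ha : a 4 = 0
  · exact ZDep.of_smul hc (by rw [hZ', ha, zero_smul, add_zero])
  -- If c Z_1 has a nonzero C_3-part a 4, then C_3 may be exchanged for Z_1: multiplying by a 4 lets
  -- C_3 be replaced by (c Z_1 - a 3 C_2) / a 4.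
  refine absurd ⟨?_, ?_⟩ h'
  · rw [famZ, independent_iff (S.Z1_vertical n)]
    intro r s hrs
    have h1 : (c * r + s * a 3) • S.C2 n + (s * a 4) • S.C3 n = 0 := by
      rw [← smul_zero c, ← hrs, smul_add, smul_comm c s, hZ']
      module
    have := (independent_iff (S.C3_vertical n)).1 h.1 _ _ h1
    exact (mul_eq_zero.1 this).resolve_right ha
  · intro V hV
    obtain ⟨r, b, hr, hb⟩ := h.2 V hV
    refine ⟨a 4 * r, ![a 4 * b 0, a 4 * b 1, a 4 * b 2, a 4 * b 3 - b 4 * a 3, b 4 * c],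
      mul_ne_zero ha hr, ?_⟩
    rw [mul_smul, hb]
    simp only [famC, famZ, Fin.sum_univ_five, Matrix.cons_val]
    rw [mul_smul (b 4) c, hZ']
    module

lemma mem_saturation_iff {B : Fin 5 → Derivation ℤ (A n) (A n)} {V : Derivation ℤ (A n) (A n)} :
    V ∈ saturation B ↔ ∃ (c : A n) (a : Fin 5 → A n), c ≠ 0 ∧ c • V = ∑ i, a i • B i := by
  constructor
  · rintro ⟨c, hc, h⟩
    obtain ⟨a, ha⟩ := (Submodule.mem_span_range_iff_exists_fun _).1 h
    exact ⟨c, a, hc, ha.symm⟩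
  · rintro ⟨c, a, hc, h⟩
    exact ⟨c, hc, (Submodule.mem_span_range_iff_exists_fun _).2 ⟨a, h.symm⟩⟩

lemma gen_mem_saturation {B : Fin 5 → Derivation ℤ (A n) (A n)} (hX : S.X n ∈ saturation B)
    (hK : S.K n ∈ saturation B) (h : ∀ i j, ⁅B i, B j⁆ ∈ saturation B)
    {V : Derivation ℤ (A n) (A n)} (hV : S.Gen n V) : V ∈ saturation B :=
  hV.induction hX hK (fun _ _ => add_mem) (fun a _ => Submodule.smul_mem _ a)
    fun _ _ => lie_mem_saturation_both h

/-- Jacobi reduces all brackets to Z_1, [C_1,C_2] and C_4: [K,C_2] = [X,Z_1], [K,C_3] = -[C_1,C_2] +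
[X,[K,C_2]], [C_1,C_3] = [X,[C_1,C_2]] and [C_2,C_3] = [X,[C_1,C_3]] - [C_1,C_4]. -/
lemma isBasis_famC (hD : ¬ S.Dep n) (hZ : S.ZDep n)
    (h12 : ⁅S.C1 n, S.C2 n⁆ ∈ saturation (S.famC n)) (h4 : S.C4 n ∈ saturation (S.famC n)) :
    S.IsBasis n (S.famC n) := by
  refine ⟨famC_independent_iff.2 hD, fun V hV => mem_saturation_iff.1 ?_⟩
  set L := saturation (S.famC n)
  have X_mem : S.X n ∈ L := mem_saturation (B := S.famC n) 0
  have K_mem : S.K n ∈ L := mem_saturation (B := S.famC n) 1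
  have C1_mem : S.C1 n ∈ L := mem_saturation (B := S.famC n) 2
  have C2_mem : S.C2 n ∈ L := mem_saturation (B := S.famC n) 3
  have C3_mem : S.C3 n ∈ L := mem_saturation (B := S.famC n) 4
  have hX : ∀ i, ⁅S.X n, S.famC n i⁆ ∈ L := fun i => by
    fin_cases i
    · simp [famC]
    exacts [C1_mem, C2_mem, C3_mem, h4]
  have hXL : ∀ {W}, W ∈ L → ⁅S.X n, W⁆ ∈ L := fun hW => lie_mem_saturation hX hW
  have hKX : ⁅S.K n, S.X n⁆ = -S.C1 n := by rw [C1, lie_skew]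
  have hKC1 : ⁅S.K n, S.C1 n⁆ ∈ L := by
    change S.Z1 n ∈ L
    rw [show S.Z1 n = S.lam n • S.C2 n from hZ]
    exact Submodule.smul_mem _ _ C2_mem
  have hKC2 : ⁅S.K n, S.C2 n⁆ ∈ L := by
    rw [C2, leibniz_lie, hKX, neg_lie, lie_self, neg_zero, zero_add]
    exact hXL hKC1
  have hKC3 : ⁅S.K n, S.C3 n⁆ ∈ L := by
    rw [C3, leibniz_lie, hKX, neg_lie]
    exact add_mem (neg_mem h12) (hXL hKC2)
  have skew : ∀ {V W}, ⁅V, W⁆ ∈ L → ⁅W, V⁆ ∈ L := fun {V W} h => by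
    rw [← lie_skew]; exact neg_mem h
  have h13 : ⁅S.C1 n, S.C3 n⁆ ∈ L := by
    have h21 : ⁅S.C1 n, S.X n⁆ = -S.C2 n := by rw [C2, lie_skew]
    rw [C3, leibniz_lie, h21, neg_lie, lie_self, neg_zero, zero_add]
    exact hXL h12
  have self : ∀ V, ⁅V, V⁆ ∈ L := fun V => by rw [lie_self]; exact zero_mem _
  have hC1 : ∀ i, ⁅S.C1 n, S.famC n i⁆ ∈ L := fun i => by
    fin_cases i
    exacts [skew C2_mem, skew hKC1, self _, h12, h13]
  have h23 : ⁅S.C2 n, S.C3 n⁆ ∈ L := by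
    rw [show S.C2 n = ⁅S.X n, S.C1 n⁆ from rfl, lie_lie]
    exact sub_mem (hXL h13) (lie_mem_saturation hC1 h4)
  have hK : ∀ i, ⁅S.K n, S.famC n i⁆ ∈ L := fun i => by
    fin_cases i
    exacts [skew C1_mem, self _, hKC1, hKC2, hKC3]
  have hC2 : ∀ i, ⁅S.C2 n, S.famC n i⁆ ∈ L := fun i => by
    fin_cases i
    exacts [skew C3_mem, skew hKC2, skew h12, self _, h23]
  have hC3 : ∀ i, ⁅S.C3 n, S.famC n i⁆ ∈ L := fun i => by
    fin_cases i
    exacts [skew h4, skew hKC3, skew h13, skew h23, self _]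
  refine gen_mem_saturation X_mem K_mem (fun i j => ?_) hV
  fin_cases i
  exacts [hX j, hK j, hC1 j, hC2 j, hC3 j]

lemma System.Spanned.mem_saturation {T : S.System} (h : T.Spanned n) :
    T.M n ∈ saturation (S.famC n) := by
  obtain ⟨d, a, b, hd, h⟩ := h
  refine mem_saturation_iff.2 ⟨d, ![0, 0, 0, a, b], hd, ?_⟩
  simp [h, famC, Fin.sum_univ_five]

/-- The characterisation of the chains for which `X, K, C_1, C_2, C_3` is a basis. -/
theorem isBasis_iff (T₂ T₃ : S.System) (h2 : T₂.M 0 = ⁅S.C1 0, S.C2 0⁆) (h3 : T₃.M 0 = S.C4 0)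
    (hcond : ∀ n m, S.DepCond n → S.DepCond m) :
    S.IsBasis 0 (S.famC 0) ∧ ¬ S.IsBasis 0 (S.famZ 0) ↔
      (∀ n, S.ZCond n) ∧ (∀ n, T₂.del n ≠ 0 ∧ T₃.del n ≠ 0) ∧
        ∀ n, T₂.Compat n ∧ T₃.Compat n := by
  constructor
  · rintro ⟨hC, hZ⟩
    have hD : ∀ n, ¬ S.Dep n := fun n h => famC_independent_iff.1 hC.1 h.zero
    -- A zero determinant at one site is the dependence condition at the preceding one. By `hcond`
    -- that condition spreads to all sites and makes C_3 a multiple of C_2.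
    have hdel : ∀ T : S.System, ∀ n, T.del n ≠ 0 := fun T n h => by
      obtain ⟨n, rfl⟩ : ∃ m, n = m + 1 := ⟨n - 1, by ring⟩
      exact hD 0 (dep_of_depCond (fun m => hcond n m ((T.del_eq_zero_iff n).1 h)) 0)
    exact ⟨(zdep_of_isBasis hC hZ).zcond, fun n => ⟨hdel T₂ n, hdel T₃ n⟩, fun n =>
      ⟨T₂.compat_of_spanned hD (System.spanned_of_isBasis hC
        (h2 ▸ .comm (S.gen_C1 0) (S.gen_C2 0))) n,
      T₃.compat_of_spanned hD (System.spanned_of_isBasis hC (h3 ▸ S.gen_C4 0)) n⟩⟩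
  · rintro ⟨hZ, hdel, hc⟩
    have hZ0 := zdep_of_zcond hZ 0
    refine ⟨isBasis_famC (fun h => ?_) hZ0 ?_ ?_, not_isBasis_famZ hZ0⟩
    -- Dependence at site 0 would make the determinant vanish at site 1.
    · exact (hdel 1).1 ((T₂.del_eq_zero_iff 0).2 h.succ.2)
    · exact h2 ▸ (T₂.spanned_of_compat (fun n => (hdel n).1) (fun n => (hc n).1) 0).mem_saturation
    · exact h3 ▸ (T₃.spanned_of_compat (fun n => (hdel n).2) (fun n => (hc n).2) 0).mem_saturation

end ShiftChain
end SemiDiscrete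

namespace SemiDiscrete

/-! ### Analytic functions of finitely many variables -/

/-- The values of the variables in `s`. -/
def res (s : Finset Coord) (Q : Jet) : s → ℝ := fun c => Q c

lemma continuous_res (s : Finset Coord) : Continuous (res s) :=
  continuous_pi fun c => continuous_apply c.1

open Classical in
-- Restriction to finitely many variables has a continuous section through P, which freezes all
-- other variables at their values in P. So local statements about such functions live on a
-- finite-dimensional space.
lemma eventually_res {s : Finset Coord} {P : Jet} {p : (s → ℝ) → Prop} :
    (∀ᶠ Q in 𝓝 P, p (res s Q)) ↔ ∀ᶠ r in 𝓝 (res s P), p r := by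
  refine ⟨fun h => ?_, fun h => (continuous_res s).continuousAt.eventually h⟩
  let ext : (s → ℝ) → Jet := fun r c => if h : c ∈ s then r ⟨c, h⟩ else P c
  have hcont : Continuous ext := continuous_pi fun c => by
    by_cases hc : c ∈ s
    · simp only [ext, hc, dif_pos]; exact continuous_apply _
    · simp only [ext, hc]; exact continuous_const
  have hP : ext (res s P) = P := by funext c; simp [ext, res]
  have h1 : Tendsto ext (𝓝 (res s P)) (𝓝 P) := by
    have := hcont.tendsto (res s P); rwa [hP] at this
  filter_upwards [h1.eventually h] with r hr
  have : res s (ext r) = r := by funext c; simp [ext, res]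
  rwa [this] at hr

namespace FinAnalyticAt

variable {P : Jet} {F F' : Jet → ℝ}

lemma congr (h : FinAnalyticAt F P) (e : ∀ᶠ Q in 𝓝 P, F' Q = F Q) : FinAnalyticAt F' P := by
  obtain ⟨s, G, hG, hF⟩ := h
  exact ⟨s, G, hG, by filter_upwards [e, hF] with Q h1 h2; rw [h1, h2]⟩

lemma mono {s s' : Finset Coord} (hs : s ⊆ s') {G : (s → ℝ) → ℝ} (hG : AnalyticAt ℝ G (res s P))
    (hF : ∀ᶠ Q in 𝓝 P, F Q = G (res s Q)) : ∃ G' : (s' → ℝ) → ℝ, AnalyticAt ℝ G' (res s' P) ∧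
      ∀ᶠ Q in 𝓝 P, F Q = G' (res s' Q) := by
  refine ⟨fun r => G (fun c => r ⟨c, hs c.2⟩), ?_, hF⟩
  refine AnalyticAt.fun_comp (f := fun (r : s' → ℝ) (c : s) => r ⟨c, hs c.2⟩) hG ?_
  exact AnalyticAt.pi fun c => (ContinuousLinearMap.proj (R := ℝ) (φ := fun _ : s' => ℝ)
    ⟨c.1, hs c.2⟩).analyticAt _

open Classical in
-- The finitely many inner functions can be written in the union of their finite sets of variables,
-- after which ordinary composition applies. All closure properties below follow from this.
lemma comp_pi {ι : Type*} [Fintype ι] {F : ι → Jet → ℝ} (hF : ∀ i, FinAnalyticAt (F i) P)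
    {g : (ι → ℝ) → ℝ} (hg : AnalyticAt ℝ g (fun i => F i P)) :
    FinAnalyticAt (fun Q => g (fun i => F i Q)) P := by
  choose s G hG hFG using hF
  choose G' hG' hFG' using fun i => mono (P := P) (Finset.subset_biUnion_of_mem s
    (Finset.mem_univ i)) (hG i) (hFG i)
  refine ⟨Finset.univ.biUnion s, fun r => g (fun i => G' i r), ?_, ?_⟩
  · refine AnalyticAt.fun_comp_of_eq hg (AnalyticAt.pi hG') ?_
    funext i
    exact (hFG' i).self_of_nhds.symm
  · filter_upwards [eventually_all.2 hFG'] with Q hQ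
    simp only [hQ]; rfl

lemma coord (c : Coord) : FinAnalyticAt (fun Q => Q c) P :=
  ⟨{c}, fun r => r ⟨c, by simp⟩, (ContinuousLinearMap.proj (R := ℝ)
    (φ := fun _ : ({c} : Finset Coord) => ℝ) ⟨c, by simp⟩).analyticAt _, Eventually.of_forall
    fun _ => rfl⟩

lemma const (a : ℝ) : FinAnalyticAt (fun _ => a) P :=
  ⟨∅, fun _ => a, analyticAt_const, Eventually.of_forall fun _ => rfl⟩

lemma comp_real (hF : FinAnalyticAt F P) {g : ℝ → ℝ} (hg : AnalyticAt ℝ g (F P)) :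
    FinAnalyticAt (fun Q => g (F Q)) P := by
  have h := (ContinuousLinearMap.proj (R := ℝ) (φ := fun _ : Unit => ℝ) ()).analyticAt
    (fun _ => F P)
  exact comp_pi (F := fun _ : Unit => F) (fun _ => hF) (g := fun r => g (r ()))
    (AnalyticAt.fun_comp (f := fun r : Unit → ℝ => r ()) hg h)

lemma comp_real₂ (hF : FinAnalyticAt F P) (hF' : FinAnalyticAt F' P) {g : ℝ → ℝ → ℝ}
    (hg : AnalyticAt ℝ (fun r : ℝ × ℝ => g r.1 r.2) (F P, F' P)) :
    FinAnalyticAt (fun Q => g (F Q) (F' Q)) P := by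
  have h (b : Bool) (r : Bool → ℝ) : AnalyticAt ℝ (fun r : Bool → ℝ => r b) r :=
    (ContinuousLinearMap.proj (R := ℝ) (φ := fun _ : Bool => ℝ) b).analyticAt r
  exact comp_pi (F := fun b : Bool => bif b then F else F') (fun b => by cases b <;> assumption)
    (g := fun r => g (r true) (r false))
    (AnalyticAt.fun_comp_of_eq (f := fun r : Bool → ℝ => (r true, r false)) hg
      ((h true _).prod (h false _)) rfl)

lemma comp_real₄ {F₁ F₂ F₃ F₄ : Jet → ℝ} (h₁ : FinAnalyticAt F₁ P) (h₂ : FinAnalyticAt F₂ P)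
    (h₃ : FinAnalyticAt F₃ P) (h₄ : FinAnalyticAt F₄ P) {g : ℝ × ℝ × ℝ × ℝ → ℝ}
    (hg : AnalyticAt ℝ g (F₁ P, F₂ P, F₃ P, F₄ P)) :
    FinAnalyticAt (fun Q => g (F₁ Q, F₂ Q, F₃ Q, F₄ Q)) P := by
  have h (i : Fin 4) (r : Fin 4 → ℝ) : AnalyticAt ℝ (fun r : Fin 4 → ℝ => r i) r :=
    (ContinuousLinearMap.proj (R := ℝ) (φ := fun _ : Fin 4 => ℝ) i).analyticAt r
  exact comp_pi (F := ![F₁, F₂, F₃, F₄]) (fun i => by fin_cases i <;> assumption)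
    (g := fun r => g (r 0, r 1, r 2, r 3))
    (AnalyticAt.fun_comp_of_eq (f := fun r : Fin 4 → ℝ => (r 0, r 1, r 2, r 3)) hg
      ((h 0 _).prod ((h 1 _).prod ((h 2 _).prod (h 3 _)))) rfl)

lemma add (hF : FinAnalyticAt F P) (hF' : FinAnalyticAt F' P) :
    FinAnalyticAt (fun Q => F Q + F' Q) P :=
  comp_real₂ hF hF' (analyticAt_fst.add analyticAt_snd)

lemma sub (hF : FinAnalyticAt F P) (hF' : FinAnalyticAt F' P) :
    FinAnalyticAt (fun Q => F Q - F' Q) P :=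
  comp_real₂ hF hF' (analyticAt_fst.sub analyticAt_snd)

lemma mul (hF : FinAnalyticAt F P) (hF' : FinAnalyticAt F' P) :
    FinAnalyticAt (fun Q => F Q * F' Q) P :=
  comp_real₂ hF hF' (analyticAt_fst.mul analyticAt_snd)

lemma neg (hF : FinAnalyticAt F P) : FinAnalyticAt (fun Q => -F Q) P :=
  comp_real hF analyticAt_id.neg

lemma inv (hF : FinAnalyticAt F P) (h : F P ≠ 0) : FinAnalyticAt (fun Q => (F Q)⁻¹) P :=
  comp_real hF (analyticAt_id.inv h)


lemma pow (hF : FinAnalyticAt F P) (k : ℕ) : FinAnalyticAt (fun Q => F Q ^ k) P :=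
  comp_real hF (analyticAt_id.pow k)

lemma comp {σ : Jet → Jet} (hF : FinAnalyticAt F (σ P))
    (hσ : ∀ c, FinAnalyticAt (fun Q => σ Q c) P) (hcont : ContinuousAt σ P) :
    FinAnalyticAt (fun Q => F (σ Q)) P := by
  obtain ⟨s, G, hG, hF⟩ := hF
  exact (comp_pi (F := fun (c : s) Q => σ Q c) (fun c => hσ c) hG).congr (hcont.eventually hF)

lemma continuousAt (hF : FinAnalyticAt F P) : ContinuousAt F P := by
  obtain ⟨s, G, hG, hF⟩ := hF
  exact (ContinuousAt.comp (f := res s) hG.continuousAt (continuous_res s).continuousAt).congr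
    (hF.mono fun _ h => h.symm)

/-! Partial derivatives. -/

/-- The direction of the variable `c` in the space of values of the variables in `s`. -/
noncomputable def _root_.SemiDiscrete.dir (s : Finset Coord) (c : Coord) : s → ℝ :=
  open Classical in fun d => if d.1 = c then 1 else 0

open Classical in
lemma _root_.SemiDiscrete.hasDerivAt_res_update (s : Finset Coord) (c : Coord) (Q : Jet) :
    HasDerivAt (fun τ : ℝ => res s (Function.update Q c τ)) (dir s c) (Q c) := by
  refine hasDerivAt_pi.2 fun d => ?_
  by_cases h : d.1 = c
  · simpa [res, dir, h] using hasDerivAt_id' (Q c)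
  · simpa [res, dir, h] using hasDerivAt_const (Q c) (Q d.1)

open Classical in
lemma _root_.SemiDiscrete.tendsto_update (c : Coord) (Q : Jet) :
    Tendsto (fun τ : ℝ => Function.update Q c τ) (𝓝 (Q c)) (𝓝 Q) := by
  have h : Continuous (fun τ : ℝ => Function.update Q c τ) :=
    continuous_const.update c continuous_id
  simpa using h.tendsto (Q c)

open Classical in
lemma eventually_hasDerivAt {s : Finset Coord} {G : (s → ℝ) → ℝ} (hG : AnalyticAt ℝ G (res s P))
    (hF : ∀ᶠ Q in 𝓝 P, F Q = G (res s Q)) (c : Coord) :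
    ∀ᶠ Q in 𝓝 P, HasDerivAt (fun τ : ℝ => F (Function.update Q c τ))
      (fderiv ℝ G (res s Q) (dir s c)) (Q c) := by
  have h1 := eventually_res.2 hG.eventually_analyticAt
  filter_upwards [hF.eventually_nhds, h1] with Q h2 h3
  have h4 : HasDerivAt (fun τ : ℝ => G (res s (Function.update Q c τ)))
      (fderiv ℝ G (res s Q) (dir s c)) (Q c) := by
    have h5 := h3.differentiableAt.hasFDerivAt
    have h6 : res s (Function.update Q c (Q c)) = res s Q := by rw [Function.update_eq_self]
    exact HasFDerivAt.comp_hasDerivAt_of_eq (Q c) h5 (hasDerivAt_res_update s c Q) h6.symm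
  exact h4.congr_of_eventuallyEq ((tendsto_update c Q).eventually h2)

lemma eventually_pd_eq {s : Finset Coord} {G : (s → ℝ) → ℝ} (hG : AnalyticAt ℝ G (res s P))
    (hF : ∀ᶠ Q in 𝓝 P, F Q = G (res s Q)) (c : Coord) :
    ∀ᶠ Q in 𝓝 P, pd c F Q = fderiv ℝ G (res s Q) (dir s c) :=
  (eventually_hasDerivAt hG hF c).mono fun _ h => h.deriv

open Classical in
lemma hasDerivAt_pd (hF : FinAnalyticAt F P) (c : Coord) :
    ∀ᶠ Q in 𝓝 P, HasDerivAt (fun τ : ℝ => F (Function.update Q c τ)) (pd c F Q) (Q c) := by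
  obtain ⟨s, G, hG, hF⟩ := hF
  filter_upwards [eventually_hasDerivAt hG hF c, eventually_pd_eq hG hF c] with Q h1 h2
  rwa [h2]

lemma _root_.SemiDiscrete.analyticAt_fderiv_apply {E : Type*} [NormedAddCommGroup E]
    [NormedSpace ℝ E] {G : E → ℝ} {r : E} (hG : AnalyticAt ℝ G r) (v : E) :
    AnalyticAt ℝ (fun r => fderiv ℝ G r v) r :=
  ((ContinuousLinearMap.apply ℝ ℝ v).analyticAt _).fun_comp hG.fderiv

lemma pd (hF : FinAnalyticAt F P) (c : Coord) : FinAnalyticAt (pd c F) P := by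
  obtain ⟨s, G, hG, hF⟩ := hF
  exact ⟨s, _, analyticAt_fderiv_apply hG (dir s c), eventually_pd_eq hG hF c⟩

end FinAnalyticAt

variable {P : Jet} {F F' : Jet → ℝ}

lemma pd_congr (h : ∀ᶠ Q in 𝓝 P, F Q = F' Q) (c : Coord) :
    ∀ᶠ Q in 𝓝 P, pd c F Q = pd c F' Q := by
  filter_upwards [h.eventually_nhds] with Q hQ
  exact EventuallyEq.deriv_eq ((tendsto_update c Q).eventually hQ)

lemma pd_comm (hF : FinAnalyticAt F P) (c d : Coord) :
    ∀ᶠ Q in 𝓝 P, pd c (pd d F) Q = pd d (pd c F) Q := by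
  obtain ⟨s, G, hG, hF⟩ := hF
  have h c := FinAnalyticAt.eventually_pd_eq hG hF c
  have h2 c d := FinAnalyticAt.eventually_pd_eq (analyticAt_fderiv_apply hG (dir s c)) (h c) d
  filter_upwards [h2 c d, h2 d c, eventually_res.2 hG.eventually_analyticAt] with Q h3 h4 h5
  have h6 (u v : s → ℝ) : fderiv ℝ (fun r => fderiv ℝ G r u) (res s Q) v =
      fderiv ℝ (fderiv ℝ G) (res s Q) v u := by
    rw [fderiv_clm_apply h5.fderiv.differentiableAt (differentiableAt_const u)]
    simp
  rw [h3, h4, h6, h6]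
  exact (h5.contDiffAt.isSymmSndFDerivAt_of_omega _ _)

open Classical in
lemma pd_eq_zero {s : Finset Coord} {G : (s → ℝ) → ℝ}
    (hF : ∀ᶠ Q in 𝓝 P, F Q = G (res s Q)) : ∀ᶠ Q in 𝓝 P, ∀ c ∉ s, pd c F Q = 0 := by
  filter_upwards [hF.eventually_nhds] with Q hQ c hc
  have h : ∀ᶠ τ in 𝓝 (Q c), F (Function.update Q c τ) = G (res s Q) := by
    filter_upwards [(tendsto_update c Q).eventually hQ] with τ hτ
    rw [hτ]
    congr 1
    funext d
    have : d.1 ≠ c := fun h => hc (h ▸ d.2)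
    simp [res, Function.update_of_ne this]
  exact (EventuallyEq.deriv_eq h).trans (deriv_const _ _)

end SemiDiscrete

namespace SemiDiscrete

/-! ### The ring of germs -/

/-- The germs at `P` of analytic functions of finitely many variables. -/
def finGerms (P : Jet) : Subring (Germ (𝓝 P) ℝ) where
  carrier := {φ | ∃ F, FinAnalyticAt F P ∧ φ = (F : Germ (𝓝 P) ℝ)}
  mul_mem' := by
    rintro _ _ ⟨F, hF, rfl⟩ ⟨F', hF', rfl⟩
    exact ⟨_, hF.mul hF', rfl⟩
  one_mem' := ⟨_, FinAnalyticAt.const 1, rfl⟩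
  add_mem' := by
    rintro _ _ ⟨F, hF, rfl⟩ ⟨F', hF', rfl⟩
    exact ⟨_, hF.add hF', rfl⟩
  zero_mem' := ⟨_, FinAnalyticAt.const 0, rfl⟩
  neg_mem' := by
    rintro _ ⟨F, hF, rfl⟩
    exact ⟨_, hF.neg, rfl⟩

variable {P : Jet}

/-- The germ of a function. -/
def germ (F : Jet → ℝ) (hF : FinAnalyticAt F P) : finGerms P :=
  ⟨F, show (F : Germ (𝓝 P) ℝ) ∈ finGerms P from ⟨F, hF, rfl⟩⟩

lemma germ_eq_germ {F F' : Jet → ℝ} {hF : FinAnalyticAt F P} {hF' : FinAnalyticAt F' P} :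
    germ F hF = germ F' hF' ↔ ∀ᶠ Q in 𝓝 P, F Q = F' Q :=
  Subtype.ext_iff.trans Germ.coe_eq

lemma germ_eq_zero {F : Jet → ℝ} {hF : FinAnalyticAt F P} :
    germ F hF = 0 ↔ ∀ᶠ Q in 𝓝 P, F Q = 0 :=
  germ_eq_germ (hF' := FinAnalyticAt.const 0)

lemma exists_germ (φ : finGerms P) : ∃ F, ∃ hF : FinAnalyticAt F P, germ F hF = φ := by
  obtain ⟨_, F, hF, rfl⟩ := φ
  exact ⟨F, hF, rfl⟩

/-- A function with a given germ. -/
noncomputable def rep (φ : finGerms P) : Jet → ℝ := (exists_germ φ).choose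
lemma rep_spec (φ : finGerms P) : FinAnalyticAt (rep φ) P := (exists_germ φ).choose_spec.choose
lemma germ_rep (φ : finGerms P) : germ (rep φ) (rep_spec φ) = φ :=
  (exists_germ φ).choose_spec.choose_spec

lemma rep_germ {F : Jet → ℝ} (hF : FinAnalyticAt F P) : ∀ᶠ Q in 𝓝 P, rep (germ F hF) Q = F Q :=
  germ_eq_germ.1 (germ_rep (germ F hF))

lemma germ_add {F F' : Jet → ℝ} (hF : FinAnalyticAt F P) (hF' : FinAnalyticAt F' P) :
    germ F hF + germ F' hF' = germ _ (hF.add hF') := rfl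
lemma germ_mul {F F' : Jet → ℝ} (hF : FinAnalyticAt F P) (hF' : FinAnalyticAt F' P) :
    germ F hF * germ F' hF' = germ _ (hF.mul hF') := rfl
lemma germ_pow {F : Jet → ℝ} (hF : FinAnalyticAt F P) (k : ℕ) :
    germ F hF ^ k = germ _ (hF.pow k) := by
  induction k with
  | zero => simp only [pow_zero]; rfl
  | succ k ih => simp only [pow_succ, ih, germ_mul]

open Classical in
lemma germ_sum {ι : Type*} (t : Finset ι) (f : ι → Jet → ℝ) (hf : ∀ d, FinAnalyticAt (f d) P) :
    ∃ hS : FinAnalyticAt (fun Q => ∑ d ∈ t, f d Q) P, ∑ d ∈ t, germ (f d) (hf d) = germ _ hS := by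
  induction t using Finset.induction_on with
  | empty => exact ⟨by simpa using FinAnalyticAt.const 0, by simp; rfl⟩
  | insert a t ha ih =>
    obtain ⟨hS, e⟩ := ih
    refine ⟨((hf a).add hS).congr (Eventually.of_forall fun Q => Finset.sum_insert ha), ?_⟩
    rw [Finset.sum_insert ha, e, germ_add]
    exact germ_eq_germ.2 (Eventually.of_forall fun Q =>
      (Finset.sum_insert (f := fun d => f d Q) ha).symm)

instance : Nontrivial (finGerms P) :=
  ⟨⟨0, 1, fun h => by simpa using congrArg (fun φ : finGerms P => (φ : Germ (𝓝 P) ℝ)) h⟩⟩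

/-- On a ball where both are analytic, a point with G ≠ 0 has a neighbourhood on which G' = 0; the
identity theorem extends this to the whole ball. -/
lemma eventually_zero_or_of_mul {E : Type*} [NormedAddCommGroup E] [NormedSpace ℝ E] {r : E}
    {G G' : E → ℝ} (hG : AnalyticAt ℝ G r) (hG' : AnalyticAt ℝ G' r)
    (h : ∀ᶠ y in 𝓝 r, G y * G' y = 0) :
    (∀ᶠ y in 𝓝 r, G y = 0) ∨ ∀ᶠ y in 𝓝 r, G' y = 0 := by
  obtain ⟨ε, hε, hB⟩ := Metric.eventually_nhds_iff_ball.1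
    (h.and (hG.eventually_analyticAt.and hG'.eventually_analyticAt))
  by_cases h0 : ∀ y ∈ Metric.ball r ε, G y = 0
  · exact Or.inl (eventually_of_mem (Metric.ball_mem_nhds r hε) h0)
  push Not at h0
  obtain ⟨z, hz, hGz⟩ := h0
  right
  have h1 : ∀ᶠ y in 𝓝 z, G' y = 0 := by
    filter_upwards [(hB z hz).2.1.continuousAt.eventually_ne hGz,
      Metric.isOpen_ball.mem_nhds hz] with y hy hyB
    exact (mul_eq_zero.1 (hB y hyB).1).resolve_left hy
  have h2 : AnalyticOnNhd ℝ G' (Metric.ball r ε) := fun y hy => (hB y hy).2.2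
  exact eventually_of_mem (Metric.ball_mem_nhds r hε)
    (h2.eqOn_zero_of_preconnected_of_eventuallyEq_zero
    (convex_ball r ε).isPreconnected hz h1)

open Classical in
instance : NoZeroDivisors (finGerms P) where
  eq_zero_or_eq_zero_of_mul_eq_zero := by
    intro φ ψ h
    obtain ⟨F, hF, rfl⟩ := exists_germ φ
    obtain ⟨F', hF', rfl⟩ := exists_germ ψ
    rw [germ_mul, germ_eq_zero] at h
    rw [germ_eq_zero, germ_eq_zero]
    obtain ⟨s, G, hG, e⟩ := hF
    obtain ⟨s', G', hG', e'⟩ := hF'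
    obtain ⟨H, hH, k⟩ := FinAnalyticAt.mono (Finset.subset_union_left (s₂ := s')) hG e
    obtain ⟨H', hH', k'⟩ := FinAnalyticAt.mono (Finset.subset_union_right (s₁ := s)) hG' e'
    have h1 : ∀ᶠ r in 𝓝 (res (s ∪ s') P), H r * H' r = 0 := by
      refine eventually_res.1 ?_
      filter_upwards [h, k, k'] with Q h1 h2 h3
      rwa [← h2, ← h3]
    refine (eventually_zero_or_of_mul hH hH' h1).imp (fun h2 => ?_) (fun h2 => ?_)
    · filter_upwards [k, eventually_res.2 h2] with Q h3 h4
      rw [h3, h4]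
    · filter_upwards [k', eventually_res.2 h2] with Q h3 h4
      rw [h3, h4]

instance : IsDomain (finGerms P) := NoZeroDivisors.to_isDomain _

/-- The germ of a variable. -/
def coordGerm (P : Jet) (c : Coord) : finGerms P := germ _ (FinAnalyticAt.coord c)

/-! ### Partial derivatives and vector fields -/

/-- The partial derivative of germs. -/
noncomputable def pdGerm (c : Coord) : Derivation ℤ (finGerms P) (finGerms P) :=
  Derivation.mk' (AddMonoidHom.toIntLinearMap (AddMonoidHom.mk'
    (fun φ => germ (pd c (rep φ)) ((rep_spec φ).pd c)) (by
      intro φ ψ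
      rw [germ_add, germ_eq_germ]
      have h1 : ∀ᶠ Q in 𝓝 P, rep (φ + ψ) Q = rep φ Q + rep ψ Q := by
        conv in rep (φ + ψ) => rw [← germ_rep φ, ← germ_rep ψ, germ_add]
        exact rep_germ _
      filter_upwards [pd_congr h1 c, (rep_spec φ).hasDerivAt_pd c, (rep_spec ψ).hasDerivAt_pd c]
        with Q h2 h3 h4
      rw [h2]
      exact (h3.add h4).deriv))) (by
    intro φ ψ
    change germ _ ((rep_spec (φ * ψ)).pd c) = φ * germ _ ((rep_spec ψ).pd c) +
      ψ * germ _ ((rep_spec φ).pd c)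
    conv_rhs => rw [← germ_rep φ, ← germ_rep ψ, germ_mul, germ_mul, germ_add]
    rw [germ_eq_germ]
    have h1 : ∀ᶠ Q in 𝓝 P, rep (φ * ψ) Q = rep φ Q * rep ψ Q := by
      conv in rep (φ * ψ) => rw [← germ_rep φ, ← germ_rep ψ, germ_mul]
      exact rep_germ _
    have h5 := pd_congr (rep_germ (rep_spec φ)) c
    have h6 := pd_congr (rep_germ (rep_spec ψ)) c
    filter_upwards [pd_congr h1 c, (rep_spec φ).hasDerivAt_pd c, (rep_spec ψ).hasDerivAt_pd c,
      h5, h6] with Q h2 h3 h4 h5 h6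
    rw [h2, h5, h6]
    refine (h3.mul h4).deriv.trans ?_
    simp only [Function.update_eq_self]
    ring)

lemma pdGerm_germ (c : Coord) {F : Jet → ℝ} (hF : FinAnalyticAt F P) :
    pdGerm c (germ F hF) = germ (pd c F) (hF.pd c) :=
  (germ_eq_germ (hF := (rep_spec _).pd c)).2 (pd_congr (rep_germ hF) c)

lemma pdGerm_comm (c d : Coord) (φ : finGerms P) :
    pdGerm c (pdGerm d φ) = pdGerm d (pdGerm c φ) := by
  obtain ⟨F, hF, rfl⟩ := exists_germ φ
  simp only [pdGerm_germ]
  exact germ_eq_germ.2 (pd_comm hF c d)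

lemma pdGerm_support (φ : finGerms P) : ∃ s : Finset Coord, ∀ c ∉ s, pdGerm c φ = 0 := by
  obtain ⟨F, hF, rfl⟩ := exists_germ φ
  obtain ⟨s, G, hG, h⟩ := id hF
  refine ⟨s, fun c hc => ?_⟩
  rw [pdGerm_germ, germ_eq_zero]
  exact (pd_eq_zero h).mono fun Q hQ => hQ c hc

open Classical in
lemma pdGerm_coordGerm (c d : Coord) : pdGerm c (coordGerm P d) = if d = c then 1 else 0 := by
  rw [coordGerm, pdGerm_germ]
  split_ifs with h
  · refine (germ_eq_germ (hF' := FinAnalyticAt.const 1)).2 (Eventually.of_forall fun Q => ?_)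
    subst h
    simp [pd]
  · refine germ_eq_zero.2 (Eventually.of_forall fun Q => ?_)
    simp [pd, Function.update_of_ne h]

lemma finsum_eq_sum_pdGerm (V : Coord → finGerms P) {φ : finGerms P} {s : Finset Coord}
    (hs : ∀ c ∉ s, pdGerm c φ = 0) : ∑ᶠ c, V c * pdGerm c φ = ∑ c ∈ s, V c * pdGerm c φ := by
  refine finsum_eq_sum_of_support_subset _ fun c hc => ?_
  by_contra h
  exact hc (by simp [hs c h])

open Classical in
/-- The derivation `∑ V_c ∂/∂c`. -/
noncomputable def ofCoeffs (V : Coord → finGerms P) : Derivation ℤ (finGerms P) (finGerms P) :=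
  Derivation.mk' (AddMonoidHom.toIntLinearMap (AddMonoidHom.mk'
    (fun φ => ∑ᶠ c, V c * pdGerm c φ) (by
      intro φ ψ
      obtain ⟨s, hs⟩ := pdGerm_support φ
      obtain ⟨s', hs'⟩ := pdGerm_support ψ
      have h1 : ∀ c ∉ s ∪ s', pdGerm c φ = 0 := fun c hc => hs c (by simp at hc; tauto)
      have h2 : ∀ c ∉ s ∪ s', pdGerm c ψ = 0 := fun c hc => hs' c (by simp at hc; tauto)
      rw [finsum_eq_sum_pdGerm V h1, finsum_eq_sum_pdGerm V h2,
        finsum_eq_sum_pdGerm V (s := s ∪ s') (fun c hc => by rw [map_add, h1 c hc, h2 c hc,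
          add_zero]), ← Finset.sum_add_distrib]
      exact Finset.sum_congr rfl fun c _ => by rw [map_add, mul_add]))) (by
    intro φ ψ
    change ∑ᶠ c, V c * pdGerm c (φ * ψ) = φ * ∑ᶠ c, V c * pdGerm c ψ + ψ * ∑ᶠ c, V c * pdGerm c φ
    obtain ⟨s, hs⟩ := pdGerm_support φ
    obtain ⟨s', hs'⟩ := pdGerm_support ψ
    have h1 : ∀ c ∉ s ∪ s', pdGerm c φ = 0 := fun c hc => hs c (by simp at hc; tauto)
    have h2 : ∀ c ∉ s ∪ s', pdGerm c ψ = 0 := fun c hc => hs' c (by simp at hc; tauto)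
    rw [finsum_eq_sum_pdGerm V h1, finsum_eq_sum_pdGerm V h2,
      finsum_eq_sum_pdGerm V (s := s ∪ s') (fun c hc => by simp [h1 c hc, h2 c hc]),
      Finset.mul_sum, Finset.mul_sum, ← Finset.sum_add_distrib]
    refine Finset.sum_congr rfl fun c _ => ?_
    rw [Derivation.leibniz, smul_eq_mul, smul_eq_mul]
    ring)

lemma ofCoeffs_apply (V : Coord → finGerms P) (φ : finGerms P) :
    ofCoeffs V φ = ∑ᶠ c, V c * pdGerm c φ := rfl

lemma ofCoeffs_eq_sum (V : Coord → finGerms P) {φ : finGerms P} {s : Finset Coord}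
    (hs : ∀ c ∉ s, pdGerm c φ = 0) : ofCoeffs V φ = ∑ c ∈ s, V c * pdGerm c φ :=
  finsum_eq_sum_pdGerm V hs

open Classical in
lemma ofCoeffs_coordGerm (V : Coord → finGerms P) (c : Coord) :
    ofCoeffs V (coordGerm P c) = V c := by
  rw [ofCoeffs_eq_sum V (s := {c}) (fun d hd => by
    rw [pdGerm_coordGerm, if_neg (fun h => hd (by simp [h]))])]
  simp [pdGerm_coordGerm]

lemma ofCoeffs_add (V W : Coord → finGerms P) : ofCoeffs (V + W) = ofCoeffs V + ofCoeffs W := by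
  ext1 φ
  obtain ⟨s, hs⟩ := pdGerm_support φ
  rw [Derivation.add_apply, ofCoeffs_eq_sum _ hs, ofCoeffs_eq_sum _ hs, ofCoeffs_eq_sum _ hs,
    ← Finset.sum_add_distrib]
  exact Finset.sum_congr rfl fun c _ => by rw [Pi.add_apply, add_mul]

lemma ofCoeffs_smul (a : finGerms P) (V : Coord → finGerms P) :
    ofCoeffs (a • V) = a • ofCoeffs V := by
  ext1 φ
  obtain ⟨s, hs⟩ := pdGerm_support φ
  rw [Derivation.smul_apply, ofCoeffs_eq_sum _ hs, ofCoeffs_eq_sum _ hs, smul_eq_mul,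
    Finset.mul_sum]
  exact Finset.sum_congr rfl fun c _ => by rw [Pi.smul_apply, smul_eq_mul, mul_assoc]

/-- The second-order terms cancel by symmetry of mixed partial derivatives. The sums stay finite
because differentiation introduces no new variables. -/
lemma ofCoeffs_lie (V W : Coord → finGerms P) : ⁅ofCoeffs V, ofCoeffs W⁆ =
    ofCoeffs (fun c => ofCoeffs V (W c) - ofCoeffs W (V c)) := by
  ext1 φ
  obtain ⟨s, hs⟩ := pdGerm_support φ
  have hs2 (c : Coord) : ∀ d ∉ s, pdGerm d (pdGerm c φ) = 0 := fun d hd => by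
    rw [pdGerm_comm, hs d hd, map_zero]
  have key (V W : Coord → finGerms P) : ofCoeffs V (ofCoeffs W φ) =
      ∑ c ∈ s, ofCoeffs V (W c) * pdGerm c φ +
        ∑ c ∈ s, ∑ d ∈ s, W c * V d * pdGerm d (pdGerm c φ) := by
    rw [ofCoeffs_eq_sum W hs, map_sum, ← Finset.sum_add_distrib]
    refine Finset.sum_congr rfl fun c _ => ?_
    rw [Derivation.leibniz, smul_eq_mul, smul_eq_mul, ofCoeffs_eq_sum V (hs2 c), Finset.mul_sum,
      add_comm, mul_comm]
    exact congrArg _ (Finset.sum_congr rfl fun d _ => by rw [mul_assoc])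
  rw [Derivation.commutator_apply, key, key, ofCoeffs_eq_sum _ hs]
  have : ∑ c ∈ s, ∑ d ∈ s, W c * V d * pdGerm d (pdGerm c φ) =
      ∑ c ∈ s, ∑ d ∈ s, V c * W d * pdGerm d (pdGerm c φ) := by
    rw [Finset.sum_comm]
    exact Finset.sum_congr rfl fun c _ => Finset.sum_congr rfl fun d _ => by
      rw [pdGerm_comm, mul_comm (W d)]
  rw [this, add_sub_add_right_eq_sub, ← Finset.sum_sub_distrib]
  exact Finset.sum_congr rfl fun c _ => by rw [sub_mul]

/-- The vector fields on germs. -/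
def fields (P : Jet) : Submodule (finGerms P) (Derivation ℤ (finGerms P) (finGerms P)) where
  carrier := {δ | ∃ V, δ = ofCoeffs V}
  add_mem' := by
    rintro _ _ ⟨V, rfl⟩ ⟨W, rfl⟩
    exact ⟨V + W, (ofCoeffs_add V W).symm⟩
  zero_mem' := ⟨0, by ext1 φ; simp [ofCoeffs_apply]⟩
  smul_mem' := by
    rintro a _ ⟨V, rfl⟩
    exact ⟨a • V, (ofCoeffs_smul a V).symm⟩

lemma ofCoeffs_mem_fields (V : Coord → finGerms P) : ofCoeffs V ∈ fields P := ⟨V, rfl⟩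

lemma eq_ofCoeffs {δ : Derivation ℤ (finGerms P) (finGerms P)} (h : δ ∈ fields P) :
    δ = ofCoeffs fun c => δ (coordGerm P c) := by
  obtain ⟨V, rfl⟩ := h
  simp only [ofCoeffs_coordGerm]

lemma fields_ext {δ ε : Derivation ℤ (finGerms P) (finGerms P)} (h : δ ∈ fields P)
    (h' : ε ∈ fields P) (e : ∀ c, δ (coordGerm P c) = ε (coordGerm P c)) : δ = ε := by
  rw [eq_ofCoeffs h, eq_ofCoeffs h']
  exact congrArg ofCoeffs (funext e)

lemma lie_mem_fields {δ ε : Derivation ℤ (finGerms P) (finGerms P)} (h : δ ∈ fields P)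
    (h' : ε ∈ fields P) : ⁅δ, ε⁆ ∈ fields P := by
  obtain ⟨V, rfl⟩ := h
  obtain ⟨W, rfl⟩ := h'
  exact ⟨_, ofCoeffs_lie V W⟩

/-! ### Pullback of germs -/

section Pull

variable {P' : Jet} {σ : Jet → Jet}

/-- `σ` is, near `P`, an analytic map which sends `P` to `P'`. -/
structure IsAnalyticMap (σ : Jet → Jet) (P P' : Jet) : Prop where
  map_eq : σ P = P'
  coord : ∀ c, FinAnalyticAt (fun Q => σ Q c) P

lemma IsAnalyticMap.continuousAt (h : IsAnalyticMap σ P P') : ContinuousAt σ P :=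
  continuousAt_pi.2 fun c => (h.coord c).continuousAt

lemma IsAnalyticMap.tendsto (h : IsAnalyticMap σ P P') : Tendsto σ (𝓝 P) (𝓝 P') := by
  have := h.continuousAt.tendsto; rwa [h.map_eq] at this

lemma FinAnalyticAt.pull {F : Jet → ℝ} (hF : FinAnalyticAt F P') (h : IsAnalyticMap σ P P') :
    FinAnalyticAt (fun Q => F (σ Q)) P :=
  FinAnalyticAt.comp (by rwa [h.map_eq]) h.coord h.continuousAt

/-- Composition of germs with an analytic map. -/
noncomputable def pull (h : IsAnalyticMap σ P P') : finGerms P' →+* finGerms P where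
  toFun φ := germ _ ((rep_spec φ).pull h)
  map_one' := (germ_eq_germ (hF' := FinAnalyticAt.const 1)).2
    (h.tendsto.eventually (rep_germ (FinAnalyticAt.const 1)))
  map_zero' := germ_eq_zero.2 (h.tendsto.eventually (rep_germ (FinAnalyticAt.const 0)))
  map_add' φ ψ := by
    rw [germ_add, germ_eq_germ]
    refine h.tendsto.eventually (p := fun Q => rep (φ + ψ) Q = rep φ Q + rep ψ Q) ?_
    conv in rep (φ + ψ) => rw [← germ_rep φ, ← germ_rep ψ, germ_add]
    exact rep_germ _
  map_mul' φ ψ := by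
    rw [germ_mul, germ_eq_germ]
    refine h.tendsto.eventually (p := fun Q => rep (φ * ψ) Q = rep φ Q * rep ψ Q) ?_
    conv in rep (φ * ψ) => rw [← germ_rep φ, ← germ_rep ψ, germ_mul]
    exact rep_germ _

lemma pull_germ (h : IsAnalyticMap σ P P') {F : Jet → ℝ} (hF : FinAnalyticAt F P') :
    pull h (germ F hF) = germ _ (hF.pull h) :=
  (germ_eq_germ (hF := (rep_spec _).pull h)).2 (h.tendsto.eventually (rep_germ hF))

open Classical in
/-- The chain rule. -/
lemma pdGerm_pull (h : IsAnalyticMap σ P P') (φ : finGerms P') {s : Finset Coord}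
    (hs : ∀ c ∉ s, pdGerm c φ = 0) (c : Coord) :
    pdGerm c (pull h φ) = ∑ d ∈ s, pull h (pdGerm d φ) * pdGerm c (pull h (coordGerm P' d)) := by
  obtain ⟨F, hF, rfl⟩ := exists_germ φ
  obtain ⟨s', G, hG, hFG⟩ := id hF
  -- The set s is replaced by the variables s' of a representation of F: outside either set the
  -- partial derivatives vanish, so both sums equal the sum over the union.
  have hsub : ∑ d ∈ s, pull h (pdGerm d (germ F hF)) * pdGerm c (pull h (coordGerm P' d)) =
      ∑ d ∈ s', pull h (pdGerm d (germ F hF)) * pdGerm c (pull h (coordGerm P' d)) := by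
    have h0 : ∀ d ∉ s', pdGerm d (germ F hF) = 0 := fun d hd => by
      rw [pdGerm_germ]; exact germ_eq_zero.2 ((pd_eq_zero hFG).mono fun Q hQ => hQ d hd)
    have h1 (t t' : Finset Coord) (ht : ∀ c ∉ t, pdGerm c (germ F hF) = 0) :
        ∑ d ∈ t, pull h (pdGerm d (germ F hF)) * pdGerm c (pull h (coordGerm P' d)) =
        ∑ d ∈ t ∪ t', pull h (pdGerm d (germ F hF)) * pdGerm c (pull h (coordGerm P' d)) :=
      Finset.sum_subset Finset.subset_union_left fun d _ hd => by
        rw [ht d hd, map_zero, zero_mul]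
    rw [h1 s s' hs, h1 s' s h0, Finset.union_comm]
  rw [hsub]
  simp only [pdGerm_germ, pull_germ, coordGerm, germ_mul]
  obtain ⟨hS, e⟩ := germ_sum s' (fun d Q => pd d F (σ Q) * pd c (fun Q => σ Q d) Q)
    (fun d => ((hF.pd d).pull h).mul ((h.coord d).pd c))
  rw [e, germ_eq_germ]
  have hcoord : ∀ᶠ Q in 𝓝 P, ∀ d : s', HasDerivAt (fun τ : ℝ => σ (Function.update Q c τ) d)
      (pd c (fun Q => σ Q d) Q) (Q c) :=
    eventually_all.2 fun d => (h.coord d).hasDerivAt_pd c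
  have hpd : ∀ᶠ Q in 𝓝 P', ∀ d : s', pd d F Q = fderiv ℝ G (res s' Q) (dir s' d) :=
    eventually_all.2 fun d => FinAnalyticAt.eventually_pd_eq hG hFG d
  filter_upwards [hcoord, h.tendsto.eventually hpd, (h.tendsto.eventually hFG).eventually_nhds,
    h.tendsto.eventually (eventually_res.2 hG.eventually_analyticAt)] with Q h1 h2 h3 h4
  have h5 : HasDerivAt (fun τ : ℝ => res s' (σ (Function.update Q c τ)))
      (fun d : s' => pd c (fun Q => σ Q d) Q) (Q c) := hasDerivAt_pi.2 h1
  have h6 : HasDerivAt (fun τ : ℝ => G (res s' (σ (Function.update Q c τ))))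
      (fderiv ℝ G (res s' (σ Q)) (fun d : s' => pd c (fun Q => σ Q d) Q)) (Q c) :=
    HasFDerivAt.comp_hasDerivAt_of_eq (Q c) h4.differentiableAt.hasFDerivAt h5
      (by rw [Function.update_eq_self])
  have h7 : pd c (fun Q => F (σ Q)) Q =
      fderiv ℝ G (res s' (σ Q)) (fun d : s' => pd c (fun Q => σ Q d) Q) :=
    (h6.congr_of_eventuallyEq ((tendsto_update c Q).eventually h3)).deriv
  have h8 : (fun d : s' => pd c (fun Q => σ Q d) Q) =
      ∑ d : s', pd c (fun Q => σ Q d) Q • dir s' d.1 := by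
    funext d
    simp [dir, Finset.sum_apply]
  rw [h7, h8, map_sum, ← Finset.sum_coe_sort s']
  refine Finset.sum_congr rfl fun d _ => ?_
  rw [map_smul, h2 d, smul_eq_mul, mul_comm]

open Classical in
/-- Vector fields are related by an analytic map as soon as this holds on the variables. -/
lemma ofCoeffs_pull (h : IsAnalyticMap σ P P') {V : Coord → finGerms P} {W : Coord → finGerms P'}
    (hVW : ∀ d, ofCoeffs V (pull h (coordGerm P' d)) = pull h (W d)) (φ : finGerms P') :
    ofCoeffs V (pull h φ) = pull h (ofCoeffs W φ) := by
  obtain ⟨s, hs⟩ := pdGerm_support φ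
  choose T hT using fun d => pdGerm_support (pull h (coordGerm P' d))
  have h1 : ∀ d ∈ s, ∀ c ∉ s.biUnion T, pdGerm c (pull h (coordGerm P' d)) = 0 :=
    fun d hd c hc => hT d c fun h2 => hc (Finset.mem_biUnion.2 ⟨d, hd, h2⟩)
  have h2 : ∀ c ∉ s.biUnion T, pdGerm c (pull h φ) = 0 := fun c hc => by
    rw [pdGerm_pull h φ hs]
    exact Finset.sum_eq_zero fun d hd => by rw [h1 d hd c hc, mul_zero]
  rw [ofCoeffs_eq_sum V h2, ofCoeffs_eq_sum W hs, map_sum]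
  simp only [pdGerm_pull h φ hs, Finset.mul_sum]
  rw [Finset.sum_comm]
  refine Finset.sum_congr rfl fun d hd => ?_
  rw [map_mul, ← hVW d, ofCoeffs_eq_sum V (h1 d hd), Finset.sum_mul]
  exact Finset.sum_congr rfl fun c _ => by ring

end Pull

end SemiDiscrete

namespace SemiDiscrete

/-! ### The shift as an analytic map -/

/-- The standing assumptions on the equation `t_{1x} = f(x, t, t_1, t_x)`. -/
structure IsRegular (f : ℝ × ℝ × ℝ × ℝ → ℝ) (Ω : Set (ℝ × ℝ × ℝ × ℝ)) : Prop where
  isOpen : IsOpen Ω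
  analytic : AnalyticOnNhd ℝ f Ω
  inj : ∀ x t t₁ y y' : ℝ, (x, t, t₁, y) ∈ Ω → (x, t, t₁, y') ∈ Ω →
    f (x, t, t₁, y) = f (x, t, t₁, y') → y = y'
  tx_ne : ∀ x t t₁ y : ℝ, (x, t, t₁, y) ∈ Ω → deriv (fun s => f (x, t, t₁, s)) y ≠ 0
  txtx_ne : ∀ x t t₁ y : ℝ, (x, t, t₁, y) ∈ Ω →
    iteratedDeriv 2 (fun s => f (x, t, t₁, s)) y ≠ 0

variable {f : ℝ × ℝ × ℝ × ℝ → ℝ} {Ω : Set (ℝ × ℝ × ℝ × ℝ)}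

/-- The partial derivative in the last variable. -/
noncomputable def par (g : ℝ × ℝ × ℝ × ℝ → ℝ) (z : ℝ × ℝ × ℝ × ℝ) : ℝ :=
  deriv (fun s => g (z.1, z.2.1, z.2.2.1, s)) z.2.2.2

lemma par_eq_fderiv {g : ℝ × ℝ × ℝ × ℝ → ℝ} {z : ℝ × ℝ × ℝ × ℝ} (hg : AnalyticAt ℝ g z) :
    par g z = fderiv ℝ g z (0, 0, 0, 1) := by
  have h1 : HasDerivAt (fun s : ℝ => (z.1, z.2.1, z.2.2.1, s)) (0, 0, 0, 1) z.2.2.2 :=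
    (hasDerivAt_const _ _).prodMk ((hasDerivAt_const _ _).prodMk
      ((hasDerivAt_const _ _).prodMk (hasDerivAt_id' _)))
  exact (HasFDerivAt.comp_hasDerivAt_of_eq z.2.2.2 hg.differentiableAt.hasFDerivAt h1 rfl).deriv

lemma analyticAt_par {g : ℝ × ℝ × ℝ × ℝ → ℝ} {z : ℝ × ℝ × ℝ × ℝ} (hg : AnalyticAt ℝ g z) :
    AnalyticAt ℝ (par g) z :=
  (analyticAt_fderiv_apply hg (0, 0, 0, 1)).congr
    (hg.eventually_analyticAt.mono fun _ h => (par_eq_fderiv h).symm)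

/-- The arguments of `f` as a function of the dynamical variables. -/
def args (Q : Jet) : ℝ × ℝ × ℝ × ℝ := (Q .x, Q (.t 0), Q (.t 1), Q .tx)

lemma pd_tx_args (g : ℝ × ℝ × ℝ × ℝ → ℝ) (Q : Jet) :
    pd .tx (fun Q => g (args Q)) Q = par g (args Q) := by
  simp [pd, par, args]

lemma f_tx_eq (Q : Jet) : f_tx f Q = par f (args Q) := pd_tx_args f Q
lemma f_txtx_eq (Q : Jet) : f_txtx f Q = par (par f) (args Q) := by
  rw [f_txtx, show f_tx f = fun Q => par f (args Q) from funext f_tx_eq, pd_tx_args]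
lemma f_txtxtx_eq (Q : Jet) : f_txtxtx f Q = par (par (par f)) (args Q) := by
  rw [f_txtxtx, show f_txtx f = fun Q => par (par f) (args Q) from funext f_txtx_eq, pd_tx_args]

lemma solveBack_spec {q : ℝ × ℝ × ℝ × ℝ} (h : ∃ y : ℝ, (q.1, q.2.1, q.2.2.1, y) ∈ Ω ∧
    f (q.1, q.2.1, q.2.2.1, y) = q.2.2.2) :
    (q.1, q.2.1, q.2.2.1, solveBack f Ω q) ∈ Ω ∧
      f (q.1, q.2.1, q.2.2.1, solveBack f Ω q) = q.2.2.2 := by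
  rw [solveBack, dif_pos h]
  exact h.choose_spec

namespace IsRegular

variable (hf : IsRegular f Ω)
include hf

lemma par_ne {z : ℝ × ℝ × ℝ × ℝ} (hz : z ∈ Ω) : par f z ≠ 0 := hf.tx_ne _ _ _ _ hz

lemma par_par_ne {z : ℝ × ℝ × ℝ × ℝ} (hz : z ∈ Ω) : par (par f) z ≠ 0 := by
  have := hf.txtx_ne _ _ _ _ hz
  rwa [iteratedDeriv_succ, iteratedDeriv_one] at this

lemma solveBack_eq {x t t₁ y : ℝ} (h : (x, t, t₁, y) ∈ Ω) :
    solveBack f Ω (x, t, t₁, f (x, t, t₁, y)) = y := by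
  obtain ⟨h1, h2⟩ := solveBack_spec (q := (x, t, t₁, f (x, t, t₁, y))) ⟨y, h, rfl⟩
  exact hf.inj _ _ _ _ _ h1 h h2

/-- The inverse function theorem for `(x, t, t_1, t_x) ↦ (x, t, t_1, f)`. -/
lemma solveBack_local {z : ℝ × ℝ × ℝ × ℝ} (hz : z ∈ Ω) :
    AnalyticAt ℝ (solveBack f Ω) (z.1, z.2.1, z.2.2.1, f z) ∧
    ∀ᶠ q in 𝓝 (z.1, z.2.1, z.2.2.1, f z), (q.1, q.2.1, q.2.2.1, solveBack f Ω q) ∈ Ω ∧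
      f (q.1, q.2.1, q.2.2.1, solveBack f Ω q) = q.2.2.2 := by
  have hfz := hf.analytic z hz
  set L := fderiv ℝ f z with hL
  set a := L (0, 0, 0, 1) with ha
  have ha0 : a ≠ 0 := by rw [ha, hL, ← par_eq_fderiv hfz]; exact hf.par_ne hz
  let p1 : (ℝ × ℝ × ℝ × ℝ) →L[ℝ] ℝ := .fst ℝ _ _
  let p2 : (ℝ × ℝ × ℝ × ℝ) →L[ℝ] ℝ := (ContinuousLinearMap.fst ℝ ℝ (ℝ × ℝ)).comp (.snd ℝ _ _)
  let p3 : (ℝ × ℝ × ℝ × ℝ) →L[ℝ] ℝ := (ContinuousLinearMap.fst ℝ ℝ ℝ).comp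
    ((ContinuousLinearMap.snd ℝ ℝ (ℝ × ℝ)).comp (.snd ℝ _ _))
  let p4 : (ℝ × ℝ × ℝ × ℝ) →L[ℝ] ℝ := (ContinuousLinearMap.snd ℝ ℝ ℝ).comp
    ((ContinuousLinearMap.snd ℝ ℝ (ℝ × ℝ)).comp (.snd ℝ _ _))
  let T : (ℝ × ℝ × ℝ × ℝ) →L[ℝ] (ℝ × ℝ × ℝ × ℝ) := p1.prod (p2.prod (p3.prod L))
  -- The inverse of the derivative T of (x, t, t_1, t_x) ↦ (x, t, t_1, f): solve the last component
  -- for dt_x, dividing by a = f_{t_x}.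
  let T' : (ℝ × ℝ × ℝ × ℝ) →L[ℝ] (ℝ × ℝ × ℝ × ℝ) := p1.prod (p2.prod (p3.prod
    (a⁻¹ • (p4 - L.comp (p1.prod (p2.prod (p3.prod 0)))))))
  have hsplit (w : ℝ × ℝ × ℝ × ℝ) : L w = L (w.1, w.2.1, w.2.2.1, 0) + w.2.2.2 * a := by
    rw [ha, ← smul_eq_mul, ← map_smul, ← map_add]
    congr 1
    simp
  let i : (ℝ × ℝ × ℝ × ℝ) ≃L[ℝ] (ℝ × ℝ × ℝ × ℝ) := ContinuousLinearEquiv.equivOfInverse T T'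
    (fun w => by
      simp only [T, T', p1, p2, p3, p4, ContinuousLinearMap.prod_apply,
        smul_apply, sub_apply,
        ContinuousLinearMap.comp_apply, ContinuousLinearMap.coe_fst', ContinuousLinearMap.coe_snd',
        zero_apply, smul_eq_mul]
      refine Prod.ext rfl (Prod.ext rfl (Prod.ext rfl ?_))
      simp only
      rw [hsplit w]
      field_simp
      ring)
    (fun w => by
      simp only [T, T', p1, p2, p3, p4, ContinuousLinearMap.prod_apply,
        smul_apply, sub_apply,
        ContinuousLinearMap.comp_apply, ContinuousLinearMap.coe_fst', ContinuousLinearMap.coe_snd',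
        zero_apply, smul_eq_mul]
      refine Prod.ext rfl (Prod.ext rfl (Prod.ext rfl ?_))
      simp only
      rw [hsplit]
      simp only
      field_simp
      ring)
  let Φ : ℝ × ℝ × ℝ × ℝ → ℝ × ℝ × ℝ × ℝ := fun w => (w.1, w.2.1, w.2.2.1, f w)
  have hΦa : AnalyticAt ℝ Φ z := (p1.analyticAt z).prod ((p2.analyticAt z).prod
    ((p3.analyticAt z).prod hfz))
  have hΦ : HasStrictFDerivAt Φ (i : (ℝ × ℝ × ℝ × ℝ) →L[ℝ] (ℝ × ℝ × ℝ × ℝ)) z :=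
    p1.hasStrictFDerivAt.prodMk (p2.hasStrictFDerivAt.prodMk
      (p3.hasStrictFDerivAt.prodMk hfz.hasStrictFDerivAt))
  let e := hΦ.toOpenPartialHomeomorph
  have hze : z ∈ e.source := hΦ.mem_toOpenPartialHomeomorph_source
  have hsymm : AnalyticAt ℝ e.symm (Φ z) :=
    e.analyticAt_symm' (i := i) hze hΦa hΦ.hasFDerivAt.fderiv
  have hez : e.symm (Φ z) = z := e.left_inv hze
  have key : ∀ᶠ q in 𝓝 (Φ z), e.symm q ∈ Ω ∧ Φ (e.symm q) = q := by
    have h1 : ∀ᶠ q in 𝓝 (Φ z), e.symm q ∈ Ω :=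
      hsymm.continuousAt.eventually (by rw [hez]; exact hf.isOpen.mem_nhds hz)
    filter_upwards [h1, e.open_target.mem_nhds (e.map_source hze)] with q h2 h3
    exact ⟨h2, e.right_inv h3⟩
  -- Injectivity in t_x identifies the chosen solution `solveBack` with the last component of the
  -- local inverse, so the choice is analytic.
  have key2 : ∀ᶠ q in 𝓝 (Φ z), solveBack f Ω q = (e.symm q).2.2.2 ∧
      (q.1, q.2.1, q.2.2.1, solveBack f Ω q) ∈ Ω ∧
      f (q.1, q.2.1, q.2.2.1, solveBack f Ω q) = q.2.2.2 := by
    filter_upwards [key] with q h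
    obtain ⟨w, hw⟩ : ∃ w, e.symm q = w := ⟨_, rfl⟩
    rw [hw] at h ⊢
    obtain ⟨h1, rfl⟩ := h
    exact ⟨hf.solveBack_eq h1, solveBack_spec ⟨w.2.2.2, h1, rfl⟩⟩
  exact ⟨(AnalyticAt.fun_comp (f := e.symm) (p4.analyticAt _) hsymm).congr
    (key2.mono fun q h => h.1.symm), key2.mono fun q h => h.2⟩

end IsRegular

lemma finAnalyticAt_comp_args {g : ℝ × ℝ × ℝ × ℝ → ℝ} {P : Jet} (hg : AnalyticAt ℝ g (args P)) :
    FinAnalyticAt (fun Q => g (args Q)) P :=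
  .comp_real₄ (.coord _) (.coord _) (.coord _) (.coord _) hg

lemma args_mem {x₀ : ℝ} {τ ξ : ℤ → ℝ} (ht : IsTrajectory f Ω x₀ τ ξ) (n : ℤ) :
    args (trajJet x₀ τ ξ n) ∈ Ω := by
  simpa [args, trajJet] using (ht n).1

lemma siteSlopeUp_shift (k : ℕ) (Q : Jet) :
    siteSlopeUp f k (shift f Q) = siteSlopeUp f (k + 1) Q := by
  induction k with
  | zero => simp [siteSlopeUp, shift]
  | succ k ih =>
    change f (_, _, _, siteSlopeUp f k (shift f Q)) = _
    rw [ih]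
    simp [siteSlopeUp, shift]

lemma siteSlopeDown_shiftInv (k : ℕ) (Q : Jet) :
    siteSlopeDown f Ω k (shiftInv f Ω Q) = siteSlopeDown f Ω (k + 1) Q := by
  induction k with
  | zero => simp [siteSlopeDown, shiftInv]
  | succ k ih =>
    change solveBack f Ω (_, _, _, siteSlopeDown f Ω k (shiftInv f Ω Q)) = _
    rw [ih]
    have h (m : ℤ) : -(m + 1) = -m - 1 := by ring
    simp [siteSlopeDown, shiftInv, h]

section Trajectory

variable {x₀ : ℝ} {τ ξ : ℤ → ℝ} (hf : IsRegular f Ω) (ht : IsTrajectory f Ω x₀ τ ξ)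
include hf ht

lemma fJ_fin (n : ℤ) : FinAnalyticAt (fJ f) (trajJet x₀ τ ξ n) :=
  finAnalyticAt_comp_args (hf.analytic _ (args_mem ht n))

lemma isAnalyticMap_shift (n : ℤ) :
    IsAnalyticMap (shift f) (trajJet x₀ τ ξ n) (trajJet x₀ τ ξ (n + 1)) where
  map_eq := by
    funext c
    cases c with
    | x => rfl
    | tx => simp [shift, trajJet, (ht n).2]
    | t k => simp only [shift, trajJet]; congr 1; ring
  coord c := by
    cases c with
    | x => exact .coord .x
    | tx => exact fJ_fin hf ht n
    | t k => exact .coord (.t (k + 1))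

lemma isAnalyticMap_shiftInv (n : ℤ) :
    IsAnalyticMap (shiftInv f Ω) (trajJet x₀ τ ξ (n + 1)) (trajJet x₀ τ ξ n) where
  map_eq := by
    funext c
    cases c with
    | x => rfl
    | tx =>
      simp only [shiftInv, trajJet, add_neg_cancel_right, add_zero, (ht n).2]
      exact hf.solveBack_eq (ht n).1
    | t k => simp only [shiftInv, trajJet]; congr 1; ring
  coord c := by
    cases c with
    | x => exact .coord .x
    | tx =>
      refine FinAnalyticAt.comp_real₄ (g := solveBack f Ω) (.coord .x) (.coord (.t (-1)))
        (.coord (.t 0)) (.coord .tx) ?_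
      simp only [trajJet, add_neg_cancel_right, add_zero, (ht n).2]
      exact (hf.solveBack_local (ht n).1).1
    | t k => exact .coord (.t (k - 1))

lemma shiftInv_shift (n : ℤ) : ∀ᶠ Q in 𝓝 (trajJet x₀ τ ξ n), shiftInv f Ω (shift f Q) = Q := by
  have hc : Continuous args := by unfold args; fun_prop
  filter_upwards [hc.continuousAt.eventually (hf.isOpen.mem_nhds (args_mem ht n))] with Q hQ
  funext c
  cases c with
  | x => rfl
  | tx => simpa [shiftInv, shift] using hf.solveBack_eq hQ
  | t k => simp [shiftInv, shift]

/-- This direction needs solvability of f = t_x near the trajectory, supplied by the inverse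
function theorem; the other composition needs only injectivity. -/
lemma shift_shiftInv (n : ℤ) :
    ∀ᶠ Q in 𝓝 (trajJet x₀ τ ξ (n + 1)), shift f (shiftInv f Ω Q) = Q := by
  have hc : Continuous (fun Q : Jet => (Q .x, Q (.t (-1)), Q (.t 0), Q .tx)) := by fun_prop
  have h1 := hc.continuousAt (x := trajJet x₀ τ ξ (n + 1))
  have h2 := (hf.solveBack_local (ht n).1).2
  rw [ContinuousAt] at h1
  simp only [trajJet, add_neg_cancel_right, add_zero, (ht n).2] at h1
  filter_upwards [h1.eventually h2] with Q hQ
  funext c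
  cases c with
  | x => rfl
  | tx => simpa [shiftInv, shift] using hQ.2
  | t k => simp [shiftInv, shift]

/-- The shift operator on germs. -/
noncomputable def shiftEquiv (n : ℤ) :
    finGerms (trajJet x₀ τ ξ (n + 1)) ≃+* finGerms (trajJet x₀ τ ξ n) :=
  RingEquiv.ofBijective (pull (isAnalyticMap_shift hf ht n)) (by
    constructor
    · rw [injective_iff_map_eq_zero]
      intro φ h
      obtain ⟨F, hF, rfl⟩ := exists_germ φ
      rw [pull_germ, germ_eq_zero] at h
      rw [germ_eq_zero]
      filter_upwards [(isAnalyticMap_shiftInv hf ht n).tendsto.eventually h,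
        shift_shiftInv hf ht n] with Q h1 h2
      rwa [h2] at h1
    · intro φ
      obtain ⟨F, hF, rfl⟩ := exists_germ φ
      refine ⟨germ _ (hF.pull (isAnalyticMap_shiftInv hf ht n)), ?_⟩
      rw [pull_germ, germ_eq_germ]
      filter_upwards [shiftInv_shift hf ht n] with Q h
      rw [h])

lemma shiftEquiv_germ (n : ℤ) {F : Jet → ℝ} (hF : FinAnalyticAt F (trajJet x₀ τ ξ (n + 1))) :
    shiftEquiv hf ht n (germ F hF) = germ _ (hF.pull (isAnalyticMap_shift hf ht n)) :=
  pull_germ (isAnalyticMap_shift hf ht n) hF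

/-! ### The slopes `t_{kx}` -/

lemma siteSlope_fin (k n : ℤ) : FinAnalyticAt (siteSlope f Ω k) (trajJet x₀ τ ξ n) := by
  have up (k : ℕ) : ∀ n : ℤ, FinAnalyticAt (siteSlopeUp f k) (trajJet x₀ τ ξ n) := by
    induction k with
    | zero => exact fun n => .coord .tx
    | succ k ih =>
      exact fun n => ((ih (n + 1)).pull (isAnalyticMap_shift hf ht n)).congr
        (Eventually.of_forall fun Q => (siteSlopeUp_shift k Q).symm)
  have down (k : ℕ) : ∀ n : ℤ, FinAnalyticAt (siteSlopeDown f Ω k) (trajJet x₀ τ ξ n) := by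
    induction k with
    | zero => exact fun n => .coord .tx
    | succ k ih =>
      intro n
      obtain ⟨n, rfl⟩ : ∃ m, n = m + 1 := ⟨n - 1, by ring⟩
      exact ((ih n).pull (isAnalyticMap_shiftInv hf ht n)).congr
        (Eventually.of_forall fun Q => (siteSlopeDown_shiftInv k Q).symm)
  by_cases hk : 0 ≤ k
  · exact (up k.toNat n).congr (Eventually.of_forall fun Q => by simp [siteSlope, hk])
  · exact (down (-k).toNat n).congr (Eventually.of_forall fun Q => by simp [siteSlope, hk])

lemma siteSlope_shift (k n : ℤ) : ∀ᶠ Q in 𝓝 (trajJet x₀ τ ξ n),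
    siteSlope f Ω k (shift f Q) = siteSlope f Ω (k + 1) Q := by
  by_cases hk : 0 ≤ k
  · lift k to ℕ using hk
    refine Eventually.of_forall fun Q => ?_
    have h1 : (0 : ℤ) ≤ (k : ℤ) + 1 := by positivity
    have h2 : ((k : ℤ) + 1).toNat = k + 1 := by omega
    simp only [siteSlope, Nat.cast_nonneg, if_true, h1, h2, Int.toNat_natCast]
    exact siteSlopeUp_shift k Q
  -- For k = -(m+1) the downward slope at the shifted point is `siteSlopeDown` m evaluated after
  -- shifting back, so the identity holds only near the trajectory point. The case m = 0 crosses
  -- from downward to upward slopes.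
  · obtain ⟨m, rfl⟩ : ∃ m : ℕ, k = -(m + 1 : ℕ) := ⟨(-k - 1).toNat, by omega⟩
    filter_upwards [shiftInv_shift hf ht n] with Q hQ
    have h1 : siteSlope f Ω (-(m + 1 : ℕ)) (shift f Q) = siteSlopeDown f Ω m Q := by
      rw [siteSlope, if_neg hk, neg_neg, Int.toNat_natCast, ← siteSlopeDown_shiftInv, hQ]
    rw [h1]
    cases m with
    | zero => simp [siteSlope, siteSlopeDown, siteSlopeUp]
    | succ m =>
      have h2 : ¬ (0 : ℤ) ≤ -((m + 1 + 1 : ℕ) : ℤ) + 1 := by push_cast; omega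
      have h3 : (-(-((m + 1 + 1 : ℕ) : ℤ) + 1)).toNat = m + 1 := by push_cast; omega
      rw [siteSlope, if_neg h2, h3]

end Trajectory

end SemiDiscrete

namespace SemiDiscrete

/-! ### Vector fields and derivations -/

/-- The derivation `δ` of germs is given by the vector field `V`. -/
def Represents {P : Jet} (V : VField) (δ : Derivation ℤ (finGerms P) (finGerms P)) : Prop :=
  δ ∈ fields P ∧ ∀ c, ∃ h : FinAnalyticAt (V c) P, δ (coordGerm P c) = germ (V c) h

namespace Represents

variable {P : Jet} {V W : VField} {δ ε : Derivation ℤ (finGerms P) (finGerms P)}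

lemma fin (h : Represents V δ) (c : Coord) : FinAnalyticAt (V c) P := (h.2 c).choose

lemma apply_coord (h : Represents V δ) (c : Coord) : δ (coordGerm P c) = germ (V c) (h.fin c) :=
  (h.2 c).choose_spec

lemma eq_ofCoeffs (h : Represents V δ) : δ = ofCoeffs fun c => germ (V c) (h.fin c) := by
  exact (SemiDiscrete.eq_ofCoeffs h.1).trans (congrArg ofCoeffs (funext h.apply_coord))

lemma apply_eq_sum (h : Represents V δ) {φ : finGerms P} {s : Finset Coord}
    (hs : ∀ c ∉ s, pdGerm c φ = 0) : δ φ = ∑ c ∈ s, germ (V c) (h.fin c) * pdGerm c φ :=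
  (DFunLike.congr_fun h.eq_ofCoeffs φ).trans (ofCoeffs_eq_sum _ hs)

lemma of_fin (h : ∀ c, FinAnalyticAt (V c) P) :
    Represents V (ofCoeffs fun c => germ (V c) (h c)) :=
  ⟨ofCoeffs_mem_fields _, fun c => ⟨h c, ofCoeffs_coordGerm _ c⟩⟩

lemma add (h : Represents V δ) (h' : Represents W ε) : Represents (V + W) (δ + ε) :=
  ⟨add_mem h.1 h'.1, fun c => ⟨(h.fin c).add (h'.fin c), by
    rw [Derivation.add_apply, h.apply_coord, h'.apply_coord]; rfl⟩⟩

lemma smul (h : Represents V δ) {F : Jet → ℝ} (hF : FinAnalyticAt F P) :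
    Represents (fun c Q => F Q * V c Q) (germ F hF • δ) :=
  ⟨Submodule.smul_mem _ _ h.1, fun c => ⟨hF.mul (h.fin c), by
    rw [Derivation.smul_apply, h.apply_coord]; rfl⟩⟩

open Classical in
lemma bracket (h : Represents V δ) (h' : Represents W ε) :
    Represents (bracket V W) ⁅δ, ε⁆ := by
  refine ⟨lie_mem_fields h.1 h'.1, fun c => ?_⟩
  obtain ⟨s, G, -, hG⟩ := h.fin c
  obtain ⟨s', G', -, hG'⟩ := h'.fin c
  have h0 : ∀ᶠ Q in 𝓝 P, ∀ d ∉ s ∪ s', pd d (V c) Q = 0 ∧ pd d (W c) Q = 0 := by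
    filter_upwards [pd_eq_zero hG, pd_eq_zero hG'] with Q h1 h2 d hd
    simp only [Finset.mem_union, not_or] at hd
    exact ⟨h1 d hd.1, h2 d hd.2⟩
  have h1 : ∀ᶠ Q in 𝓝 P, SemiDiscrete.bracket V W c Q =
      ∑ d ∈ s ∪ s', (V d Q * pd d (W c) Q - W d Q * pd d (V c) Q) := by
    filter_upwards [h0] with Q hQ
    refine finsum_eq_sum_of_support_subset _ fun d hd => ?_
    by_contra hn
    exact hd (by simp [(hQ d hn).1, (hQ d hn).2])
  obtain ⟨hS, e⟩ := germ_sum (s ∪ s') (fun d Q => V d Q * pd d (W c) Q - W d Q * pd d (V c) Q)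
    (fun d => ((h.fin d).mul ((h'.fin c).pd d)).sub ((h'.fin d).mul ((h.fin c).pd d)))
  have hfin : FinAnalyticAt (SemiDiscrete.bracket V W c) P := hS.congr h1
  refine ⟨hfin, ?_⟩
  have e1 : germ _ hfin = germ _ hS := germ_eq_germ.2 h1
  rw [e1, ← e, Derivation.commutator_apply, h.apply_coord, h'.apply_coord,
    h.apply_eq_sum (s := s ∪ s') (fun d hd => by
      rw [pdGerm_germ]; exact germ_eq_zero.2 (h0.mono fun Q hQ => (hQ d hd).2)),
    h'.apply_eq_sum (s := s ∪ s') (fun d hd => by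
      rw [pdGerm_germ]; exact germ_eq_zero.2 (h0.mono fun Q hQ => (hQ d hd).1)),
    ← Finset.sum_sub_distrib]
  exact Finset.sum_congr rfl fun d _ => by rw [pdGerm_germ, pdGerm_germ]; rfl

end Represents

lemma fieldX_fin (P : Jet) (c : Coord) : FinAnalyticAt (fieldX c) P := by
  cases c with
  | x => exact .const 0
  | tx => exact .const 1
  | t k => exact .const 0

/-- The derivation `∂/∂t_x`. -/
noncomputable def germX (P : Jet) : Derivation ℤ (finGerms P) (finGerms P) :=
  ofCoeffs fun c => germ (fieldX c) (fieldX_fin P c)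

lemma represents_germX (P : Jet) : Represents fieldX (germX P) := .of_fin _

lemma germX_apply {P : Jet} (φ : finGerms P) : germX P φ = pdGerm .tx φ := by
  rw [germX, ofCoeffs_apply, finsum_eq_single _ Coord.tx]
  · change 1 * _ = _
    rw [one_mul]
  · intro c hc
    cases c with
    | x => exact zero_mul _
    | tx => exact absurd rfl hc
    | t k => exact zero_mul _

lemma germX_germ {P : Jet} {F : Jet → ℝ} (hF : FinAnalyticAt F P) :
    germX P (germ F hF) = germ (pd .tx F) (hF.pd .tx) := by
  rw [germX_apply, pdGerm_germ]

section Chain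

variable {f : ℝ × ℝ × ℝ × ℝ → ℝ} {Ω : Set (ℝ × ℝ × ℝ × ℝ)} {x₀ : ℝ} {τ ξ : ℤ → ℝ}
  (hf : IsRegular f Ω) (ht : IsTrajectory f Ω x₀ τ ξ) (n : ℤ)

lemma f_tx_ne (hf : IsRegular f Ω) (ht : IsTrajectory f Ω x₀ τ ξ) (n : ℤ) :
    f_tx f (trajJet x₀ τ ξ n) ≠ 0 := by
  rw [f_tx_eq]; exact hf.par_ne (args_mem ht n)

lemma f_txtx_ne (hf : IsRegular f Ω) (ht : IsTrajectory f Ω x₀ τ ξ) (n : ℤ) :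
    f_txtx f (trajJet x₀ τ ξ n) ≠ 0 := by
  rw [f_txtx_eq]; exact hf.par_par_ne (args_mem ht n)

lemma f_tx_fin (hf : IsRegular f Ω) (ht : IsTrajectory f Ω x₀ τ ξ) (n : ℤ) :
    FinAnalyticAt (f_tx f) (trajJet x₀ τ ξ n) := (fJ_fin hf ht n).pd _

lemma f_txtx_fin (hf : IsRegular f Ω) (ht : IsTrajectory f Ω x₀ τ ξ) (n : ℤ) :
    FinAnalyticAt (f_txtx f) (trajJet x₀ τ ξ n) := (f_tx_fin hf ht n).pd _

lemma fieldK_fin (hf : IsRegular f Ω) (ht : IsTrajectory f Ω x₀ τ ξ) (n : ℤ) (c : Coord) :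
    FinAnalyticAt (fieldK f Ω c) (trajJet x₀ τ ξ n) := by
  cases c with
  | x => exact .const 1
  | tx => exact .const 0
  | t k => exact siteSlope_fin hf ht k n

/-- The derivation `∂/∂x + t_x ∂/∂t + ⋯`. -/
noncomputable def germK : Derivation ℤ (finGerms (trajJet x₀ τ ξ n))
    (finGerms (trajJet x₀ τ ξ n)) :=
  ofCoeffs fun c => germ (fieldK f Ω c) (fieldK_fin hf ht n c)

lemma represents_germK : Represents (fieldK f Ω) (germK hf ht n) := .of_fin _

lemma shiftEquiv_x : shiftEquiv hf ht n (coordGerm _ .x) = coordGerm _ .x :=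
  shiftEquiv_germ hf ht n _
lemma shiftEquiv_t (k : ℤ) :
    shiftEquiv hf ht n (coordGerm _ (.t k)) = coordGerm _ (.t (k + 1)) :=
  shiftEquiv_germ hf ht n _
lemma shiftEquiv_tx : shiftEquiv hf ht n (coordGerm _ .tx) = germ (fJ f) (fJ_fin hf ht n) :=
  shiftEquiv_germ hf ht n _

noncomputable def qInv : finGerms (trajJet x₀ τ ξ n) :=
  germ _ ((f_tx_fin hf ht n).inv (f_tx_ne hf ht n))

noncomputable def q2Inv : finGerms (trajJet x₀ τ ξ n) :=
  germ _ ((f_txtx_fin hf ht n).inv (f_txtx_ne hf ht n))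

lemma germX_f_mul_qInv : germX _ (shiftEquiv hf ht n (coordGerm _ .tx)) * qInv hf ht n = 1 := by
  rw [shiftEquiv_tx, germX_germ, qInv, germ_mul]
  refine (germ_eq_germ (hF' := FinAnalyticAt.const 1)).2 ?_
  filter_upwards [(f_tx_fin hf ht n).continuousAt.eventually_ne (f_tx_ne hf ht n)] with Q hQ
  exact mul_inv_cancel₀ hQ

lemma germX_x {P : Jet} : germX P (coordGerm P .x) = 0 := (represents_germX P).apply_coord .x
lemma germX_tx {P : Jet} : germX P (coordGerm P .tx) = 1 := (represents_germX P).apply_coord .tx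
lemma germX_t {P : Jet} (k : ℤ) : germX P (coordGerm P (.t k)) = 0 :=
  (represents_germX P).apply_coord (.t k)
lemma germK_x : germK hf ht n (coordGerm _ .x) = 1 := (represents_germK hf ht n).apply_coord .x
lemma germK_tx : germK hf ht n (coordGerm _ .tx) = 0 := (represents_germK hf ht n).apply_coord .tx
lemma germK_t (k : ℤ) : germK hf ht n (coordGerm _ (.t k)) = germ _ (siteSlope_fin hf ht k n) :=
  (represents_germK hf ht n).apply_coord (.t k)

/-- Two vector fields are related by the shift as soon as they are on the variables. -/
lemma related_of_coord {δ : Derivation ℤ (finGerms (trajJet x₀ τ ξ n))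
    (finGerms (trajJet x₀ τ ξ n))}
    {ε : Derivation ℤ (finGerms (trajJet x₀ τ ξ (n + 1))) (finGerms (trajJet x₀ τ ξ (n + 1)))}
    (hδ : δ ∈ fields _) (hε : ε ∈ fields _)
    (h : ∀ c, δ (shiftEquiv hf ht n (coordGerm _ c)) = shiftEquiv hf ht n (ε (coordGerm _ c)))
    (φ : finGerms (trajJet x₀ τ ξ (n + 1))) :
    δ (shiftEquiv hf ht n φ) = shiftEquiv hf ht n (ε φ) := by
  obtain ⟨V, rfl⟩ := hδ
  obtain ⟨W, rfl⟩ := hε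
  refine ofCoeffs_pull (isAnalyticMap_shift hf ht n) (fun d => ?_) φ
  exact (h d).trans (by rw [ofCoeffs_coordGerm]; rfl)

/-- The chain of rings of germs along a trajectory. -/
noncomputable def jetChain : ShiftChain fun n => finGerms (trajJet x₀ τ ξ n) where
  D := shiftEquiv hf ht
  X n := germX _
  K := germK hf ht
  x n := coordGerm _ .x
  tx n := coordGerm _ .tx
  t n k := coordGerm _ (.t k)
  qi := qInv hf ht
  q2i := q2Inv hf ht
  fields n := fields _
  X_mem n := (represents_germX _).1
  K_mem n := (represents_germK hf ht n).1
  lie_mem n _ hV _ hW := lie_mem_fields hV hW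
  eq_zero n V hV hx htx h := fields_ext hV (zero_mem _) fun c => by
    cases c with
    | x => exact hx
    | tx => exact htx
    | t k => exact h k
  D_x := shiftEquiv_x hf ht
  D_t := shiftEquiv_t hf ht
  X_x n := germX_x
  X_tx n := germX_tx
  X_t n := germX_t
  K_x := germK_x hf ht
  K_tx := germK_tx hf ht
  K_t0 n := by
    rw [germK_t]
    exact germ_eq_germ.2 (Eventually.of_forall fun Q => by simp [siteSlope, siteSlopeUp])
  K_t1 n := by
    rw [germK_t, shiftEquiv_tx]
    exact germ_eq_germ.2 (Eventually.of_forall fun Q => by simp [siteSlope, siteSlopeUp, fJ])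
  q_mul_qi := germX_f_mul_qInv hf ht
  q2_mul_q2i n := by
    rw [shiftEquiv_tx, germX_germ, germX_germ, q2Inv, germ_mul]
    refine (germ_eq_germ (hF' := FinAnalyticAt.const 1)).2 ?_
    filter_upwards [(f_txtx_fin hf ht n).continuousAt.eventually_ne (f_txtx_ne hf ht n)] with Q hQ
    exact mul_inv_cancel₀ hQ
  X_D n F := by
    refine related_of_coord hf ht n (δ := qInv hf ht n • germX _)
      (Submodule.smul_mem _ _ (represents_germX _).1) (represents_germX _).1 (fun c => ?_) F
    rw [Derivation.smul_apply, smul_eq_mul]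
    cases c with
    | x => rw [shiftEquiv_x, germX_x, germX_x, mul_zero, map_zero]
    | tx => rw [mul_comm, germX_f_mul_qInv, germX_tx, map_one]
    | t k => rw [shiftEquiv_t, germX_t, germX_t, mul_zero, map_zero]
  K_D n F := by
    refine related_of_coord hf ht n (δ := germK hf ht n -
      (qInv hf ht n * germK hf ht n (shiftEquiv hf ht n (coordGerm _ .tx))) • germX _)
      (sub_mem (represents_germK hf ht n).1 (Submodule.smul_mem _ _ (represents_germX _).1))
      (represents_germK hf ht (n + 1)).1 (fun c => ?_) F
    rw [Derivation.sub_apply, Derivation.smul_apply, smul_eq_mul]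
    cases c with
    | x => rw [shiftEquiv_x, germX_x, germK_x, germK_x, mul_zero, sub_zero, map_one]
    | tx =>
      -- On t_x the claim is K f - p X f = 0, which is how p was chosen.
      rw [germK_tx, map_zero]
      linear_combination -germK hf ht n (shiftEquiv hf ht n (coordGerm _ .tx)) *
        germX_f_mul_qInv hf ht n
    | t k =>
      rw [shiftEquiv_t, germX_t, germK_t, germK_t, mul_zero, sub_zero, shiftEquiv_germ]
      exact germ_eq_germ.2 ((siteSlope_shift hf ht k n).mono fun Q h => h.symm)

/-! ### The characteristic ring -/

lemma exists_gen_of_charRing {V : VField} (h : CharRing f Ω (trajJet x₀ τ ξ n) V) :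
    ∃ δ, (jetChain hf ht).Gen n δ ∧ Represents V δ := by
  induction h with
  | genX => exact ⟨_, .genX, represents_germX _⟩
  | genK => exact ⟨_, .genK, represents_germK hf ht n⟩
  | add _ _ h h' =>
    obtain ⟨δ, h1, h2⟩ := h
    obtain ⟨ε, k1, k2⟩ := h'
    exact ⟨_, .add h1 k1, h2.add k2⟩
  | smul hF _ h =>
    obtain ⟨δ, h1, h2⟩ := h
    exact ⟨_, .smul _ h1, h2.smul hF⟩
  | comm _ _ h h' =>
    obtain ⟨δ, h1, h2⟩ := h
    obtain ⟨ε, k1, k2⟩ := h'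
    exact ⟨_, .comm h1 k1, h2.bracket k2⟩

/-- Ring membership for vector fields concerns actual functions, not germs; so derivations are
matched with some representing field, and scalars with representatives of their germs. -/
lemma exists_charRing_of_gen {δ : Derivation ℤ (finGerms (trajJet x₀ τ ξ n))
    (finGerms (trajJet x₀ τ ξ n))} (h : (jetChain hf ht).Gen n δ) :
    ∃ V, CharRing f Ω (trajJet x₀ τ ξ n) V ∧ Represents V δ := by
  refine ShiftChain.Gen.induction (p := fun δ : Derivation ℤ (finGerms (trajJet x₀ τ ξ n))
    (finGerms (trajJet x₀ τ ξ n)) => ∃ V, CharRing f Ω (trajJet x₀ τ ξ n) V ∧ Represents V δ)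
    ⟨_, .genX, represents_germX _⟩ ⟨_, .genK, represents_germK hf ht n⟩ ?_ ?_ ?_ h
  · rintro _ _ ⟨V, h1, h2⟩ ⟨W, k1, k2⟩
    exact ⟨_, .add h1 k1, h2.add k2⟩
  · rintro a _ ⟨V, h1, h2⟩
    obtain ⟨F, hF, rfl⟩ := exists_germ a
    exact ⟨_, .smul hF h1, h2.smul hF⟩
  · rintro _ _ ⟨V, h1, h2⟩ ⟨W, k1, k2⟩
    exact ⟨_, .comm h1 k1, h2.bracket k2⟩

lemma sum_smul_apply_coord {P : Jet} {B : Fin 5 → VField}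
    {δ : Fin 5 → Derivation ℤ (finGerms P) (finGerms P)} (h : ∀ i, Represents (B i) (δ i))
    {a : Fin 5 → Jet → ℝ} (ha : ∀ i, FinAnalyticAt (a i) P) (c : Coord) :
    ∃ hS : FinAnalyticAt (fun Q => ∑ i, a i Q * B i c Q) P,
      (∑ i, germ (a i) (ha i) • δ i) (coordGerm P c) = germ _ hS := by
  obtain ⟨hS, e⟩ := germ_sum Finset.univ (fun i Q => a i Q * B i c Q)
    (fun i => (ha i).mul ((h i).fin c))
  refine ⟨hS, ?_⟩
  rw [← e, ← Derivation.coeFnAddMonoidHom_apply, map_sum, Finset.sum_apply]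
  exact Finset.sum_congr rfl fun i _ => by
    change germ (a i) (ha i) * δ i (coordGerm P c) = _
    rw [(h i).apply_coord]; rfl

lemma isCharRingBasis_iff {B : Fin 5 → VField} {δ : Fin 5 → Derivation ℤ
    (finGerms (trajJet x₀ τ ξ n)) (finGerms (trajJet x₀ τ ξ n))}
    (hB : ∀ i, CharRing f Ω (trajJet x₀ τ ξ n) (B i)) (h : ∀ i, Represents (B i) (δ i)) :
    IsCharRingBasis f Ω (trajJet x₀ τ ξ n) B ↔ (jetChain hf ht).IsBasis n δ := by
  have hmem (a : Fin 5 → finGerms (trajJet x₀ τ ξ n)) : ∑ i, a i • δ i ∈ fields _ :=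
    Submodule.sum_mem _ fun i _ => Submodule.smul_mem _ _ (h i).1
  constructor
  · rintro ⟨-, h1, h2⟩
    constructor
    · intro a ha i
      have h3 := h1 (fun i => rep (a i)) (fun i => rep_spec (a i)) (fun c => by
        obtain ⟨hS, e⟩ := sum_smul_apply_coord h (fun i => rep_spec (a i)) c
        simp only [germ_rep, ha, Derivation.zero_apply] at e
        exact germ_eq_zero.1 e.symm) i
      rw [← germ_rep (a i), germ_eq_zero]
      exact h3
    · intro ε hε
      obtain ⟨V, hV, hVε⟩ := exists_charRing_of_gen hf ht n hε
      obtain ⟨q, a, hq, ha, hq0, h4⟩ := h2 V hV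
      refine ⟨germ q hq, fun i => germ (a i) (ha i), fun h5 => hq0 (germ_eq_zero.1 h5), ?_⟩
      refine fields_ext (Submodule.smul_mem _ _ hVε.1) (hmem _) fun c => ?_
      obtain ⟨hS, e⟩ := sum_smul_apply_coord h ha c
      rw [e, (hVε.smul hq).apply_coord]
      exact germ_eq_germ.2 (h4 c)
  · rintro ⟨h1, h2⟩
    refine ⟨hB, fun a ha h3 i => ?_, fun V hV => ?_⟩
    · refine germ_eq_zero.1 (h1 (fun i => germ (a i) (ha i)) ?_ i)
      refine fields_ext (hmem _) (zero_mem _) fun c => ?_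
      obtain ⟨hS, e⟩ := sum_smul_apply_coord h ha c
      rw [e]
      exact germ_eq_zero.2 (h3 c)
    · obtain ⟨ε, hε, hVε⟩ := exists_gen_of_charRing hf ht n hV
      obtain ⟨q, a, hq, h4⟩ := h2 ε hε
      refine ⟨rep q, fun i => rep (a i), rep_spec q, fun i => rep_spec (a i), fun h5 => hq ?_,
        fun c => ?_⟩
      · rw [← germ_rep q]; exact germ_eq_zero.2 h5
      · obtain ⟨hS, e⟩ := sum_smul_apply_coord h (fun i => rep_spec (a i)) c
        simp only [germ_rep] at e
        rw [← h4] at e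
        have h6 : (q • ε) (coordGerm _ c) = germ _ ((rep_spec q).mul (hVε.fin c)) := by
          conv_lhs => rw [← germ_rep q]
          exact (hVε.smul (rep_spec q)).apply_coord c
        exact germ_eq_germ.1 (h6.symm.trans e)

end Chain

end SemiDiscrete

namespace SemiDiscrete

/-! ### Functions and their germs -/

/-- `φ` is the germ of `F`. -/
def HasGerm {P : Jet} (F : Jet → ℝ) (φ : finGerms P) : Prop := ∃ h, germ F h = φ

namespace HasGerm

variable {P : Jet} {F F' : Jet → ℝ} {φ ψ : finGerms P}

lemma fin (h : HasGerm F φ) : FinAnalyticAt F P := h.1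
lemma eq (h : HasGerm F φ) (hF : FinAnalyticAt F P) : germ F hF = φ := h.2
lemma eq_iff (h : HasGerm F φ) (h' : HasGerm F' ψ) : φ = ψ ↔ ∀ᶠ Q in 𝓝 P, F Q = F' Q := by
  obtain ⟨h, rfl⟩ := h
  obtain ⟨h', rfl⟩ := h'
  exact germ_eq_germ
lemma eq_zero_iff (h : HasGerm F φ) : φ = 0 ↔ ∀ᶠ Q in 𝓝 P, F Q = 0 := by
  obtain ⟨h, rfl⟩ := h
  exact germ_eq_zero
lemma congr (h : HasGerm F φ) (e : ∀ᶠ Q in 𝓝 P, F' Q = F Q) : HasGerm F' φ := by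
  obtain ⟨h, rfl⟩ := h
  exact ⟨h.congr e, germ_eq_germ.2 e⟩
lemma of_eq (h : HasGerm F φ) (e : φ = ψ) : HasGerm F ψ := e ▸ h
lemma add (h : HasGerm F φ) (h' : HasGerm F' ψ) : HasGerm (fun Q => F Q + F' Q) (φ + ψ) := by
  obtain ⟨h, rfl⟩ := h
  obtain ⟨h', rfl⟩ := h'
  exact ⟨h.add h', rfl⟩
lemma sub (h : HasGerm F φ) (h' : HasGerm F' ψ) : HasGerm (fun Q => F Q - F' Q) (φ - ψ) := by
  obtain ⟨h, rfl⟩ := h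
  obtain ⟨h', rfl⟩ := h'
  exact ⟨h.sub h', rfl⟩
lemma mul (h : HasGerm F φ) (h' : HasGerm F' ψ) : HasGerm (fun Q => F Q * F' Q) (φ * ψ) := by
  obtain ⟨h, rfl⟩ := h
  obtain ⟨h', rfl⟩ := h'
  exact ⟨h.mul h', rfl⟩
lemma neg (h : HasGerm F φ) : HasGerm (fun Q => -F Q) (-φ) := by
  obtain ⟨h, rfl⟩ := h
  exact ⟨h.neg, rfl⟩
lemma pow (h : HasGerm F φ) (k : ℕ) : HasGerm (fun Q => F Q ^ k) (φ ^ k) := by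
  obtain ⟨h, rfl⟩ := h
  exact ⟨h.pow k, (germ_pow h k).symm⟩
lemma one : HasGerm (P := P) (fun _ => 1) 1 := ⟨.const 1, rfl⟩
lemma natCast (k : ℕ) : HasGerm (P := P) (fun _ => (k : ℝ)) (k : finGerms P) := by
  induction k with
  | zero => exact ⟨by simpa using FinAnalyticAt.const 0, by simp; rfl⟩
  | succ k ih => simpa using ih.add one
lemma ofNat (k : ℕ) [k.AtLeastTwo] :
    HasGerm (P := P) (fun _ => (ofNat(k) : ℝ)) (ofNat(k) : finGerms P) := by
  simpa only [Nat.cast_ofNat] using natCast (P := P) (OfNat.ofNat k)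
lemma germX (h : HasGerm F φ) : HasGerm (pd .tx F) (germX P φ) := by
  obtain ⟨h, rfl⟩ := h
  exact ⟨h.pd .tx, (germX_germ h).symm⟩
lemma coord (c : Coord) : HasGerm (fun Q => Q c) (coordGerm P c) := ⟨.coord c, rfl⟩

/-- The action of a vector field on a function of `x, t, t_1, t_x`. -/
lemma apply_args {δ : Derivation ℤ (finGerms P) (finGerms P)} (hδ : δ ∈ fields P)
    {g : ℝ × ℝ × ℝ × ℝ → ℝ} (h : HasGerm (fun Q => g (args Q)) φ) {a b c d : Jet → ℝ}
    (ha : HasGerm a (δ (coordGerm P .x))) (hb : HasGerm b (δ (coordGerm P .tx)))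
    (hc : HasGerm c (δ (coordGerm P (.t 0)))) (hd : HasGerm d (δ (coordGerm P (.t 1)))) :
    HasGerm (fun Q => a Q * pd .x (fun Q => g (args Q)) Q + b Q * pd .tx (fun Q => g (args Q)) Q
      + c Q * pd (.t 0) (fun Q => g (args Q)) Q + d Q * pd (.t 1) (fun Q => g (args Q)) Q)
      (δ φ) := by
  classical
  obtain ⟨hF, rfl⟩ := h
  have hs : ∀ e ∉ ({.x, .tx, .t 0, .t 1} : Finset Coord), pdGerm e (germ _ hF) = 0 := by
    intro e he
    simp only [Finset.mem_insert, Finset.mem_singleton, not_or] at he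
    obtain ⟨h1, h2, h3, h4⟩ := he
    rw [pdGerm_germ]
    refine germ_eq_zero.2 (Eventually.of_forall fun Q => ?_)
    simp [pd, args, Function.update_of_ne (Ne.symm h1), Function.update_of_ne (Ne.symm h2),
      Function.update_of_ne (Ne.symm h3), Function.update_of_ne (Ne.symm h4)]
  have e : δ (germ _ hF) = δ (coordGerm P .x) * pdGerm .x (germ _ hF) +
      δ (coordGerm P .tx) * pdGerm .tx (germ _ hF) +
      δ (coordGerm P (.t 0)) * pdGerm (.t 0) (germ _ hF) +
      δ (coordGerm P (.t 1)) * pdGerm (.t 1) (germ _ hF) := by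
    conv_lhs => rw [eq_ofCoeffs hδ]
    rw [ofCoeffs_eq_sum _ hs]
    rw [Finset.sum_insert (by simp), Finset.sum_insert (by simp), Finset.sum_insert (by simp),
      Finset.sum_singleton]
    ring
  rw [e]
  have hp (c : Coord) : HasGerm (pd c (fun Q => g (args Q))) (pdGerm c (germ _ hF)) :=
    ⟨hF.pd c, (pdGerm_germ c hF).symm⟩
  exact (((ha.mul (hp _)).add (hb.mul (hp _))).add (hc.mul (hp _))).add (hd.mul (hp _))

end HasGerm

section Chain

variable {f : ℝ × ℝ × ℝ × ℝ → ℝ} {Ω : Set (ℝ × ℝ × ℝ × ℝ)} {x₀ : ℝ} {τ ξ : ℤ → ℝ}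
  (hf : IsRegular f Ω) (ht : IsTrajectory f Ω x₀ τ ξ) (n : ℤ)

lemma HasGerm.D {F : Jet → ℝ} {φ : finGerms (trajJet x₀ τ ξ (n + 1))} (h : HasGerm F φ) :
    HasGerm (D f F) ((jetChain hf ht).D n φ) := by
  obtain ⟨h, rfl⟩ := h
  exact ⟨_, (shiftEquiv_germ hf ht n h).symm⟩

lemma HasGerm.Dinv {F : Jet → ℝ} {φ : finGerms (trajJet x₀ τ ξ n)} (h : HasGerm F φ) :
    HasGerm (Dinv f Ω F) (((jetChain hf ht).D n).symm φ) := by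
  obtain ⟨h, rfl⟩ := h
  refine ⟨h.pull (isAnalyticMap_shiftInv hf ht n), ?_⟩
  rw [RingEquiv.eq_symm_apply]
  refine (shiftEquiv_germ hf ht n _).trans (germ_eq_germ.2 ?_)
  filter_upwards [shiftInv_shift hf ht n] with Q hQ
  change F (shiftInv f Ω (shift f Q)) = F Q
  rw [hQ]

lemma hasGerm_f : HasGerm (fJ f) ((jetChain hf ht).f n) :=
  ⟨fJ_fin hf ht n, (shiftEquiv_tx hf ht n).symm⟩
lemma hasGerm_q : HasGerm (f_tx f) ((jetChain hf ht).q n) := (hasGerm_f hf ht n).germX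
lemma hasGerm_q2 : HasGerm (f_txtx f) ((jetChain hf ht).q2 n) := (hasGerm_q hf ht n).germX
lemma hasGerm_q3 : HasGerm (f_txtxtx f) ((jetChain hf ht).q3 n) := (hasGerm_q2 hf ht n).germX
lemma hasGerm_q4 : HasGerm (f_txtxtxtx f) ((jetChain hf ht).X n ((jetChain hf ht).q3 n)) :=
  (hasGerm_q3 hf ht n).germX
lemma hasGerm_qi : HasGerm (fun Q => (f_tx f Q)⁻¹) ((jetChain hf ht).qi n) :=
  ⟨(f_tx_fin hf ht n).inv (f_tx_ne hf ht n), rfl⟩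
lemma hasGerm_q2i : HasGerm (fun Q => (f_txtx f Q)⁻¹) ((jetChain hf ht).q2i n) :=
  ⟨(f_txtx_fin hf ht n).inv (f_txtx_ne hf ht n), rfl⟩

lemma eventually_f_tx_ne (hf : IsRegular f Ω) (ht : IsTrajectory f Ω x₀ τ ξ) (n : ℤ) :
    ∀ᶠ Q in 𝓝 (trajJet x₀ τ ξ n), f_tx f Q ≠ 0 :=
  (f_tx_fin hf ht n).continuousAt.eventually_ne (f_tx_ne hf ht n)

lemma hasGerm_C1 {g : ℝ × ℝ × ℝ × ℝ → ℝ} {F : Jet → ℝ} (hF : F = fun Q => g (args Q))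
    {φ : finGerms (trajJet x₀ τ ξ n)} (h : HasGerm F φ) :
    HasGerm (fun Q => pd (.t 0) F Q + f_tx f Q * pd (.t 1) F Q) ((jetChain hf ht).C1 n φ) := by
  subst hF
  have h0 : HasGerm (P := trajJet x₀ τ ξ n) (fun _ => 0) 0 := by simpa using HasGerm.natCast 0
  refine (HasGerm.apply_args ((jetChain hf ht).C1_mem n) h
    (h0.of_eq ((jetChain hf ht).C1_x n).symm) (h0.of_eq ((jetChain hf ht).C1_tx n).symm)
    (HasGerm.one.of_eq ((jetChain hf ht).C1_t0 n).symm)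
    ((hasGerm_q hf ht n).of_eq ((jetChain hf ht).C1_t1 n).symm)).congr
    (Eventually.of_forall fun Q => by ring)

lemma hasGerm_C2 {g : ℝ × ℝ × ℝ × ℝ → ℝ} {F : Jet → ℝ} (hF : F = fun Q => g (args Q))
    {φ : finGerms (trajJet x₀ τ ξ n)} (h : HasGerm F φ) :
    HasGerm (fun Q => f_txtx f Q * pd (.t 1) F Q) ((jetChain hf ht).C2 n φ) := by
  subst hF
  have h0 : HasGerm (P := trajJet x₀ τ ξ n) (fun _ => 0) 0 := by simpa using HasGerm.natCast 0
  obtain ⟨h1, h2, h3, h4⟩ := (jetChain hf ht).C2_vertical n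
  refine (HasGerm.apply_args h1 h (h0.of_eq h2.symm) (h0.of_eq h3.symm) (h0.of_eq h4.symm)
    ((hasGerm_q2 hf ht n).of_eq ((jetChain hf ht).C2_t1 n).symm)).congr
    (Eventually.of_forall fun Q => by ring)

lemma hasGerm_K {g : ℝ × ℝ × ℝ × ℝ → ℝ} {F : Jet → ℝ} (hF : F = fun Q => g (args Q))
    {φ : finGerms (trajJet x₀ τ ξ n)} (h : HasGerm F φ) :
    HasGerm (fun Q => pd .x F Q + Q .tx * pd (.t 0) F Q + fJ f Q * pd (.t 1) F Q)
      ((jetChain hf ht).K n φ) := by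
  subst hF
  have h0 : HasGerm (P := trajJet x₀ τ ξ n) (fun _ => 0) 0 := by simpa using HasGerm.natCast 0
  refine (HasGerm.apply_args ((jetChain hf ht).K_mem n) h
    (HasGerm.one.of_eq ((jetChain hf ht).K_x n).symm) (h0.of_eq ((jetChain hf ht).K_tx n).symm)
    ((HasGerm.coord _).of_eq ((jetChain hf ht).K_t0 n).symm)
    ((hasGerm_f hf ht n).of_eq ((jetChain hf ht).K_t1 n).symm)).congr
    (Eventually.of_forall fun Q => by ring)

lemma fJ_eq_args : fJ f = fun Q => f (args Q) := rfl
lemma f_tx_eq_args : f_tx f = fun Q => par f (args Q) := funext f_tx_eq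
lemma f_txtx_eq_args : f_txtx f = fun Q => par (par f) (args Q) := funext f_txtx_eq

lemma hasGerm_v : HasGerm (vFun f) ((jetChain hf ht).v n) :=
  hasGerm_C1 hf ht n fJ_eq_args (hasGerm_f hf ht n)

lemma hasGerm_p : HasGerm (pFun f) ((jetChain hf ht).p n) :=
  ((hasGerm_qi hf ht n).mul (hasGerm_K hf ht n fJ_eq_args (hasGerm_f hf ht n))).congr
    (Eventually.of_forall fun _ => div_eq_inv_mul _ _)

lemma hasGerm_lam : HasGerm (fun Q => (wFun f Q - vFun f Q) / f_txtx f Q)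
    ((jetChain hf ht).lam n) := by
  -- Z_1 t_1 = K (C_1 t_1) - C_1 (K t_1) = K f_{t_x} - C_1 f = w - v; dividing by C_2 t_1 = f_{t_x
  -- t_x} gives λ.
  have h1 : (jetChain hf ht).Z1 n ((jetChain hf ht).t n 1) =
      (jetChain hf ht).K n ((jetChain hf ht).q n) - (jetChain hf ht).v n := by
    rw [ShiftChain.Z1_apply, ShiftChain.C1_t1, ShiftChain.K_t1]; rfl
  rw [ShiftChain.lam, h1]
  exact ((hasGerm_q2i hf ht n).mul ((hasGerm_K hf ht n f_tx_eq_args (hasGerm_q hf ht n)).sub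
    (hasGerm_v hf ht n))).congr (Eventually.of_forall fun _ => div_eq_inv_mul _ _)

lemma zCondition_iff : ZCondition f (trajJet x₀ τ ξ n) ↔ (jetChain hf ht).ZCond n :=
  (((hasGerm_lam hf ht (n + 1)).D hf ht n).eq_iff
    ((hasGerm_q hf ht n).mul ((hasGerm_lam hf ht n).sub (hasGerm_p hf ht n)))).symm

lemma hasGerm_e : HasGerm (fun Q => hFun f Q / f_tx f Q ^ 2) ((jetChain hf ht).e n) := by
  refine (((hasGerm_q3 hf ht n).mul (hasGerm_qi hf ht n)).sub (((HasGerm.ofNat 3).mul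
    ((hasGerm_q2 hf ht n).pow 2)).mul ((hasGerm_qi hf ht n).pow 2))).congr ?_
  filter_upwards [eventually_f_tx_ne hf ht n] with Q hQ
  rw [hFun]
  field_simp

/-- The chain system attached to a difference system whose coefficients have the given germs. -/
lemma exists_system (Y : DiffSystem) (hE12 : Y.E12 = fun _ => -1) (hE24 : Y.E24 = fun _ => -1)
    {M : ∀ n, Derivation ℤ (finGerms (trajJet x₀ τ ξ n)) (finGerms (trajJet x₀ τ ξ n))}
    {β F1 F2 F3 : ∀ n, finGerms (trajJet x₀ τ ξ n)}
    (hM : ∀ n, M n ∈ (jetChain hf ht).vertical n) (hβ : ∀ n, β n ≠ 0)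
    (hrel : ∀ n, ∃ c : finGerms (trajJet x₀ τ ξ n), (jetChain hf ht).Related (M (n + 1))
      (((jetChain hf ht).qi n ^ 3 * β n) • M n -
        ((jetChain hf ht).qi n ^ 3 * F1 n) • (jetChain hf ht).C3 n
        - ((jetChain hf ht).qi n ^ 2 * F2 n) • (jetChain hf ht).C2 n
        - ((jetChain hf ht).qi n ^ 3 * F3 n) • (jetChain hf ht).C1 n
        + c • (jetChain hf ht).X n))
    (h11 : ∀ n, HasGerm Y.E11 (β n))
    (h22 : ∀ n, HasGerm Y.E22 (3 * (jetChain hf ht).q2 n * (jetChain hf ht).qi n ^ 2))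
    (h23 : ∀ n, HasGerm Y.E23 ((jetChain hf ht).qi n * β n))
    (h32 : ∀ n, HasGerm Y.E32 ((jetChain hf ht).e n))
    (h34 : ∀ n, HasGerm Y.E34 ((jetChain hf ht).q2 n))
    (hF1 : ∀ n, HasGerm Y.F1 (F1 n)) (hF2 : ∀ n, HasGerm Y.F2 (F2 n))
    (hF3 : ∀ n, HasGerm Y.F3 (F3 n)) :
    ∃ T : (jetChain hf ht).System, T.M = M ∧
      (∀ n, Y.Nondegenerate f Ω (trajJet x₀ τ ξ n) ↔ T.del n ≠ 0) ∧
      ∀ n, T.del n ≠ 0 → T.del (n + 1) ≠ 0 →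
        (Y.Compatible f Ω (trajJet x₀ τ ξ n) ↔ T.Compat n) := by
  choose c hc using hrel
  have hm1 : ∀ n, HasGerm (P := trajJet x₀ τ ξ n) (fun _ => (-1 : ℝ)) (-1) :=
    fun n => HasGerm.one.neg
  have h12 : ∀ n, HasGerm (P := trajJet x₀ τ ξ n) Y.E12 (-1) := hE12 ▸ hm1
  have h24 : ∀ n, HasGerm (P := trajJet x₀ τ ξ n) Y.E24 (-1) := hE24 ▸ hm1
  -- The entries under D⁻¹ belong to site n and the others to site n+1, so the germ of Δ is computed
  -- at site n+1.
  have hdel n : HasGerm (Y.delta f Ω) _ :=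
    ((((((h11 (n + 1)).mul (h22 (n + 1))).mul (h34 (n + 1))).mul
    ((h34 n).Dinv hf ht n)).neg).add ((((h11 (n + 1)).mul (h24 (n + 1))).mul (h32 (n + 1))).mul
    ((h34 n).Dinv hf ht n))).sub ((((h12 (n + 1)).mul (h23 (n + 1))).mul (h34 (n + 1))).mul
    ((h32 n).Dinv hf ht n))
  let num : Jet → ℝ := fun Q =>
    (Y.F1 Q * Y.E24 Q * Y.E32 Q - Y.F1 Q * Y.E22 Q * Y.E34 Q + Y.F2 Q * Y.E12 Q * Y.E34 Q
      - Y.F3 Q * Y.E12 Q * Y.E24 Q) * Dinv f Ω Y.E34 Q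
    - Dinv f Ω Y.F3 Q * Y.E12 Q * Y.E23 Q * Y.E34 Q
  have hnum n : HasGerm num _ := (((((((hF1 (n + 1)).mul (h24 (n + 1))).mul (h32 (n + 1))).sub
    (((hF1 (n + 1)).mul (h22 (n + 1))).mul (h34 (n + 1)))).add
    (((hF2 (n + 1)).mul (h12 (n + 1))).mul (h34 (n + 1)))).sub
    (((hF3 (n + 1)).mul (h12 (n + 1))).mul (h24 (n + 1)))).mul ((h34 n).Dinv hf ht n)).sub
    (((((hF3 n).Dinv hf ht n).mul (h12 (n + 1))).mul (h23 (n + 1))).mul (h34 (n + 1)))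
  have hdel_fin : ∀ n, FinAnalyticAt (Y.delta f Ω) (trajJet x₀ τ ξ n) := fun n => by
    obtain ⟨n, rfl⟩ : ∃ m, n = m + 1 := ⟨n - 1, by ring⟩
    exact (hdel n).fin
  have hnum_fin : ∀ n, FinAnalyticAt num (trajJet x₀ τ ξ n) := fun n => by
    obtain ⟨n, rfl⟩ : ∃ m, n = m + 1 := ⟨n - 1, by ring⟩
    exact (hnum n).fin
  have he (n : ℤ) : (jetChain hf ht).e (n + 1) = (jetChain hf ht).q3 (n + 1) *
      (jetChain hf ht).qi (n + 1) - 3 * (jetChain hf ht).q2 (n + 1) ^ 2 *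
      (jetChain hf ht).qi (n + 1) ^ 2 := rfl
  let T : (jetChain hf ht).System :=
    { M := M, β := β, F1 := F1, F2 := F2, F3 := F3, c := c, M_vertical := hM, β_ne_zero := hβ
      related_M := hc, num := fun n => germ _ (hnum_fin n), del := fun n => germ _ (hdel_fin n)
      -- With E_{24} = -1, the term 3 q2² qi² from E_{22} E_{34} cancels the one inside E_{32} = e,
      -- leaving qi β (q2 D⁻¹e - q3 D⁻¹q2).
      D_del := fun n => by
        rw [(hdel n).eq (hdel_fin (n + 1))]
        simp only [map_sub, map_add, map_mul, map_neg, map_one, map_pow, map_ofNat,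
          RingEquiv.apply_symm_apply, he]
        ring
      D_num := fun n => by
        rw [(hnum n).eq (hnum_fin (n + 1))]
        simp only [map_sub, map_add, map_mul, map_neg, map_one, map_pow, map_ofNat,
          RingEquiv.apply_symm_apply, he]
        ring }
  refine ⟨T, rfl, fun n => not_congr (HasGerm.eq_zero_iff ⟨hdel_fin n, rfl⟩).symm,
    fun n h0 h1 => ?_⟩
  have hn : HasGerm num (T.num n) := ⟨hnum_fin n, rfl⟩
  have hd : HasGerm (Y.delta f Ω) (T.del n) := ⟨hdel_fin n, rfl⟩
  have hn' : HasGerm (D f num) _ := HasGerm.D hf ht n ⟨hnum_fin (n + 1), rfl⟩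
  have hd' : HasGerm (D f (Y.delta f Ω)) _ := HasGerm.D hf ht n ⟨hdel_fin (n + 1), rfl⟩
  have hH (Q : Jet) : Y.H f Ω Q = num Q / Y.delta f Ω Q := rfl
  have hL := hn'.mul hd
  have hR := (((h11 n).mul hn).sub ((hF1 n).mul hd)).mul hd'
  have hC : T.Compat n ↔ _ := hL.eq_iff hR
  constructor
  · intro h
    -- Compatibility is known only where Δ and DΔ are nonzero. After multiplication by Δ · DΔ it
    -- holds throughout a neighbourhood, and the nonzero germs then cancel in the domain.
    have h2 := ((hd.mul hd').mul (hL.sub hR)).eq_zero_iff.2 (by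
      filter_upwards [h] with Q hQ
      by_cases k0 : Y.delta f Ω Q = 0
      · rw [k0]; ring
      by_cases k1 : D f (Y.delta f Ω) Q = 0
      · rw [k1]; ring
      have h3 : D f num Q / D f (Y.delta f Ω) Q = _ := hQ k0 k1
      rw [hH, hE12, div_eq_iff k1] at h3
      rw [h3]
      field_simp
      ring)
    refine sub_eq_zero.1 ((mul_eq_zero.1 h2).resolve_left (mul_ne_zero h0 ?_))
    exact (jetChain hf ht).D_ne_zero n h1
  · intro h
    filter_upwards [hC.1 h] with Q hQ k0 k1
    change D f num Q / D f (Y.delta f Ω) Q = _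
    rw [hH, hE12]
    field_simp
    linear_combination hQ

end Chain

end SemiDiscrete

namespace SemiDiscrete

section Chain

variable {f : ℝ × ℝ × ℝ × ℝ → ℝ} {Ω : Set (ℝ × ℝ × ℝ × ℝ)} {x₀ : ℝ} {τ ξ : ℤ → ℝ}
  (hf : IsRegular f Ω) (ht : IsTrajectory f Ω x₀ τ ξ) (n : ℤ)

/-! ### The two systems -/

lemma hasGerm_C1_q : HasGerm (fun Q => f_ttx f Q + f_tx f Q * f_t1tx f Q)
    ((jetChain hf ht).C1 n ((jetChain hf ht).q n)) :=
  hasGerm_C1 hf ht n f_tx_eq_args (hasGerm_q hf ht n)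

lemma hasGerm_C1_q2 : HasGerm (fun Q => f_ttxtx f Q + f_tx f Q * f_t1txtx f Q)
    ((jetChain hf ht).C1 n ((jetChain hf ht).q2 n)) :=
  hasGerm_C1 hf ht n f_txtx_eq_args (hasGerm_q2 hf ht n)

lemma hasGerm_C2_f : HasGerm (fun Q => f_txtx f Q * f_t1 f Q)
    ((jetChain hf ht).C2 n ((jetChain hf ht).f n)) :=
  hasGerm_C2 hf ht n fJ_eq_args (hasGerm_f hf ht n)

lemma hasGerm_C2_q : HasGerm (fun Q => f_txtx f Q * f_t1tx f Q)
    ((jetChain hf ht).C2 n ((jetChain hf ht).q n)) :=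
  hasGerm_C2 hf ht n f_tx_eq_args (hasGerm_q hf ht n)

lemma hasGerm_E22 : HasGerm (fun Q => 3 * f_txtx f Q / f_tx f Q ^ 2)
    (3 * (jetChain hf ht).q2 n * (jetChain hf ht).qi n ^ 2) := by
  refine (((HasGerm.ofNat 3).mul (hasGerm_q2 hf ht n)).mul ((hasGerm_qi hf ht n).pow 2)).congr
    (Eventually.of_forall fun Q => ?_)
  simp only [div_eq_mul_inv, inv_pow]

lemma hasGerm_system2_F1 : HasGerm (system2 f).F1 ((jetChain hf ht).F1 n) :=
  ((hasGerm_v hf ht n).mul (hasGerm_qi hf ht n)).congr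
    (Eventually.of_forall fun _ => div_eq_mul_inv _ _)

lemma hasGerm_system2_F2 : HasGerm (system2 f).F2 ((jetChain hf ht).F2 n) := by
  have hi := hasGerm_qi hf ht n
  refine (((((HasGerm.ofNat 2).mul (hasGerm_C1_q hf ht n)).mul (hi.pow 2)).sub
    ((hasGerm_C2_f hf ht n).mul (hi.pow 2))).sub ((((HasGerm.ofNat 2).mul
    (hasGerm_v hf ht n)).mul (hasGerm_q2 hf ht n)).mul (hi.pow 3))).congr ?_
  filter_upwards [eventually_f_tx_ne hf ht n] with Q hQ
  simp only [system2, vFun]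
  field_simp
  ring

lemma hasGerm_system2_F3 : HasGerm (system2 f).F3 ((jetChain hf ht).F3 n) := by
  have hi := hasGerm_qi hf ht n
  have h2 := hasGerm_q2 hf ht n
  have hv := hasGerm_v hf ht n
  refine (((((hasGerm_C2_q hf ht n).neg.mul hi).add ((hasGerm_C1_q2 hf ht n).mul hi)).sub
    ((((HasGerm.ofNat 2).mul h2).mul (hasGerm_C1_q hf ht n)).mul (hi.pow 2))).sub
    (h2.mul (((hv.mul h2).mul (hi.pow 3)).sub ((hi.pow 2).mul (hasGerm_C2_f hf ht n))))).sub
    ((hv.mul (hasGerm_e hf ht n)).mul hi) |>.congr ?_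
  filter_upwards [eventually_f_tx_ne hf ht n] with Q hQ
  simp only [system2, vFun, hFun]
  field_simp
  ring

lemma hasGerm_system3_F1 : HasGerm (system3 f).F1
    (6 * (jetChain hf ht).q2 n * (jetChain hf ht).qi n ^ 2) := by
  refine (((HasGerm.ofNat 6).mul (hasGerm_q2 hf ht n)).mul ((hasGerm_qi hf ht n).pow 2)).congr
    (Eventually.of_forall fun Q => ?_)
  simp only [system3, div_eq_mul_inv, inv_pow]

lemma hasGerm_system3_F2 : HasGerm (system3 f).F2 (4 * (jetChain hf ht).e n *
    (jetChain hf ht).qi n ^ 2 - 3 * (jetChain hf ht).q2 n ^ 2 * (jetChain hf ht).qi n ^ 4) := by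
  have hi := hasGerm_qi hf ht n
  refine ((((HasGerm.ofNat 4).mul (hasGerm_e hf ht n)).mul (hi.pow 2)).sub
    (((HasGerm.ofNat 3).mul ((hasGerm_q2 hf ht n).pow 2)).mul (hi.pow 4))).congr ?_
  filter_upwards [eventually_f_tx_ne hf ht n] with Q hQ
  simp only [system3]
  field_simp

lemma ShiftChain.X_e {A : ℤ → Type*} [∀ n, CommRing (A n)] (S : ShiftChain A) (n : ℤ) :
    S.X n (S.e n) = S.X n (S.q3 n) * S.qi n - 7 * S.q2 n * S.q3 n * S.qi n ^ 2
      + 6 * S.q2 n ^ 3 * S.qi n ^ 3 := by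
  have h3 : S.X n 3 = 0 := by exact_mod_cast (S.X n).map_natCast 3
  simp only [ShiftChain.e, map_sub, Derivation.leibniz, Derivation.leibniz_pow, smul_eq_mul,
    nsmul_eq_mul, ShiftChain.X_qi, ShiftChain.X_q2, h3]
  push_cast
  ring

lemma hasGerm_system3_F3 : HasGerm (system3 f).F3
    ((jetChain hf ht).X n ((jetChain hf ht).e n) * (jetChain hf ht).qi n -
      3 * (jetChain hf ht).e n * (jetChain hf ht).q2 n * (jetChain hf ht).qi n ^ 2) := by
  have hi := hasGerm_qi hf ht n
  have h2 := hasGerm_q2 hf ht n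
  rw [ShiftChain.X_e]
  refine ((((((hasGerm_q4 hf ht n).mul hi).sub ((((HasGerm.ofNat 7).mul h2).mul
    (hasGerm_q3 hf ht n)).mul (hi.pow 2))).add (((HasGerm.ofNat 6).mul (h2.pow 3)).mul
    (hi.pow 3))).mul hi).sub
    ((((HasGerm.ofNat 3).mul (hasGerm_e hf ht n)).mul h2).mul (hi.pow 2))).congr ?_
  filter_upwards [eventually_f_tx_ne hf ht n] with Q hQ
  simp only [system3, hFun]
  field_simp
  ring

lemma exists_system2 : ∃ T : (jetChain hf ht).System,
    T.M = (fun n => ⁅(jetChain hf ht).C1 n, (jetChain hf ht).C2 n⁆) ∧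
    (∀ n, (system2 f).Nondegenerate f Ω (trajJet x₀ τ ξ n) ↔ T.del n ≠ 0) ∧
    ∀ n, T.del n ≠ 0 → T.del (n + 1) ≠ 0 →
      ((system2 f).Compatible f Ω (trajJet x₀ τ ξ n) ↔ T.Compat n) :=
  exists_system hf ht (system2 f) rfl rfl (β := fun _ => 1)
    (fun n => ShiftChain.lie_C1_C2_vertical _ n)
    (fun _ => one_ne_zero)
    (fun n => by simpa only [mul_one] using (jetChain hf ht).related_lie_C1_C2 n)
    (fun _ => HasGerm.one) (hasGerm_E22 hf ht)
    (fun n => by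
      rw [mul_one]
      exact (hasGerm_qi hf ht n).congr (Eventually.of_forall fun _ => one_div _))
    (hasGerm_e hf ht) (hasGerm_q2 hf ht) (hasGerm_system2_F1 hf ht) (hasGerm_system2_F2 hf ht)
    (hasGerm_system2_F3 hf ht)

lemma exists_system3 : ∃ T : (jetChain hf ht).System, T.M = (jetChain hf ht).C4 ∧
    (∀ n, (system3 f).Nondegenerate f Ω (trajJet x₀ τ ξ n) ↔ T.del n ≠ 0) ∧
    ∀ n, T.del n ≠ 0 → T.del (n + 1) ≠ 0 →
      ((system3 f).Compatible f Ω (trajJet x₀ τ ξ n) ↔ T.Compat n) :=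
  exists_system hf ht (system3 f) rfl rfl (fun n => ShiftChain.C4_vertical _ n)
    (fun n => (jetChain hf ht).qi_ne_zero n) (fun n => (jetChain hf ht).related_C4 n)
    (fun n => (hasGerm_qi hf ht n).congr (Eventually.of_forall fun _ => one_div _))
    (hasGerm_E22 hf ht)
    (fun n => ((hasGerm_qi hf ht n).mul (hasGerm_qi hf ht n)).congr
      (Eventually.of_forall fun Q => by
        change 1 / f_tx f Q ^ 2 = _
        rw [one_div, sq, mul_inv]))
    (hasGerm_e hf ht) (hasGerm_q2 hf ht) (hasGerm_system3_F1 hf ht) (hasGerm_system3_F2 hf ht)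
    (hasGerm_system3_F3 hf ht)

end Chain

end SemiDiscrete

namespace SemiDiscrete

section TwoStep

variable {f : ℝ × ℝ × ℝ × ℝ → ℝ} {Ω : Set (ℝ × ℝ × ℝ × ℝ)}

/-! ### Dependence of `C_2` and `C_3` along the trajectory -/

/-- The variables `x, t, t_1, t_2, t_x`. -/
def args₂ (Q : Jet) : ℝ × ℝ × ℝ × ℝ × ℝ := (Q .x, Q (.t 0), Q (.t 1), Q (.t 2), Q .tx)

def site₀ (z : ℝ × ℝ × ℝ × ℝ × ℝ) : ℝ × ℝ × ℝ × ℝ := (z.1, z.2.1, z.2.2.1, z.2.2.2.2)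

def site₁ (f : ℝ × ℝ × ℝ × ℝ → ℝ) (z : ℝ × ℝ × ℝ × ℝ × ℝ) : ℝ × ℝ × ℝ × ℝ :=
  (z.1, z.2.2.1, z.2.2.2.1, f (site₀ z))

lemma site₀_args₂ (Q : Jet) : site₀ (args₂ Q) = args Q := rfl

lemma site₁_args₂ (Q : Jet) : site₁ f (args₂ Q) = args (shift f Q) := by
  simp [site₁, site₀, args₂, args, shift, one_add_one_eq_two]

/-- The function of `x, t, t_1, t_2, t_x` which vanishes where `C_2` and `C_3` are dependent. -/
noncomputable def depFun (f : ℝ × ℝ × ℝ × ℝ → ℝ) (z : ℝ × ℝ × ℝ × ℝ × ℝ) : ℝ :=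
  par (par (par f)) (site₁ f z) * par (par f) (site₀ z) * par f (site₀ z) ^ 2 -
    (par (par (par f)) (site₀ z) * par f (site₀ z) - 3 * par (par f) (site₀ z) ^ 2) *
      par (par f) (site₁ f z)

lemma analyticAt_site₀ (z : ℝ × ℝ × ℝ × ℝ × ℝ) : AnalyticAt ℝ site₀ z := by
  have h1 := analyticAt_snd (𝕜 := ℝ) (p := z)
  have h2 := analyticAt_snd.comp h1
  exact analyticAt_fst.prod ((analyticAt_fst.comp h1).prod
    ((analyticAt_fst.comp h2).prod (analyticAt_snd.comp (analyticAt_snd.comp h2))))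

lemma analyticAt_site₁ {z : ℝ × ℝ × ℝ × ℝ × ℝ} (h : AnalyticAt ℝ f (site₀ z)) :
    AnalyticAt ℝ (site₁ f) z := by
  have h2 := analyticAt_snd.comp (analyticAt_snd (𝕜 := ℝ) (p := z))
  exact analyticAt_fst.prod ((analyticAt_fst.comp h2).prod
    ((analyticAt_fst.comp (analyticAt_snd.comp h2)).prod (h.comp (analyticAt_site₀ z))))

lemma mem_twoStepDomain {z : ℝ × ℝ × ℝ × ℝ × ℝ} :
    z ∈ twoStepDomain f Ω ↔ site₀ z ∈ Ω ∧ site₁ f z ∈ Ω := Iff.rfl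

lemma IsRegular.isOpen_twoStepDomain (hf : IsRegular f Ω) : IsOpen (twoStepDomain f Ω) := by
  rw [isOpen_iff_mem_nhds]
  intro z hz
  obtain ⟨h0, h1⟩ := mem_twoStepDomain.1 hz
  filter_upwards [(analyticAt_site₀ z).continuousAt.eventually (hf.isOpen.mem_nhds h0),
    (analyticAt_site₁ (hf.analytic _ h0)).continuousAt.eventually (hf.isOpen.mem_nhds h1)]
    with w k0 k1 using mem_twoStepDomain.2 ⟨k0, k1⟩

lemma IsRegular.analyticOnNhd_depFun (hf : IsRegular f Ω) :
    AnalyticOnNhd ℝ (depFun f) (twoStepDomain f Ω) := by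
  intro z hz
  obtain ⟨h0, h1⟩ := mem_twoStepDomain.1 hz
  have a0 := hf.analytic _ h0
  have b1 := analyticAt_par a0
  have b2 := analyticAt_par b1
  have b3 := analyticAt_par b2
  have c2 := analyticAt_par (analyticAt_par (hf.analytic _ h1))
  have c3 := analyticAt_par c2
  have s0 := analyticAt_site₀ z
  have s1 := analyticAt_site₁ a0
  exact (((c3.comp s1).mul (b2.comp s0)).mul ((b1.comp s0).pow 2)).sub
    ((((b3.comp s0).mul (b1.comp s0)).sub (analyticAt_const.mul ((b2.comp s0).pow 2))).mul
      (c2.comp s1))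

open Classical in
/-- A germ at `P` of a function of `x, t, t_1, t_2, t_x` vanishes if and only if it vanishes as a
germ on `ℝ⁵`. -/
lemma eventually_args₂_iff {p : ℝ × ℝ × ℝ × ℝ × ℝ → Prop} {P : Jet} :
    (∀ᶠ Q in 𝓝 P, p (args₂ Q)) ↔ ∀ᶠ z in 𝓝 (args₂ P), p z := by
  have hc : Continuous args₂ := by unfold args₂; fun_prop
  refine ⟨fun h => ?_, fun h => hc.continuousAt.eventually h⟩
  let E : ℝ × ℝ × ℝ × ℝ × ℝ → Jet := fun z => Function.update (Function.update (Function.update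
    (Function.update (Function.update P .x z.1) (.t 0) z.2.1) (.t 1) z.2.2.1) (.t 2) z.2.2.2.1)
    .tx z.2.2.2.2
  have hE : Continuous E := by
    refine ((((continuous_const.update _ ?_).update _ ?_).update _ ?_).update _ ?_).update _ ?_ <;>
    fun_prop
  have hEP : E (args₂ P) = P := by simp [E, args₂]
  have hE' (z) : args₂ (E z) = z := by simp [E, args₂]
  have h1 := (hE.tendsto' (args₂ P) P hEP).eventually h
  simpa only [hE'] using h1

variable {x₀ : ℝ} {τ ξ : ℤ → ℝ} (hf : IsRegular f Ω) (ht : IsTrajectory f Ω x₀ τ ξ)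

/-- Because e carries the denominator f_{t_x}², multiplying by it turns the condition into the
vanishing of a function of x, t, t_1, t_2, t_x alone. -/
lemma depCond_iff (n : ℤ) : (jetChain hf ht).DepCond n ↔
    depFun f =ᶠ[𝓝 (args₂ (trajJet x₀ τ ξ n))] 0 := by
  have h1 : (jetChain hf ht).DepCond n ↔ _ :=
    (((hasGerm_q3 hf ht (n + 1)).D hf ht n).mul (hasGerm_q2 hf ht n)).eq_iff
      ((hasGerm_e hf ht n).mul ((hasGerm_q2 hf ht (n + 1)).D hf ht n))
  rw [h1, EventuallyEq, ← eventually_args₂_iff]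
  have h2 := eventually_f_tx_ne hf ht n
  refine eventually_congr ?_
  filter_upwards [h2] with Q hQ
  simp only [D, hFun, f_txtxtx_eq, f_txtx_eq, f_tx_eq, depFun, site₀_args₂, site₁_args₂,
    Pi.zero_apply] at hQ ⊢
  rw [div_mul_eq_mul_div, eq_div_iff (pow_ne_zero 2 hQ), sub_eq_zero]

/-- All sites are seen through the same analytic function on ℝ⁵. It vanishes near one point of the
connected component, hence on the whole component, which is open and contains the points of all
sites. -/
lemma depCond_of_depCond (hconn : ∀ n : ℤ, (x₀, τ n, τ (n + 1), τ (n + 2), ξ n) ∈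
      connectedComponentIn (twoStepDomain f Ω) (x₀, τ 0, τ 1, τ 2, ξ 0))
    {n m : ℤ} (h : (jetChain hf ht).DepCond n) : (jetChain hf ht).DepCond m := by
  rw [depCond_iff] at h ⊢
  have hp (n : ℤ) : args₂ (trajJet x₀ τ ξ n) ∈
      connectedComponentIn (twoStepDomain f Ω) (x₀, τ 0, τ 1, τ 2, ξ 0) := by
    simpa [args₂, trajJet] using hconn n
  have h1 := (hf.analyticOnNhd_depFun.mono
    (connectedComponentIn_subset _ _)).eqOn_zero_of_preconnected_of_eventuallyEq_zero
    isPreconnected_connectedComponentIn (hp n) h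
  filter_upwards [hf.isOpen_twoStepDomain.connectedComponentIn.mem_nhds (hp m)] with z hz
    using h1 hz

end TwoStep

/-! ### The concrete fields and the final translation. -/

section Chain

variable {f : ℝ × ℝ × ℝ × ℝ → ℝ} {Ω : Set (ℝ × ℝ × ℝ × ℝ)} {x₀ : ℝ} {τ ξ : ℤ → ℝ}
  (hf : IsRegular f Ω) (ht : IsTrajectory f Ω x₀ τ ξ) (n : ℤ)

lemma represents_fieldX : Represents fieldX ((jetChain hf ht).X n) := represents_germX _
lemma represents_fieldK : Represents (fieldK f Ω) ((jetChain hf ht).K n) := represents_germK hf ht n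
lemma represents_fieldC1 : Represents (fieldC1 f Ω) ((jetChain hf ht).C1 n) :=
  (represents_fieldX hf ht n).bracket (represents_fieldK hf ht n)
lemma represents_fieldC2 : Represents (fieldC2 f Ω) ((jetChain hf ht).C2 n) :=
  (represents_fieldX hf ht n).bracket (represents_fieldC1 hf ht n)
lemma represents_fieldC3 : Represents (fieldC3 f Ω) ((jetChain hf ht).C3 n) :=
  (represents_fieldX hf ht n).bracket (represents_fieldC2 hf ht n)
lemma represents_fieldZ1 : Represents (fieldZ1 f Ω) ((jetChain hf ht).Z1 n) :=
  (represents_fieldK hf ht n).bracket (represents_fieldC1 hf ht n)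

lemma isCharRingBasis_C3_iff : IsCharRingBasis f Ω (trajJet x₀ τ ξ n)
      ![fieldX, fieldK f Ω, fieldC1 f Ω, fieldC2 f Ω, fieldC3 f Ω] ↔
    (jetChain hf ht).IsBasis n ((jetChain hf ht).famC n) := by
  have hC1 : CharRing f Ω (trajJet x₀ τ ξ n) (fieldC1 f Ω) := .comm .genX .genK
  have hC2 : CharRing f Ω (trajJet x₀ τ ξ n) (fieldC2 f Ω) := .comm .genX hC1
  have hC3 : CharRing f Ω (trajJet x₀ τ ξ n) (fieldC3 f Ω) := .comm .genX hC2
  refine isCharRingBasis_iff hf ht n (fun i => ?_) fun i => ?_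
  · fin_cases i
    exacts [.genX, .genK, hC1, hC2, hC3]
  · fin_cases i
    exacts [represents_fieldX hf ht n, represents_fieldK hf ht n, represents_fieldC1 hf ht n,
      represents_fieldC2 hf ht n, represents_fieldC3 hf ht n]

lemma isCharRingBasis_Z1_iff : IsCharRingBasis f Ω (trajJet x₀ τ ξ n)
      ![fieldX, fieldK f Ω, fieldC1 f Ω, fieldC2 f Ω, fieldZ1 f Ω] ↔
    (jetChain hf ht).IsBasis n ((jetChain hf ht).famZ n) := by
  have hC1 : CharRing f Ω (trajJet x₀ τ ξ n) (fieldC1 f Ω) := .comm .genX .genK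
  have hC2 : CharRing f Ω (trajJet x₀ τ ξ n) (fieldC2 f Ω) := .comm .genX hC1
  have hZ1 : CharRing f Ω (trajJet x₀ τ ξ n) (fieldZ1 f Ω) := .comm .genK hC1
  refine isCharRingBasis_iff hf ht n (fun i => ?_) fun i => ?_
  · fin_cases i
    exacts [.genX, .genK, hC1, hC2, hZ1]
  · fin_cases i
    exacts [represents_fieldX hf ht n, represents_fieldK hf ht n, represents_fieldC1 hf ht n,
      represents_fieldC2 hf ht n, represents_fieldZ1 hf ht n]

include hf ht in
lemma fieldZ1_eq (h : ∀ n, ZCondition f (trajJet x₀ τ ξ n)) (c : Coord) :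
    ∀ᶠ Q in 𝓝 (trajJet x₀ τ ξ n), fieldZ1 f Ω c Q =
      (wFun f Q - vFun f Q) / f_txtx f Q * fieldC2 f Ω c Q := by
  have h1 := (jetChain hf ht).zdep_of_zcond (fun n => (zCondition_iff hf ht n).1 (h n)) n
  have hZ : HasGerm (fieldZ1 f Ω c) _ :=
    ⟨_, ((represents_fieldZ1 hf ht n).apply_coord c).symm⟩
  have hC : HasGerm (fieldC2 f Ω c) _ :=
    ⟨_, ((represents_fieldC2 hf ht n).apply_coord c).symm⟩
  exact (hZ.eq_iff ((hasGerm_lam hf ht n).mul hC)).1 (DFunLike.congr_fun h1 _)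

end Chain

end SemiDiscrete

theorem mainTheorem2 (f : ℝ × ℝ × ℝ × ℝ → ℝ) (Ω : Set (ℝ × ℝ × ℝ × ℝ))
    (hΩ : IsOpen Ω) (hf : AnalyticOnNhd ℝ f Ω)
    (hinj : ∀ x t t₁ y y' : ℝ, (x, t, t₁, y) ∈ Ω → (x, t, t₁, y') ∈ Ω →
      f (x, t, t₁, y) = f (x, t, t₁, y') → y = y')
    (hf_tx : ∀ x t t₁ y : ℝ, (x, t, t₁, y) ∈ Ω → deriv (fun s => f (x, t, t₁, s)) y ≠ 0)
    (hf_txtx : ∀ x t t₁ y : ℝ, (x, t, t₁, y) ∈ Ω →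
      iteratedDeriv 2 (fun s => f (x, t, t₁, s)) y ≠ 0)
    (x₀ : ℝ) (τ ξ : ℤ → ℝ) (htraj : IsTrajectory f Ω x₀ τ ξ)
    (hconn : ∀ n : ℤ, (x₀, τ n, τ (n + 1), τ (n + 2), ξ n) ∈
      connectedComponentIn (twoStepDomain f Ω) (x₀, τ 0, τ 1, τ 2, ξ 0)) :
    ((IsCharRingBasis f Ω (trajJet x₀ τ ξ 0)
          ![fieldX, fieldK f Ω, fieldC1 f Ω, fieldC2 f Ω, fieldC3 f Ω] ∧
        ¬ IsCharRingBasis f Ω (trajJet x₀ τ ξ 0)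
          ![fieldX, fieldK f Ω, fieldC1 f Ω, fieldC2 f Ω, fieldZ1 f Ω]) ↔
      ((∀ n : ℤ, ZCondition f (trajJet x₀ τ ξ n)) ∧
        (∀ n : ℤ, (system2 f).Nondegenerate f Ω (trajJet x₀ τ ξ n) ∧
          (system3 f).Nondegenerate f Ω (trajJet x₀ τ ξ n)) ∧
        (∀ n : ℤ, (system2 f).Compatible f Ω (trajJet x₀ τ ξ n) ∧
          (system3 f).Compatible f Ω (trajJet x₀ τ ξ n)))) ∧
    ((∀ n : ℤ, ZCondition f (trajJet x₀ τ ξ n)) →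
      ∀ c, ∀ᶠ Q in 𝓝 (trajJet x₀ τ ξ 0), fieldZ1 f Ω c Q =
        (wFun f Q - vFun f Q) / f_txtx f Q * fieldC2 f Ω c Q) := by
  have hreg : IsRegular f Ω := ⟨hΩ, hf, hinj, hf_tx, hf_txtx⟩
  refine ⟨?_, fieldZ1_eq hreg htraj 0⟩
  obtain ⟨T₂, hM₂, hdel₂, hcomp₂⟩ := exists_system2 hreg htraj
  obtain ⟨T₃, hM₃, hdel₃, hcomp₃⟩ := exists_system3 hreg htraj
  rw [isCharRingBasis_C3_iff hreg htraj, isCharRingBasis_Z1_iff hreg htraj,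
    (jetChain hreg htraj).isBasis_iff T₂ T₃ (congrFun hM₂ 0) (congrFun hM₃ 0)
      fun n m => depCond_of_depCond hreg htraj hconn]
  simp only [zCondition_iff hreg htraj, hdel₂, hdel₃]
  -- Condition 3 is translated under condition 2, since its germ form requires nonzero determinants
  -- at sites n and n+1.
  refine and_congr_right fun _ => and_congr_right fun hdel => forall_congr' fun n => ?_
  rw [hcomp₂ n (hdel n).1 (hdel (n + 1)).1, hcomp₃ n (hdel n).2 (hdel (n + 1)).2]
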